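/- Let $g(x)=1-(1-x^2)^4$ for $|x|\le 1$, $g(x)=1$ for $|x|>1$, let $H(x,u)=\frac{u^2}{2}+g(x)$, and let $u_o(x)=-2$ for $x<0$, $u_o(x)=2$ for $x>0$. For every $(q_o,p_o)\in\mathbb R^2$ the system $\dot q=p$, $\dot p=-g'(q)$, $(q,p)(0)=(q_o,p_o)$, has a unique solution on $\mathbb R$; denote its value at time $t$ by $\mathcal F(t,q_o,p_o)=(\mathcal F_q,\mathcal F_p)(t,q_o,p_o)$, and put $q^\sharp(t)=\mathcal F_q(t,0,2)$. Let $D=([0,+\infty)\times\{2\})\cup(\{0\}\times(0,2])$. For all $t>0$ and $x>0$ there is a unique $\Delta(t,x)=(q_o,p_o)\in D$ such that $\mathcal F_q(t,q_o,p_o)=x$ and $\mathcal F_q(s,q_o,p_o)>0$ for all $s\in(0,t)$. For $t>0$ define $u(t,x)=\mathcal F_p(t,\Delta(t,x))$ if $x>0$ and $u(t,x)=-\mathcal F_p(t,\Delta(t,-x))$ if $x<0$. Then: 1. $u\in L^\infty((0,+\infty)\times\mathbb R)$, and $u$ is an entropy solution of $\partial_t u+\partial_x(H(x,u))=0$, $u(0,\cdot)=u_o$,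 in the following sense: for all $\phi\in C_c^\infty([0,+\infty)\times\mathbb R)$ with $\phi\ge 0$ and all $k\in\mathbb R$, $$\int_0^{+\infty}\!\!\int_{\mathbb R}|u-k|\,\partial_t\phi\,dx\,dt+\int_0^{+\infty}\!\!\int_{\mathbb R}\operatorname{sgn}(u-k)\,(H(x,u)-H(x,k))\,\partial_x\phi\,dx\,dt-\int_0^{+\infty}\!\!\int_{\mathbb R}\operatorname{sgn}(u-k)\,\partial_xH(x,k)\,\phi\,dx\,dt+\int_{\mathbb R}|u_o(x)-k|\,\phi(0,x)\,dx\ \ge 0 .$$ 2. $u$ is a classical solution outside $x=0$ and $|x|=q^\sharp(t)$: it is of class $C^1$ on the set $\{(t,x): t>0,\ x\neq0,\ |x|\ne q^\sharp(t)\}$ and satisfies $\partial_tu+\partial_x(H(x,u))=0$ there; moreover $\lim_{t\to0+}u(t,x)=u_o(x)$ for all $x\neq0$. 3. $u$ is continuous at every point $(t,x)$ with $t>0$ and $|x|=q^\sharp(t)$. 4. $u$ has a stationary entropic shock along $x=0$ for $t>\pi/(2\sqrt2)$: for every such $t$ the limits $u(t,0\pm)$ of $u$ at $(t,0)$ from $\{x>0\}$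 and from $\{x<0\}$ exist and are different, they satisfy the Rankine–Hugoniot condition with zero speed $H(0,u(t,0-))=H(0,u(t,0+))$, and the Lax entropy inequalities $\partial_uH(0,u(t,0+))<0<\partial_uH(0,u(t,0-))$. -/

import Mathlib

open MeasureTheory Set Filter Topology
open scoped ContDiff

noncomputable section

namespace ScalarCL

/-- A trajectory, defined for all times, of the Hamiltonian system
`q' = ∂_u H (q, p)`, `p' = - ∂_x H (q, p)`; here `γ t = (q t, p t)`. -/
def IsHamiltonianTrajectory (H : ℝ → ℝ → ℝ) (γ : ℝ → ℝ × ℝ) : Prop :=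
  ∀ t, HasDerivAt γ
    (deriv (fun w => H (γ t).1 w) (γ t).2, -deriv (fun y => H y (γ t).2) (γ t).1) t

/-- The Hamiltonian flow `F (t, z)`: the value at time `t` of the trajectory starting from
`z = (q₀, p₀)` at time `0`. -/
def flow (H : ℝ → ℝ → ℝ) (t : ℝ) (z : ℝ × ℝ) : ℝ × ℝ :=
  Classical.epsilon (fun γ : ℝ → ℝ × ℝ => IsHamiltonianTrajectory H γ ∧ γ 0 = z) t

/-- Bounded entropy solutions of `∂_t u + ∂_x (H (x, u)) = 0`, `u (0, ·) = u₀`, for `H` of class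
`C¹`. A test function is the restriction to `[0, ∞) × ℝ` of a smooth compactly supported function
on `ℝ × ℝ` and is nonnegative on `[0, ∞) × ℝ`. -/
structure IsEntropySolution (H : ℝ → ℝ → ℝ) (u₀ : ℝ → ℝ) (u : ℝ → ℝ → ℝ) : Prop where
  datum_bounded : MemLp u₀ ⊤ volume
  bounded : MemLp (fun z : ℝ × ℝ => u z.1 z.2) ⊤
    (volume.restrict (Ioi (0 : ℝ) ×ˢ (univ : Set ℝ)))
  entropy : ∀ φ : ℝ × ℝ → ℝ, ContDiff ℝ ∞ φ → HasCompactSupport φ →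
    (∀ t x, 0 ≤ t → 0 ≤ φ (t, x)) → ∀ k : ℝ,
    0 ≤ (∫ t in Ioi (0 : ℝ), ∫ x : ℝ, |u t x - k| * deriv (fun s => φ (s, x)) t)
      + (∫ t in Ioi (0 : ℝ), ∫ x : ℝ,
          Real.sign (u t x - k) * (H x (u t x) - H x k) * deriv (fun y => φ (t, y)) x)
      - (∫ t in Ioi (0 : ℝ), ∫ x : ℝ,
          Real.sign (u t x - k) * deriv (fun y => H y k) x * φ (t, x))
      + ∫ x : ℝ, |u₀ x - k| * φ (0, x)

/-- Near `(t, x)` the function `u` is of class `C¹`, and at `(t, x)` the equation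
`∂_t u + ∂_x (H (x, u)) = 0` holds. -/
def IsClassicalSolutionAt (H : ℝ → ℝ → ℝ) (u : ℝ → ℝ → ℝ) (t x : ℝ) : Prop :=
  ContDiffAt ℝ 1 (fun z : ℝ × ℝ => u z.1 z.2) (t, x) ∧
    deriv (fun s => u s x) t + deriv (fun y => H y (u t y)) x = 0

/-- At time `t`, the function `u` has a stationary entropic shock at `ξ`: the traces on the two
sides of the line `x = ξ` exist at `(t, ξ)` (as limits in space-time) and are different, the
Rankine-Hugoniot condition holds with speed zero, and so do the Lax entropy inequalities. -/
def HasStationaryEntropicShock (H : ℝ → ℝ → ℝ) (u : ℝ → ℝ → ℝ) (t ξ : ℝ) : Prop :=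
  ∃ um up : ℝ,
    Tendsto (fun z : ℝ × ℝ => u z.1 z.2) (𝓝[{z | z.2 < ξ}] (t, ξ)) (𝓝 um) ∧
    Tendsto (fun z : ℝ × ℝ => u z.1 z.2) (𝓝[{z | ξ < z.2}] (t, ξ)) (𝓝 up) ∧
    um ≠ up ∧
    H ξ um = H ξ up ∧
    deriv (fun w => H ξ w) up < 0 ∧ 0 < deriv (fun w => H ξ w) um

/-- The potential. -/
def g (x : ℝ) : ℝ := if |x| ≤ 1 then 1 - (1 - x ^ 2) ^ 4 else 1

/-- The Hamiltonian `u² / 2 + g x`. -/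
def ham (x u : ℝ) : ℝ := u ^ 2 / 2 + g x

/-- The initial datum; its value at the single point `0` is immaterial. -/
def datum (x : ℝ) : ℝ := if x < 0 then -2 else 2

/-- The rightmost ray of the fan issuing from the origin. -/
def qSharp (t : ℝ) : ℝ := (flow ham t (0, 2)).1

/-- The set of starting points `(q₀, p₀)`. -/
def startSet : Set (ℝ × ℝ) := (Ici (0 : ℝ) ×ˢ {2}) ∪ ({0} ×ˢ Ioc (0 : ℝ) 2)

/-- The trajectory issuing from `d` in the set of starting points reaches the position `x` at time
`t`, and its position is positive at all times in `(0, t)`. -/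
def IsStartingPoint (t x : ℝ) (d : ℝ × ℝ) : Prop :=
  d ∈ startSet ∧ (flow ham t d).1 = x ∧ ∀ s ∈ Ioo (0 : ℝ) t, 0 < (flow ham s d).1

/-- The map `Δ`. It is meaningful for `t > 0` and `x > 0`. -/
def start (t x : ℝ) : ℝ × ℝ := Classical.epsilon (IsStartingPoint t x)

/-- The explicit function, meaningful for `t > 0` and `x ≠ 0`. Its value on the null set `x = 0`
is immaterial. -/
def sol (t x : ℝ) : ℝ :=
  if 0 < x then (flow ham t (start t x)).2
  else if x < 0 then -(flow ham t (start t (-x))).2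
  else 0

end ScalarCL

end

/-! For x > 0 the function u is the velocity field of the trajectories issuing from D, so the main
point is that the trajectories staying positive up to time t reach every x > 0 exactly once. The two
pieces of D are joined into one family `ray s`, s > -2: the fan (0, 2 + s) for s ≤ 0, the half-line
(s, 2) for s ≥ 0. Among admissible parameters the position at time t is strictly increasing in s. On
the half-line the energy is at least 2, above the maximum 1 of the potential, so there are no
turning points and travel times can be compared (`straight_sub_ge`). In the fan the potential is a
softening spring: g'(x)/x decreases for x > 0, so the Wronskian of a slower and a faster trajectory
is nondecreasing. Hence the ratio of their positions never drops below the ratio of their initial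
speeds (`fan_ratio_le`), and the faster one is still positive when the slower one first returns to 0
(`fan_pos`). The admissible parameters therefore form an open half-line above `threshold t`, where
the position is 0, and the intermediate value theorem gives `existsUnique_param`.

The flow is C¹ along each line of initial points and the position has positive derivative in s, so
the inverse function theorem gives regularity off the curve |x| = q♯(t) (`sol_regular_of_branch`).
The curve itself corresponds to the corner s = 0 of D; there monotonicity alone still gives
continuity (`continuousAt_param`).

The trace at x = 0+ is the velocity at the threshold. It is nonpositive because that trajectory
arrives at 0 from the right, and negative unless the threshold is -2, the equilibrium. Sturm
comparison with sin(wr), w < 2√2 = √(g''(0)), excludes -2 once t exceeds the half-period of the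
linearization (`neg_two_lt_threshold`). Oddness of u then gives opposite traces, hence
Rankine–Hugoniot and Lax.

For the entropy inequality, u is continuous and piecewise C¹ in the open quadrant, so entropies are
balanced exactly there, up to boundary terms. Smoothing |w - k|, exhausting the quadrant by
rectangles and reflecting the left half-plane leave on x = 0 only `kruzkovFlux k w + kruzkovFlux
(-k) w` with w the trace, which is nonpositive since w ≤ 0 (`kruzkovFlux_add_nonpos`). -/

namespace ScalarCL
open scoped NNReal

/-! ### Global solutions of Lipschitz differential equations -/

section Global

variable {E : Type*} [NormedAddCommGroup E] [NormedSpace ℝ E]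

/-- An integral over `[0, t]` is controlled by `cosh`, when the integrand is. -/
theorem norm_integral_le_cosh {f : ℝ → E} {B c : ℝ} (hc : 0 < c)
    (h : ∀ s, ‖f s‖ ≤ B * Real.cosh (c * s)) (t : ℝ) :
    ‖∫ s in (0 : ℝ)..t, f s‖ ≤ B / c * Real.cosh (c * t) := by
  have hB : 0 ≤ B := by
    have := (norm_nonneg _).trans (h 0)
    simpa using this
  have hint : ∫ s in (0 : ℝ)..t, B * Real.cosh (c * s) = B / c * Real.sinh (c * t) := by
    have hd : ∀ s ∈ uIcc 0 t,
        HasDerivAt (fun s => B / c * Real.sinh (c * s)) (B * Real.cosh (c * s)) s := by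
      intro s _
      have := (((hasDerivAt_id s).const_mul c).sinh).const_mul (B / c)
      refine this.congr_deriv ?_
      simp only [id]
      field_simp
    rw [intervalIntegral.integral_eq_sub_of_hasDerivAt hd]
    · simp
    · exact (by fun_prop : Continuous fun s => B * Real.cosh (c * s)).intervalIntegrable _ _
  calc ‖∫ s in (0 : ℝ)..t, f s‖
      ≤ |∫ s in (0 : ℝ)..t, B * Real.cosh (c * s)| :=
        intervalIntegral.norm_integral_le_abs_of_norm_le
          (Eventually.of_forall fun s => h s)
          ((by fun_prop : Continuous fun s => B * Real.cosh (c * s)).intervalIntegrable _ _)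
    _ = B / c * |Real.sinh (c * t)| := by
        rw [hint, abs_mul, abs_of_nonneg (by positivity)]
    _ ≤ B / c * Real.cosh (c * t) := by
        gcongr
        rw [Real.abs_sinh, ← Real.cosh_abs]
        exact Real.sinh_lt_cosh _ |>.le

open scoped BoundedContinuousFunction in
/-- **Global existence** for a differential equation whose right-hand side is Lipschitz in space. -/
theorem exists_forall_hasDerivAt_of_lipschitz [CompleteSpace E] {v : ℝ → E → E} {K : ℝ≥0}
    (hv : ∀ t, LipschitzWith K (v t)) (hc : Continuous fun z : ℝ × E => v z.1 z.2) {x₀ : E} {C : ℝ}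
    (hC : ∀ t, ‖v t x₀‖ ≤ C) :
    ∃ γ : ℝ → E, γ 0 = x₀ ∧ ∀ t, HasDerivAt γ (v t (γ t)) t := by
  -- The unknown is written x₀ + cosh(ct) z(t) with z bounded. In this weighted norm the Picard map
  -- on the whole line has Lipschitz constant K / c, and this c makes it at most 1/2.
  set c : ℝ := 2 * K + 1 with hc_def
  have hcpos : 0 < c := by positivity
  have hcosh : ∀ t : ℝ, 0 < Real.cosh (c * t) := fun t => Real.cosh_pos _
  have hcont : ∀ z : ℝ →ᵇ E, Continuous fun s => v s (x₀ + Real.cosh (c * s) • z s) := fun z =>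
    hc.comp (continuous_id.prodMk (continuous_const.add
      ((Real.continuous_cosh.comp (continuous_const.mul continuous_id)).smul z.continuous)))
  have hint : ∀ z : ℝ →ᵇ E, ∀ t : ℝ, HasDerivAt
      (fun t => ∫ s in (0 : ℝ)..t, v s (x₀ + Real.cosh (c * s) • z s))
      (v t (x₀ + Real.cosh (c * t) • z t)) t := fun z t =>
    intervalIntegral.integral_hasDerivAt_right ((hcont z).intervalIntegrable _ _)
      (hcont z).stronglyMeasurable.stronglyMeasurableAtFilter (hcont z).continuousAt
  have hbound : ∀ (z : ℝ →ᵇ E) (s : ℝ), ‖v s (x₀ + Real.cosh (c * s) • z s)‖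
      ≤ (C + K * ‖z‖) * Real.cosh (c * s) := by
    intro z s
    have h1 : ‖v s (x₀ + Real.cosh (c * s) • z s) - v s x₀‖ ≤ K * (Real.cosh (c * s) * ‖z‖) := by
      refine ((hv s).norm_sub_le _ _).trans ?_
      rw [add_sub_cancel_left, norm_smul, Real.norm_of_nonneg (hcosh s).le]
      gcongr
      exact z.norm_coe_le_norm s
    have h2 := norm_le_norm_add_norm_sub' (v s (x₀ + Real.cosh (c * s) • z s)) (v s x₀)
    have h3 : (1 : ℝ) ≤ Real.cosh (c * s) := Real.one_le_cosh _
    have h4 : 0 ≤ C := (norm_nonneg _).trans (hC 0)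
    nlinarith [hC s]
  let N : (ℝ →ᵇ E) → (ℝ →ᵇ E) := fun z => BoundedContinuousFunction.ofNormedAddCommGroup
    (fun t => (Real.cosh (c * t))⁻¹ • ∫ s in (0 : ℝ)..t, v s (x₀ + Real.cosh (c * s) • z s))
    (((Real.continuous_cosh.comp (continuous_const.mul continuous_id)).inv₀
      fun t => (hcosh t).ne').smul
      (continuous_iff_continuousAt.2 fun t => (hint z t).continuousAt))
    ((C + K * ‖z‖) / c) (fun t => by
      have := norm_integral_le_cosh hcpos (hbound z) t
      rw [norm_smul, norm_inv, Real.norm_of_nonneg (hcosh t).le, inv_mul_le_iff₀ (hcosh t)]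
      linarith)
  have hN : ContractingWith (1 / 2) N := by
    refine ⟨by rw [← NNReal.coe_lt_coe]; norm_num, LipschitzWith.of_dist_le_mul fun z w => ?_⟩
    rw [BoundedContinuousFunction.dist_le (by positivity)]
    intro t
    have h1 : ∀ s, ‖v s (x₀ + Real.cosh (c * s) • z s) - v s (x₀ + Real.cosh (c * s) • w s)‖
        ≤ (K * dist z w) * Real.cosh (c * s) := by
      intro s
      refine ((hv s).norm_sub_le _ _).trans ?_
      rw [add_sub_add_left_eq_sub, ← smul_sub, norm_smul, Real.norm_of_nonneg (hcosh s).le,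
        ← dist_eq_norm]
      have := z.dist_coe_le_dist (g := w) s
      have h5 := mul_le_mul_of_nonneg_left this (hcosh s).le
      nlinarith [K.2, mul_le_mul_of_nonneg_left h5 K.2]
    have h2 := norm_integral_le_cosh hcpos h1 t
    rw [intervalIntegral.integral_sub ((hcont z).intervalIntegrable _ _)
      ((hcont w).intervalIntegrable _ _)] at h2
    change dist ((Real.cosh (c * t))⁻¹ • ∫ s in (0 : ℝ)..t, v s (x₀ + Real.cosh (c * s) • z s))
      ((Real.cosh (c * t))⁻¹ • ∫ s in (0 : ℝ)..t, v s (x₀ + Real.cosh (c * s) • w s)) ≤ _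
    rw [dist_eq_norm, ← smul_sub, norm_smul, norm_inv, Real.norm_of_nonneg (hcosh t).le,
      inv_mul_le_iff₀ (hcosh t)]
    refine h2.trans ?_
    have h3 : (K : ℝ) * dist z w / c ≤ ((1 / 2 : ℝ≥0) : ℝ) * dist z w := by
      rw [div_le_iff₀ hcpos]
      have : 0 ≤ dist z w := dist_nonneg
      push_cast
      nlinarith [K.2]
    rw [mul_comm (Real.cosh (c * t))]
    exact mul_le_mul_of_nonneg_right h3 (hcosh t).le
  set z := hN.fixedPoint N with hz
  have hfix : N z = z := hN.fixedPoint_isFixedPt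
  have hval : ∀ t, Real.cosh (c * t) • z t
      = ∫ s in (0 : ℝ)..t, v s (x₀ + Real.cosh (c * s) • z s) := by
    intro t
    have : (Real.cosh (c * t))⁻¹ • (∫ s in (0 : ℝ)..t, v s (x₀ + Real.cosh (c * s) • z s)) = z t :=
      DFunLike.congr_fun hfix t
    rw [← this, smul_inv_smul₀ (hcosh t).ne']
  refine ⟨fun t => x₀ + Real.cosh (c * t) • z t, ?_, fun t => ?_⟩
  · change x₀ + Real.cosh (c * 0) • z 0 = x₀
    rw [hval, intervalIntegral.integral_same, add_zero]
  · have h := (hint z t).const_add x₀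
    refine h.congr_of_eventuallyEq (Eventually.of_forall fun s => ?_)
    change x₀ + Real.cosh (c * s) • z s = _
    rw [hval]

end Global

/-! ### The potential -/

/-- With exponent at least 2 the truncation at 0 does not affect differentiability. This lets `g`
and its first two derivatives be differentiated as formulas in `max (1 - x ^ 2) 0`, without
splitting at |x| = 1. -/
theorem hasDerivAt_max_pow (n : ℕ) (x : ℝ) :
    HasDerivAt (fun y : ℝ => max y 0 ^ (n + 2)) ((n + 2) * max x 0 ^ (n + 1)) x := by
  rcases lt_trichotomy x 0 with hx | rfl | hx
  · rw [max_eq_right hx.le]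
    have : (fun y : ℝ => max y 0 ^ (n + 2)) =ᶠ[𝓝 x] fun _ => 0 := by
      filter_upwards [Iio_mem_nhds hx] with y hy
      rw [max_eq_right (le_of_lt hy)]; simp
    simpa using (hasDerivAt_const x (0 : ℝ)).congr_of_eventuallyEq this
  · have h : (fun y : ℝ => max y 0 ^ (n + 2)) =O[𝓝 0] fun y => y ^ (n + 2) := by
      refine Asymptotics.isBigO_of_le _ fun y => ?_
      rw [norm_pow, norm_pow]
      gcongr
      rw [Real.norm_eq_abs, Real.norm_eq_abs]
      rcases le_total y 0 with hy | hy <;> simp [hy]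
    rw [hasDerivAt_iff_isLittleO]
    simp only [max_self, ne_eq, Nat.add_eq_zero_iff, OfNat.ofNat_ne_zero, one_ne_zero, and_false,
      not_false_eq_true, zero_pow, sub_zero, mul_zero, smul_zero]
    refine h.trans_isLittleO ?_
    simpa using (Asymptotics.isLittleO_pow_pow (𝕜 := ℝ) (m := 1) (n := n + 2) (by omega))
  · rw [max_eq_left hx.le]
    have : (fun y : ℝ => max y 0 ^ (n + 2)) =ᶠ[𝓝 x] fun y => y ^ (n + 2) := by
      filter_upwards [Ioi_mem_nhds hx] with y hy
      rw [max_eq_left (le_of_lt hy)]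
    refine HasDerivAt.congr_of_eventuallyEq ?_ this
    simpa using hasDerivAt_pow (n + 2) x

/-- The ratio `g' x / x`. -/
noncomputable def stiffness (x : ℝ) : ℝ := 8 * max (1 - x ^ 2) 0 ^ 3

/-- The derivative of the potential. -/
noncomputable def force (x : ℝ) : ℝ := stiffness x * x

/-- The second derivative of the potential. -/
noncomputable def forceDeriv (x : ℝ) : ℝ :=
  8 * max (1 - x ^ 2) 0 ^ 3 - 48 * x ^ 2 * max (1 - x ^ 2) 0 ^ 2

theorem g_eq (x : ℝ) : g x = 1 - max (1 - x ^ 2) 0 ^ 4 := by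
  unfold g
  split_ifs with h
  · have : x ^ 2 ≤ 1 := (sq_le_one_iff_abs_le_one x).2 h
    rw [max_eq_left (by linarith)]
  · have : 1 ≤ x ^ 2 := by
      have := (one_lt_sq_iff_one_lt_abs x).2 (not_le.1 h)
      exact this.le
    rw [max_eq_right (by linarith)]; norm_num

theorem g_zero : g 0 = 0 := by simp [g]

theorem max_one_sub_sq_mem (x : ℝ) : max (1 - x ^ 2) 0 ∈ Icc (0 : ℝ) 1 :=
  ⟨le_max_right _ _, max_le (by nlinarith [sq_nonneg x]) zero_le_one⟩

theorem g_nonneg (x : ℝ) : 0 ≤ g x := by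
  rw [g_eq]
  have := max_one_sub_sq_mem x
  linarith [pow_le_one₀ this.1 this.2 (n := 4)]

theorem g_le_one (x : ℝ) : g x ≤ 1 := by
  rw [g_eq]
  have := max_one_sub_sq_mem x
  linarith [pow_nonneg this.1 4]

theorem hasDerivAt_g (x : ℝ) : HasDerivAt g (force x) x := by
  have h1 : HasDerivAt (fun x : ℝ => 1 - x ^ 2) (-(2 * x)) x := by
    simpa using (hasDerivAt_pow 2 x).const_sub 1
  have h2 := ((hasDerivAt_max_pow 2 (1 - x ^ 2)).comp x h1).const_sub 1
  rw [show g = fun x => 1 - max (1 - x ^ 2) 0 ^ 4 from funext g_eq]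
  refine HasDerivAt.congr_deriv h2 ?_
  simp only [force, stiffness]
  push_cast
  ring

theorem hasDerivAt_force (x : ℝ) : HasDerivAt force (forceDeriv x) x := by
  have h1 : HasDerivAt (fun x : ℝ => 1 - x ^ 2) (-(2 * x)) x := by
    simpa using (hasDerivAt_pow 2 x).const_sub 1
  have h2 := (((hasDerivAt_max_pow 1 (1 - x ^ 2)).comp x h1).const_mul 8).mul (hasDerivAt_id x)
  refine HasDerivAt.congr_deriv h2 ?_
  simp only [forceDeriv, Function.comp, id]
  push_cast
  ring

/-- The positive part vanishes where x² > 1, which keeps the polynomial factors of `forceDeriv`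
bounded on the whole line. -/
theorem max_one_sub_sq_mul_sq (x : ℝ) : max (1 - x ^ 2) 0 * x ^ 2 ≤ max (1 - x ^ 2) 0 := by
  rcases le_total (1 - x ^ 2) 0 with h | h
  · simp [max_eq_right h]
  · rw [max_eq_left h]; nlinarith [sq_nonneg x]

theorem abs_forceDeriv_le (x : ℝ) : |forceDeriv x| ≤ 60 := by
  unfold forceDeriv
  have h := max_one_sub_sq_mem x
  have h2 := max_one_sub_sq_mul_sq x
  set m := max (1 - x ^ 2) 0
  have h3 : m ^ 3 ≤ 1 := pow_le_one₀ h.1 h.2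
  have h4 : 0 ≤ m ^ 3 := pow_nonneg h.1 _
  have h5 : x ^ 2 * m ^ 2 ≤ 1 := by nlinarith [h.1, h.2, mul_nonneg h.1 (sq_nonneg x)]
  have h6 : 0 ≤ x ^ 2 * m ^ 2 := by positivity
  rw [abs_le]; constructor <;> nlinarith

theorem hasDerivAt_forceDeriv (x : ℝ) : HasDerivAt forceDeriv
    (-144 * x * max (1 - x ^ 2) 0 ^ 2 + 192 * x ^ 3 * max (1 - x ^ 2) 0) x := by
  have h1 : HasDerivAt (fun x : ℝ => 1 - x ^ 2) (-(2 * x)) x := by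
    simpa using (hasDerivAt_pow 2 x).const_sub 1
  have h2 := (((hasDerivAt_max_pow 1 (1 - x ^ 2)).comp x h1).const_mul 8).sub
    (((hasDerivAt_pow 2 x).const_mul 48).mul ((hasDerivAt_max_pow 0 (1 - x ^ 2)).comp x h1))
  refine HasDerivAt.congr_deriv h2 ?_
  simp only [Function.comp]
  push_cast
  ring

theorem abs_deriv_forceDeriv_le (x : ℝ) :
    |-144 * x * max (1 - x ^ 2) 0 ^ 2 + 192 * x ^ 3 * max (1 - x ^ 2) 0| ≤ 336 := by
  rcases le_total (1 - x ^ 2) 0 with h | h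
  · simp [max_eq_right h]
  · have hx : |x| ≤ 1 := (sq_le_one_iff_abs_le_one x).1 (by linarith)
    have hm := max_one_sub_sq_mem x
    set m := max (1 - x ^ 2) 0
    have hx3 : |x| ^ 3 ≤ 1 := pow_le_one₀ (abs_nonneg x) hx
    have hm2 : m ^ 2 ≤ 1 := pow_le_one₀ hm.1 hm.2
    have h1 : |-144 * x * m ^ 2| ≤ 144 := by
      rw [abs_mul, abs_mul, abs_of_nonneg (sq_nonneg m)]
      norm_num
      nlinarith [abs_nonneg x, sq_nonneg m]
    have h2 : |192 * x ^ 3 * m| ≤ 192 := by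
      rw [abs_mul, abs_mul, abs_pow, abs_of_nonneg hm.1]
      norm_num
      nlinarith [pow_nonneg (abs_nonneg x) 3, hm.1, hm.2]
    exact (abs_add_le _ _).trans (by linarith)

theorem abs_forceDeriv_sub_le (x y : ℝ) : |forceDeriv x - forceDeriv y| ≤ 336 * |x - y| := by
  have := Convex.norm_image_sub_le_of_norm_hasDerivWithin_le (f := forceDeriv) (s := univ)
    (fun x _ => (hasDerivAt_forceDeriv x).hasDerivWithinAt)
    (fun x _ => abs_deriv_forceDeriv_le x) convex_univ (mem_univ y) (mem_univ x)
  simpa using this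

theorem continuous_forceDeriv : Continuous forceDeriv :=
  continuous_iff_continuousAt.2 fun x => (hasDerivAt_forceDeriv x).continuousAt

theorem continuous_force : Continuous force :=
  continuous_iff_continuousAt.2 fun x => (hasDerivAt_force x).continuousAt

theorem continuous_g : Continuous g :=
  continuous_iff_continuousAt.2 fun x => (hasDerivAt_g x).continuousAt

theorem abs_force_sub_le (x y : ℝ) : |force x - force y| ≤ 60 * |x - y| := by
  have := Convex.norm_image_sub_le_of_norm_hasDerivWithin_le (f := force) (s := univ)
    (fun x _ => (hasDerivAt_force x).hasDerivWithinAt)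
    (fun x _ => abs_forceDeriv_le x) convex_univ (mem_univ y) (mem_univ x)
  simpa using this

/-- The first-order Taylor expansion of the force. -/
theorem abs_force_sub_sub_le (x y : ℝ) :
    |force y - force x - forceDeriv x * (y - x)| ≤ 336 * |y - x| ^ 2 := by
  have hd : ∀ z ∈ uIcc x y, HasDerivWithinAt (fun z => force z - forceDeriv x * z)
      (forceDeriv z - forceDeriv x) (uIcc x y) z := by
    intro z _
    have := (hasDerivAt_force z).sub ((hasDerivAt_id z).const_mul (forceDeriv x))
    rw [mul_one] at this
    exact this.hasDerivWithinAt
  have := Convex.norm_image_sub_le_of_norm_hasDerivWithin_le (C := 336 * |y - x|) hd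
    (fun z hz => by
      refine (abs_forceDeriv_sub_le z x).trans ?_
      exact mul_le_mul_of_nonneg_left (abs_sub_left_of_mem_uIcc hz) (by norm_num))
    (convex_uIcc x y) left_mem_uIcc right_mem_uIcc
  rw [Real.norm_eq_abs, Real.norm_eq_abs] at this
  calc _ = |force y - forceDeriv x * y - (force x - forceDeriv x * x)| := by ring_nf
    _ ≤ _ := this
    _ = _ := by ring

theorem abs_force_le (x : ℝ) : |force x| ≤ 8 := by
  unfold force stiffness
  have h := max_one_sub_sq_mem x
  rcases le_total (1 - x ^ 2) 0 with h' | h'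
  · simp [max_eq_right h']
  · have hx : |x| ≤ 1 := (sq_le_one_iff_abs_le_one x).1 (by linarith)
    set m := max (1 - x ^ 2) 0
    rw [abs_mul, abs_of_nonneg (by have := h.1; positivity)]
    have h3 : m ^ 3 ≤ 1 := pow_le_one₀ h.1 h.2
    nlinarith [abs_nonneg x, pow_nonneg h.1 3]

theorem force_neg (x : ℝ) : force (-x) = -force x := by simp [force, stiffness]

/-- The softening of the spring: the one property of the nonlinearity behind the ordering of the
fan. -/
theorem stiffness_anti {x y : ℝ} (hx : 0 ≤ x) (h : x ≤ y) : stiffness y ≤ stiffness x := by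
  unfold stiffness
  gcongr

theorem deriv_ham_snd (x u : ℝ) : deriv (fun w => ham x w) u = u := by
  have : HasDerivAt (fun w => ham x w) u u := by
    have := ((hasDerivAt_pow 2 u).div_const 2).add_const (g x)
    refine HasDerivAt.congr_deriv this ?_
    simp
  exact this.deriv

theorem deriv_ham_fst (x u : ℝ) : deriv (fun y => ham y u) x = force x :=
  ((hasDerivAt_g x).const_add (u ^ 2 / 2)).deriv

/-! ### The Hamiltonian flow -/

/-- The Hamiltonian vector field. -/
noncomputable def hamField (z : ℝ × ℝ) : ℝ × ℝ := (z.2, -force z.1)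

theorem isHamiltonianTrajectory_iff {γ : ℝ → ℝ × ℝ} :
    IsHamiltonianTrajectory ham γ ↔ ∀ t, HasDerivAt γ (hamField (γ t)) t := by
  simp only [IsHamiltonianTrajectory, deriv_ham_snd, deriv_ham_fst, hamField]

theorem lipschitzWith_hamField : LipschitzWith 60 hamField := by
  refine LipschitzWith.of_dist_le_mul fun z w => ?_
  have h1 : |z.1 - w.1| ≤ dist z w := by
    rw [← Real.dist_eq]; exact le_max_left _ _
  have h2 : |z.2 - w.2| ≤ dist z w := by
    rw [← Real.dist_eq]; exact le_max_right _ _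
  refine max_le ?_ ?_
  · simp only [hamField, Real.dist_eq, NNReal.coe_ofNat]
    linarith [dist_nonneg (x := z) (y := w)]
  · simp only [hamField, Real.dist_eq, NNReal.coe_ofNat]
    rw [neg_sub_neg, abs_sub_comm]
    linarith [abs_force_sub_le z.1 w.1]

theorem existsUnique_trajectory (z : ℝ × ℝ) :
    ∃! γ : ℝ → ℝ × ℝ, IsHamiltonianTrajectory ham γ ∧ γ 0 = z := by
  obtain ⟨γ, h0, hγ⟩ := exists_forall_hasDerivAt_of_lipschitz (v := fun _ => hamField)
    (fun _ => lipschitzWith_hamField) (lipschitzWith_hamField.continuous.comp continuous_snd)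
    (x₀ := z) (fun _ => le_rfl)
  refine ⟨γ, ⟨isHamiltonianTrajectory_iff.2 hγ, h0⟩, ?_⟩
  rintro δ ⟨hδ, hδ0⟩
  rw [isHamiltonianTrajectory_iff] at hδ
  exact ODE_solution_unique_univ (v := fun _ => hamField) (s := fun _ => univ) (t₀ := 0)
    (fun _ => lipschitzWith_hamField.lipschitzOnWith) (fun t => ⟨hδ t, mem_univ _⟩)
    (fun t => ⟨hγ t, mem_univ _⟩) (by rw [hδ0, h0])

theorem flow_spec (z : ℝ × ℝ) :
    IsHamiltonianTrajectory ham (fun t => flow ham t z) ∧ flow ham 0 z = z :=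
  Classical.epsilon_spec (p := fun γ : ℝ → ℝ × ℝ => IsHamiltonianTrajectory ham γ ∧ γ 0 = z)
    (existsUnique_trajectory z).exists

theorem flow_zero (z : ℝ × ℝ) : flow ham 0 z = z := (flow_spec z).2

theorem hasDerivAt_flow (z : ℝ × ℝ) (t : ℝ) :
    HasDerivAt (fun t => flow ham t z) (hamField (flow ham t z)) t :=
  isHamiltonianTrajectory_iff.1 (flow_spec z).1 t

theorem continuous_flow_time (z : ℝ × ℝ) : Continuous fun t => flow ham t z :=
  continuous_iff_continuousAt.2 fun t => (hasDerivAt_flow z t).continuousAt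

theorem hasDerivAt_flow_fst (z : ℝ × ℝ) (t : ℝ) :
    HasDerivAt (fun t => (flow ham t z).1) (flow ham t z).2 t :=
  (hasDerivAt_flow z t).fst

theorem hasDerivAt_flow_snd (z : ℝ × ℝ) (t : ℝ) :
    HasDerivAt (fun t => (flow ham t z).2) (-force (flow ham t z).1) t :=
  (hasDerivAt_flow z t).snd

theorem ham_flow (z : ℝ × ℝ) (t : ℝ) :
    ham (flow ham t z).1 (flow ham t z).2 = ham z.1 z.2 := by
  have hd : ∀ t, HasDerivAt (fun t => ham (flow ham t z).1 (flow ham t z).2) 0 t := by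
    intro t
    have h := (((hasDerivAt_flow_snd z t).pow 2).div_const 2).add
      ((hasDerivAt_g _).comp t (hasDerivAt_flow_fst z t))
    refine HasDerivAt.congr_deriv h ?_
    push_cast
    ring
  have := is_const_of_deriv_eq_zero (fun t => (hd t).differentiableAt) (fun t => (hd t).deriv) t 0
  simpa only [flow_zero] using this

/-- The origin is an equilibrium, and uniqueness is applied with initial time t. It will exclude
trajectories touching the position 0 with zero velocity. -/
theorem flow_eq_zero {z : ℝ × ℝ} {t : ℝ} (h : flow ham t z = 0) : z = 0 := by
  have h0 : ∀ t : ℝ, HasDerivAt (fun _ : ℝ => (0 : ℝ × ℝ)) (hamField 0) t := by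
    intro t
    have : hamField 0 = 0 := by ext <;> simp [hamField, force]
    rw [this]
    exact hasDerivAt_const _ _
  have := ODE_solution_unique_univ (v := fun _ => hamField) (s := fun _ => univ) (t₀ := t)
    (fun _ => lipschitzWith_hamField.lipschitzOnWith)
    (fun t => ⟨hasDerivAt_flow z t, mem_univ _⟩) (fun t => ⟨h0 t, mem_univ _⟩) h
  simpa [flow_zero] using congrFun this 0

theorem dist_flow_le (z w : ℝ × ℝ) {t : ℝ} (ht : 0 ≤ t) :
    dist (flow ham t z) (flow ham t w) ≤ dist z w * Real.exp (60 * t) := by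
  have := dist_le_of_trajectories_ODE (v := fun _ => hamField) (K := 60) (a := 0) (b := t)
    (δ := dist z w) (fun _ => lipschitzWith_hamField) (continuous_flow_time z).continuousOn
    (fun s _ => (hasDerivAt_flow z s).hasDerivWithinAt) (continuous_flow_time w).continuousOn
    (fun s _ => (hasDerivAt_flow w s).hasDerivWithinAt)
    (by simp only [flow_zero]; exact le_rfl) t ⟨ht, le_rfl⟩
  simpa using this

/-- A family of continuous curves which is Lipschitz with respect to the parameter is jointly
continuous. -/
theorem continuousAt_uncurry_of_lipschitz {α : Type*} [PseudoMetricSpace α] {F : ℝ → α → ℝ × ℝ}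
    (hF : ∀ z, Continuous fun t => F t z)
    (hL : ∀ T, ∃ L : ℝ≥0, ∀ t ∈ Icc 0 T, LipschitzWith L (F t)) {t : ℝ} (ht : 0 < t) (z : α) :
    ContinuousAt (fun y : ℝ × α => F y.1 y.2) (t, z) := by
  obtain ⟨L, hL⟩ := hL (t + 1)
  have := continuousOn_prod_of_continuousOn_lipschitzOnWith' (fun y : ℝ × α => F y.1 y.2) L
    (s := Icc 0 (t + 1)) (t := univ) (fun b hb => (hL b hb).lipschitzOnWith)
    (fun a _ => (hF a).continuousOn)
  exact this.continuousAt (prod_mem_nhds (Icc_mem_nhds ht (by linarith)) univ_mem)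

theorem continuousAt_flow {t : ℝ} (ht : 0 < t) (z : ℝ × ℝ) :
    ContinuousAt (fun y : ℝ × (ℝ × ℝ) => flow ham y.1 y.2) (t, z) := by
  refine continuousAt_uncurry_of_lipschitz continuous_flow_time (fun T => ?_) ht z
  refine ⟨⟨Real.exp (60 * T), (Real.exp_pos _).le⟩, fun t ht =>
    LipschitzWith.of_dist_le_mul fun z w => (dist_flow_le z w ht.1).trans ?_⟩
  rw [mul_comm]
  refine mul_le_mul_of_nonneg_right (Real.exp_le_exp.2 ?_) dist_nonneg
  linarith [ht.2]

/-! ### Differentiability of the flow with respect to the initial point -/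

/-- The linearized vector field at a point with abscissa `q`. -/
noncomputable def linField (q : ℝ) (y : ℝ × ℝ) : ℝ × ℝ := (y.2, -(forceDeriv q * y.1))

theorem lipschitzWith_linField (q : ℝ) : LipschitzWith 60 (linField q) := by
  refine LipschitzWith.of_dist_le_mul fun z w => ?_
  have h1 : |z.1 - w.1| ≤ dist z w := by
    rw [← Real.dist_eq]; exact le_max_left _ _
  have h2 : |z.2 - w.2| ≤ dist z w := by
    rw [← Real.dist_eq]; exact le_max_right _ _
  refine max_le ?_ ?_
  · simp only [linField, Real.dist_eq, NNReal.coe_ofNat]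
    linarith [dist_nonneg (x := z) (y := w)]
  · simp only [linField, Real.dist_eq, NNReal.coe_ofNat]
    rw [neg_sub_neg, abs_sub_comm, ← mul_sub, abs_mul]
    have := abs_forceDeriv_le q
    nlinarith [abs_nonneg (z.1 - w.1), abs_nonneg (forceDeriv q)]

theorem linField_zero (q : ℝ) : linField q 0 = 0 := by ext <;> simp [linField]

theorem exists_variation (z e : ℝ × ℝ) : ∃ Y : ℝ → ℝ × ℝ, Y 0 = e ∧
    ∀ t, HasDerivAt Y (linField (flow ham t z).1 (Y t)) t := by
  refine exists_forall_hasDerivAt_of_lipschitz (v := fun t => linField (flow ham t z).1) (K := 60)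
    (fun _ => lipschitzWith_linField _) ?_ (C := 60 * ‖e‖) (fun t => ?_)
  · have h1 : Continuous fun y : ℝ × (ℝ × ℝ) => forceDeriv (flow ham y.1 z).1 :=
      continuous_forceDeriv.comp
        (continuous_fst.comp ((continuous_flow_time z).comp continuous_fst))
    exact (continuous_snd.comp continuous_snd).prodMk
      (h1.mul (continuous_fst.comp continuous_snd)).neg
  · have := (lipschitzWith_linField (flow ham t z).1).dist_le_mul e 0
    simpa [linField_zero] using this

/-- The derivative of the flow at `z` in the direction `e`. -/
noncomputable def variation (z e : ℝ × ℝ) : ℝ → ℝ × ℝ := (exists_variation z e).choose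

theorem variation_zero (z e : ℝ × ℝ) : variation z e 0 = e := (exists_variation z e).choose_spec.1

theorem hasDerivAt_variation (z e : ℝ × ℝ) (t : ℝ) :
    HasDerivAt (variation z e) (linField (flow ham t z).1 (variation z e t)) t :=
  (exists_variation z e).choose_spec.2 t

theorem continuous_variation_time (z e : ℝ × ℝ) : Continuous (variation z e) :=
  continuous_iff_continuousAt.2 fun t => (hasDerivAt_variation z e t).continuousAt

theorem norm_variation_le (z e : ℝ × ℝ) {t : ℝ} (ht : 0 ≤ t) :
    ‖variation z e t‖ ≤ ‖e‖ * Real.exp (60 * t) := by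
  have := norm_le_gronwallBound_of_norm_deriv_right_le (a := 0) (b := t) (δ := ‖e‖) (K := 60)
    (ε := 0) (continuous_variation_time z e).continuousOn
    (fun s _ => (hasDerivAt_variation z e s).hasDerivWithinAt) (by rw [variation_zero])
    (fun s _ => by
      have := (lipschitzWith_linField (flow ham s z).1).dist_le_mul (variation z e s) 0
      simpa [linField_zero] using this) t ⟨ht, le_rfl⟩
  simpa [gronwallBound_ε0] using this

theorem gronwallBound_zero_le {K ε t : ℝ} (hK : 1 ≤ K) (hε : 0 ≤ ε) :
    gronwallBound 0 K ε t ≤ ε * Real.exp (K * t) := by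
  rw [gronwallBound_of_K_ne_0 (by linarith)]
  have h1 := Real.exp_pos (K * t)
  have h2 : ε / K ≤ ε := div_le_self hε hK
  have h3 : 0 ≤ ε / K := by positivity
  nlinarith

/-- The difference of the two trajectories solves the linearized equation up to the Taylor remainder
of the force, which is quadratic in h by `dist_flow_le`. Gronwall's inequality then compares it with
`h • variation z e`. -/
theorem norm_flow_sub_sub_le (z e : ℝ × ℝ) (h : ℝ) {t : ℝ} (ht : 0 ≤ t) :
    ‖flow ham t (z + h • e) - flow ham t z - h • variation z e t‖
      ≤ 336 * (‖e‖ * Real.exp (60 * t)) ^ 2 * Real.exp (60 * t) * h ^ 2 := by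
  set B := 336 * (‖e‖ * Real.exp (60 * t)) ^ 2 * h ^ 2 with hB
  have key := dist_le_of_approx_trajectories_ODE (v := fun s => linField (flow ham s z).1) (K := 60)
    (f := fun s => flow ham s (z + h • e) - flow ham s z) (g := fun s => h • variation z e s)
    (a := 0) (b := t) (δ := 0) (εf := B) (εg := 0) (fun _ => lipschitzWith_linField _)
    ((continuous_flow_time _).sub (continuous_flow_time _)).continuousOn
    (fun s _ => ((hasDerivAt_flow _ s).sub (hasDerivAt_flow _ s)).hasDerivWithinAt)
    (fun s hs => ?_) ((continuous_variation_time z e).const_smul h).continuousOn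
    (fun s _ => ((hasDerivAt_variation z e s).const_smul h).hasDerivWithinAt)
    (fun s _ => ?_) (by simp [flow_zero, variation_zero]) t ⟨ht, le_rfl⟩
  · rw [dist_eq_norm] at key
    refine key.trans ?_
    simp only [sub_zero, add_zero]
    refine (gronwallBound_zero_le (by norm_num) (by positivity)).trans (le_of_eq ?_)
    rw [hB]
    push_cast
    ring
  · set x := flow ham s z
    set y := flow ham s (z + h • e)
    have hd : dist y x ≤ |h| * (‖e‖ * Real.exp (60 * t)) := by
      have h0 := dist_flow_le (z + h • e) z hs.1
      rw [dist_self_add_left, norm_smul, Real.norm_eq_abs] at h0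
      refine h0.trans ?_
      rw [mul_assoc]
      gcongr
      exact hs.2.le
    have h1 : |y.1 - x.1| ≤ dist y x := by
      rw [← Real.dist_eq]; exact le_max_left _ _
    have h2 : hamField y - hamField x - linField x.1 (y - x)
        = (0, -(force y.1 - force x.1 - forceDeriv x.1 * (y.1 - x.1))) := by
      ext
      · simp [hamField, linField]
      · simp [hamField, linField]; ring
    rw [dist_eq_norm, h2, Prod.norm_mk, norm_zero, norm_neg, Real.norm_eq_abs,
      max_eq_right (abs_nonneg _)]
    refine (abs_force_sub_sub_le _ _).trans ?_
    calc 336 * |y.1 - x.1| ^ 2 ≤ 336 * (|h| * (‖e‖ * Real.exp (60 * t))) ^ 2 := by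
          gcongr; exact h1.trans hd
      _ = B := by rw [hB, mul_pow, sq_abs]; ring
  · rw [dist_eq_norm, norm_le_zero_iff]
    ext <;> simp [linField]; ring

theorem hasDerivAt_flow_line (z e : ℝ × ℝ) {t : ℝ} (ht : 0 ≤ t) :
    HasDerivAt (fun h : ℝ => flow ham t (z + h • e)) (variation z e t) 0 := by
  rw [hasDerivAt_iff_isLittleO_nhds_zero]
  refine Asymptotics.IsBigO.trans_isLittleO (g := fun h : ℝ => h ^ 2) ?_
    (by simpa using (Asymptotics.isLittleO_pow_pow (𝕜 := ℝ) (m := 1) (n := 2) (by omega)))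
  refine Asymptotics.IsBigO.of_bound
    (336 * (‖e‖ * Real.exp (60 * t)) ^ 2 * Real.exp (60 * t)) (Eventually.of_forall fun h => ?_)
  have := norm_flow_sub_sub_le z e h ht
  simp only [zero_add, zero_smul, add_zero, norm_pow, Real.norm_eq_abs, sq_abs]
  exact this

/-- The variation along z solves the linear equation along w up to an error controlled by the
Lipschitz constant 336 of `forceDeriv`; Gronwall again. This gives continuity of the derivative of
the flow. -/
theorem dist_variation_le (z w e : ℝ × ℝ) {t : ℝ} (ht : 0 ≤ t) :
    dist (variation z e t) (variation w e t)
      ≤ 336 * ‖e‖ * Real.exp (60 * t) ^ 3 * dist z w := by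
  set B := 336 * (dist z w * Real.exp (60 * t)) * (‖e‖ * Real.exp (60 * t)) with hB
  have key := dist_le_of_approx_trajectories_ODE (v := fun s => linField (flow ham s w).1) (K := 60)
    (f := variation z e) (g := variation w e)
    (a := 0) (b := t) (δ := 0) (εf := B) (εg := 0) (fun _ => lipschitzWith_linField _)
    (continuous_variation_time z e).continuousOn
    (fun s _ => (hasDerivAt_variation z e s).hasDerivWithinAt)
    (fun s hs => ?_) (continuous_variation_time w e).continuousOn
    (fun s _ => (hasDerivAt_variation w e s).hasDerivWithinAt)
    (fun s _ => by rw [dist_self]) (by simp [variation_zero]) t ⟨ht, le_rfl⟩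
  · refine key.trans ?_
    simp only [sub_zero, add_zero]
    refine (gronwallBound_zero_le (by norm_num) (by positivity)).trans (le_of_eq ?_)
    rw [hB]
    push_cast
    ring
  · have hexp : Real.exp (60 * s) ≤ Real.exp (60 * t) := Real.exp_le_exp.2 (by linarith [hs.2])
    have h1 : |(flow ham s z).1 - (flow ham s w).1| ≤ dist z w * Real.exp (60 * t) := by
      rw [← Real.dist_eq]
      refine (le_max_left _ _ : _ ≤ dist (flow ham s z) (flow ham s w)).trans
        ((dist_flow_le z w hs.1).trans ?_)
      gcongr
    have h2 : |(variation z e s).1| ≤ ‖e‖ * Real.exp (60 * t) := by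
      rw [← Real.norm_eq_abs]
      refine (le_max_left _ _ : _ ≤ ‖variation z e s‖).trans ((norm_variation_le z e hs.1).trans ?_)
      gcongr
    have h3 : linField (flow ham s z).1 (variation z e s)
        - linField (flow ham s w).1 (variation z e s)
        = (0, -((forceDeriv (flow ham s z).1 - forceDeriv (flow ham s w).1)
            * (variation z e s).1)) := by
      ext
      · simp [linField]
      · simp [linField]; ring
    rw [dist_eq_norm, h3, Prod.norm_mk, norm_zero, norm_neg, Real.norm_eq_abs,
      max_eq_right (abs_nonneg _), abs_mul]
    refine mul_le_mul ((abs_forceDeriv_sub_le _ _).trans ?_) h2 (abs_nonneg _) (by positivity)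
    gcongr

theorem continuousAt_variation {t : ℝ} (ht : 0 < t) (z e : ℝ × ℝ) :
    ContinuousAt (fun y : ℝ × (ℝ × ℝ) => variation y.2 e y.1) (t, z) := by
  refine continuousAt_uncurry_of_lipschitz (F := fun t z => variation z e t)
    (fun z => continuous_variation_time z e) (fun T => ?_) ht z
  refine ⟨⟨336 * ‖e‖ * Real.exp (60 * T) ^ 3, by positivity⟩, fun t ht =>
    LipschitzWith.of_dist_le_mul fun z w => (dist_variation_le z w e ht.1).trans ?_⟩
  refine mul_le_mul_of_nonneg_right ?_ dist_nonneg
  change _ ≤ 336 * ‖e‖ * Real.exp (60 * T) ^ 3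
  gcongr
  exact ht.2

theorem hasDerivAt_flow_line' (z e : ℝ × ℝ) {t : ℝ} (ht : 0 ≤ t) (s : ℝ) :
    HasDerivAt (fun s : ℝ => flow ham t (z + s • e)) (variation (z + s • e) e t) s := by
  have h := hasDerivAt_flow_line (z + s • e) e ht
  -- The derivative at increment 0 from the base point z + s • e is rewritten at s - s, so that a
  -- translation of the variable yields the derivative at s.
  rw [← sub_self s] at h
  have h2 := h.comp_sub_const s s
  refine h2.congr_of_eventuallyEq (Eventually.of_forall fun r => ?_)
  change _ = flow ham t (z + s • e + (r - s) • e)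
  rw [add_assoc, ← add_smul, add_sub_cancel]

/-- The derivative of the flow along a line of initial points. -/
noncomputable def lineDeriv (z e : ℝ × ℝ) (y : ℝ × ℝ) : ℝ × ℝ →L[ℝ] ℝ × ℝ :=
  (ContinuousLinearMap.toSpanSingleton ℝ (hamField (flow ham y.1 (z + y.2 • e)))).coprod
    (ContinuousLinearMap.toSpanSingleton ℝ (variation (z + y.2 • e) e y.1))

theorem lineDeriv_apply (z e y w : ℝ × ℝ) : lineDeriv z e y w
    = w.1 • hamField (flow ham y.1 (z + y.2 • e)) + w.2 • variation (z + y.2 • e) e y.1 := by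
  simp [lineDeriv]

theorem continuousAt_line (z e : ℝ × ℝ) (y : ℝ × ℝ) :
    ContinuousAt (fun y : ℝ × ℝ => (y.1, z + y.2 • e)) y := by
  fun_prop

theorem continuousAt_lineDeriv (z e : ℝ × ℝ) {y : ℝ × ℝ} (hy : 0 < y.1) :
    ContinuousAt (lineDeriv z e) y ∧
      HasStrictFDerivAt (fun y : ℝ × ℝ => flow ham y.1 (z + y.2 • e)) (lineDeriv z e y) y := by
  have hpos : ∀ᶠ v : ℝ × ℝ in 𝓝 y, 0 < v.1 := continuous_fst.continuousAt.eventually_const_lt hy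
  have c1 : ContinuousAt (fun y : ℝ × ℝ => ContinuousLinearMap.toSpanSingleton ℝ
      (hamField (flow ham y.1 (z + y.2 • e)))) y := by
    refine (ContinuousLinearMap.toSpanSingletonCLE (𝕜 := ℝ) (E := ℝ × ℝ)).continuous.continuousAt.comp
      (lipschitzWith_hamField.continuous.continuousAt.comp ?_)
    exact ContinuousAt.comp (x := y) (f := fun y : ℝ × ℝ => (y.1, z + y.2 • e))
      (continuousAt_flow hy _) (continuousAt_line z e y)
  have c2 : ContinuousAt (fun y : ℝ × ℝ => ContinuousLinearMap.toSpanSingleton ℝ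
      (variation (z + y.2 • e) e y.1)) y := by
    refine (ContinuousLinearMap.toSpanSingletonCLE (𝕜 := ℝ) (E := ℝ × ℝ)).continuous.continuousAt.comp ?_
    exact ContinuousAt.comp (x := y) (f := fun y : ℝ × ℝ => (y.1, z + y.2 • e))
      (continuousAt_variation hy _ e) (continuousAt_line z e y)
  constructor
  · have h := (c1.clm_comp (continuousAt_const (y := ContinuousLinearMap.fst ℝ ℝ ℝ))).add
      (c2.clm_comp (continuousAt_const (y := ContinuousLinearMap.snd ℝ ℝ ℝ)))
    refine h.congr (Eventually.of_forall fun v => ?_)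
    ext <;> simp [lineDeriv]
  · exact hasStrictFDerivAt_uncurry_coprod (f := fun t s => flow ham t (z + s • e))
      (f₁ := fun t s => ContinuousLinearMap.toSpanSingleton ℝ (hamField (flow ham t (z + s • e))))
      (f₂ := fun t s => ContinuousLinearMap.toSpanSingleton ℝ (variation (z + s • e) e t))
      (Eventually.of_forall fun v => (hasDerivAt_flow _ v.1).hasFDerivAt)
      (hpos.mono fun v hv => (hasDerivAt_flow_line' z e hv.le v.2).hasFDerivAt) c1 c2

/-- Along a line of initial points, the flow is of class `C¹`. -/
theorem contDiffAt_flow_line (z e : ℝ × ℝ) {y : ℝ × ℝ} (hy : 0 < y.1) :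
    ContDiffAt ℝ 1 (fun y : ℝ × ℝ => flow ham y.1 (z + y.2 • e)) y := by
  rw [contDiffAt_one_iff]
  refine ⟨lineDeriv z e, {v | 0 < v.1}, continuous_fst.continuousAt.eventually_const_lt hy,
    fun v hv => (continuousAt_lineDeriv z e hv).1.continuousWithinAt,
    fun v hv => (continuousAt_lineDeriv z e hv).2.hasFDerivAt⟩

/-! ### Comparison of trajectories -/

/-- A continuous function which is positive near `0` on the right and has no first zero is
positive. -/
theorem pos_of_forall_first_zero {f : ℝ → ℝ} (hf : Continuous f) {T : ℝ}
    (h0 : ∀ᶠ t in 𝓝[>] 0, 0 < f t)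
    (h : ∀ τ ∈ Ioo 0 T, (∀ s ∈ Ioo 0 τ, 0 < f s) → f τ ≠ 0) : ∀ t ∈ Ioo 0 T, 0 < f t := by
  intro t ht
  by_contra! hneg
  obtain ⟨δ, hδ, hδf⟩ := mem_nhdsGT_iff_exists_Ioo_subset.1 h0
  have hδ0 : 0 < δ := hδ
  have hδt : δ ≤ t := by
    by_contra! hlt
    exact absurd (hδf ⟨ht.1, hlt⟩) (not_lt.2 hneg)
  -- Starting at δ/2 rather than 0 keeps a possible zero of f at 0 out of the compact set, whose
  -- least element is then the first positive zero.
  have hS : IsCompact (Icc (δ / 2) t ∩ {s | f s ≤ 0}) :=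
    isCompact_Icc.inter_right (isClosed_le hf continuous_const)
  obtain ⟨τ, ⟨hτ, hτf⟩, hmin⟩ := hS.exists_isLeast ⟨t, ⟨by linarith, le_rfl⟩, hneg⟩
  have hτ0 : 0 < τ := by linarith [hτ.1]
  have hbefore : ∀ s ∈ Ioo 0 τ, 0 < f s := by
    intro s hs
    by_contra! hle
    rcases lt_or_ge s (δ / 2) with h1 | h1
    · exact absurd (hδf ⟨hs.1, by linarith⟩) (not_lt.2 hle)
    · exact absurd (hmin ⟨⟨h1, hs.2.le.trans hτ.2⟩, hle⟩) (not_le.2 hs.2)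
  have hge : 0 ≤ f τ := by
    have hcl : IsClosed {s | 0 ≤ f s} := isClosed_le continuous_const hf
    have : closure (Ioo 0 τ) ⊆ {s | 0 ≤ f s} :=
      hcl.closure_subset_iff.2 fun s hs => (hbefore s hs).le
    rw [closure_Ioo hτ0.ne] at this
    exact this ⟨hτ0.le, le_rfl⟩
  exact h τ ⟨hτ0, hτ.2.trans_lt ht.2⟩ hbefore (le_antisymm hτf hge)

theorem eventually_pos_of_hasDerivAt {f : ℝ → ℝ} {f' : ℝ} (h : HasDerivAt f f' 0) (h0 : f 0 = 0)
    (hf' : 0 < f') : ∀ᶠ t in 𝓝[>] 0, 0 < f t := by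
  have h1 := (hasDerivAt_iff_tendsto_slope.1 h).mono_left
    (nhdsWithin_mono 0 fun t (ht : 0 < t) => ht.ne')
  filter_upwards [h1.eventually_const_lt hf', self_mem_nhdsWithin] with t ht htpos
  rw [slope_def_field, h0, sub_zero, sub_zero] at ht
  exact (div_pos_iff_of_pos_right htpos).1 ht

theorem hasDerivAt_wronskian (z w : ℝ × ℝ) (t : ℝ) :
    HasDerivAt (fun t => (flow ham t w).2 * (flow ham t z).1 - (flow ham t w).1 * (flow ham t z).2)
      ((flow ham t z).1 * (flow ham t w).1
        * (stiffness (flow ham t z).1 - stiffness (flow ham t w).1)) t := by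
  have h := ((hasDerivAt_flow_snd w t).mul (hasDerivAt_flow_fst z t)).sub
    ((hasDerivAt_flow_fst w t).mul (hasDerivAt_flow_snd z t))
  refine HasDerivAt.congr_deriv h ?_
  simp only [force]
  ring

/-! ### Trajectories issuing from the origin -/

section Fan

variable {p₁ p₂ T : ℝ}

/-- The derivative of the Wronskian is the product of the positions times the difference of
stiffnesses, and the stiffness is smaller on the outer trajectory. -/
theorem wronskian_monotoneOn {z w : ℝ × ℝ}
    (h : ∀ t ∈ Ioo 0 T, 0 < (flow ham t z).1 ∧ (flow ham t z).1 ≤ (flow ham t w).1) :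
    MonotoneOn (fun t => (flow ham t w).2 * (flow ham t z).1
      - (flow ham t w).1 * (flow ham t z).2) (Icc 0 T) := by
  refine monotoneOn_of_hasDerivWithinAt_nonneg (convex_Icc 0 T)
    (fun t _ => (hasDerivAt_wronskian z w t).continuousAt.continuousWithinAt)
    (fun t _ => (hasDerivAt_wronskian z w t).hasDerivWithinAt) fun t ht => ?_
  rw [interior_Icc] at ht
  obtain ⟨h1, h2⟩ := h t ht
  have := stiffness_anti h1.le h2
  have : 0 < (flow ham t w).1 := h1.trans_le h2
  have : 0 < (flow ham t z).1 * (flow ham t w).1 := by positivity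
  nlinarith

/-- As long as the slower trajectory issuing from the origin is positive, the ratio of the positions
is at least the ratio of the initial velocities. -/
theorem fan_ratio_le (hp₁ : 0 < p₁) (hp : p₁ < p₂)
    (h : ∀ t ∈ Ioo 0 T, 0 < (flow ham t (0, p₁)).1) :
    ∀ t ∈ Icc 0 T, p₂ * (flow ham t (0, p₁)).1 ≤ p₁ * (flow ham t (0, p₂)).1 := by
  -- The constant c < p₂ / p₁ gives a strict inequality for small times. As long as it lasts, c > 1
  -- keeps the faster trajectory outside the slower one, so the Wronskian is nonnegative and the
  -- ratio of positions nondecreasing. The ratio exceeds c at τ / 2, so it cannot equal c at τ.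
  have key : ∀ c, 1 < c → c < p₂ / p₁ → ∀ t ∈ Ioo 0 T,
      0 < (flow ham t (0, p₂)).1 - c * (flow ham t (0, p₁)).1 := by
    intro c hc1 hc2
    rw [lt_div_iff₀ hp₁] at hc2
    refine pos_of_forall_first_zero
      (f := fun t => (flow ham t (0, p₂)).1 - c * (flow ham t (0, p₁)).1)
      ((continuous_fst.comp (continuous_flow_time _)).sub
        (continuous_const.mul (continuous_fst.comp (continuous_flow_time _)))) ?_ ?_
    · refine eventually_pos_of_hasDerivAt (((hasDerivAt_flow_fst (0, p₂) 0)).sub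
        ((hasDerivAt_flow_fst (0, p₁) 0).const_mul c)) ?_ ?_
      · simp [flow_zero]
      · simp only [flow_zero]; linarith
    · intro τ hτ hbefore hzero
      have hW := wronskian_monotoneOn (z := (0, p₁)) (w := (0, p₂)) (T := τ) fun t ht => by
        have h1 := h t ⟨ht.1, ht.2.trans hτ.2⟩
        have h2 := hbefore t ht
        exact ⟨h1, by nlinarith⟩
      have hpos : ∀ t ∈ Icc (τ / 2) τ, 0 < (flow ham t (0, p₁)).1 := fun t ht =>
        h t ⟨by linarith [ht.1, hτ.1], ht.2.trans_lt hτ.2⟩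
      have hd : ∀ t ∈ Icc (τ / 2) τ, HasDerivAt
          (fun t => (flow ham t (0, p₂)).1 / (flow ham t (0, p₁)).1)
          (((flow ham t (0, p₂)).2 * (flow ham t (0, p₁)).1
            - (flow ham t (0, p₂)).1 * (flow ham t (0, p₁)).2) / (flow ham t (0, p₁)).1 ^ 2) t :=
        fun t ht => (hasDerivAt_flow_fst _ t).div (hasDerivAt_flow_fst _ t) (hpos t ht).ne'
      have hmono : MonotoneOn (fun t => (flow ham t (0, p₂)).1 / (flow ham t (0, p₁)).1)
          (Icc (τ / 2) τ) := by
        refine monotoneOn_of_hasDerivWithinAt_nonneg (convex_Icc _ _)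
          (fun t ht => (hd t ht).continuousAt.continuousWithinAt)
          (fun t ht => (hd t (interior_subset ht)).hasDerivWithinAt) fun t ht => ?_
        have ht' := interior_subset ht
        have h0 : (0 : ℝ) ≤ t := by linarith [ht'.1, hτ.1]
        have := hW (left_mem_Icc.2 hτ.1.le) ⟨h0, ht'.2⟩ h0
        simp only [flow_zero, mul_zero, zero_mul, sub_zero] at this
        exact div_nonneg this (sq_nonneg _)
      have h1 := hmono (left_mem_Icc.2 (by linarith [hτ.1])) (right_mem_Icc.2 (by linarith [hτ.1]))
        (by linarith [hτ.1] : τ / 2 ≤ τ)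
      have h2 := hbefore (τ / 2) ⟨by linarith [hτ.1], by linarith [hτ.1]⟩
      have h3 := hpos τ (right_mem_Icc.2 (by linarith [hτ.1]))
      have h4 := hpos (τ / 2) (left_mem_Icc.2 (by linarith [hτ.1]))
      simp only at h1
      rw [show (flow ham τ (0, p₂)).1 / (flow ham τ (0, p₁)).1 = c by
        rw [div_eq_iff h3.ne']; linarith, div_le_iff₀ h4] at h1
      linarith
  intro t ht
  have hT : Ioo 0 T ⊆ {t | p₂ * (flow ham t (0, p₁)).1 ≤ p₁ * (flow ham t (0, p₂)).1} := by
    intro t ht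
    by_contra! hlt
    have hlt : p₁ * (flow ham t (0, p₂)).1 < p₂ * (flow ham t (0, p₁)).1 := not_le.1 hlt
    have h1 := h t ht
    -- If the ratio were below p₂ / p₁ at time t, a value c between them, and above 1, would
    -- contradict `key`.
    obtain ⟨c, hc1, hc2⟩ := exists_between
      (max_lt ((one_lt_div hp₁).2 hp) (by
        rw [div_lt_div_iff₀ h1 hp₁]; linarith :
          (flow ham t (0, p₂)).1 / (flow ham t (0, p₁)).1 < p₂ / p₁))
    have h2 := key c ((le_max_left _ _).trans_lt hc1) hc2 t ht
    have h3 := (le_max_right _ _).trans_lt hc1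
    rw [div_lt_iff₀ h1] at h3
    linarith
  rcases ht.1.eq_or_lt with rfl | h0
  · simp [flow_zero]
  have hcl : IsClosed {t | p₂ * (flow ham t (0, p₁)).1 ≤ p₁ * (flow ham t (0, p₂)).1} :=
    isClosed_le (continuous_const.mul (continuous_fst.comp (continuous_flow_time _)))
      (continuous_const.mul (continuous_fst.comp (continuous_flow_time _)))
  have := hcl.closure_subset_iff.2 hT
  rw [closure_Ioo (h0.trans_le ht.2).ne] at this
  exact this ht

/-- The half-period of the faster trajectory is strictly longer. -/
theorem fan_pos (hp₁ : 0 < p₁) (hp : p₁ < p₂) (hT : 0 < T)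
    (h : ∀ t ∈ Ioo 0 T, 0 < (flow ham t (0, p₁)).1) : 0 < (flow ham T (0, p₂)).1 := by
  have hratio := fan_ratio_le hp₁ hp h
  have hlt : ∀ t ∈ Ioo 0 T, (flow ham t (0, p₁)).1 < (flow ham t (0, p₂)).1 := by
    intro t ht
    have h1 := hratio t ⟨ht.1.le, ht.2.le⟩
    have h2 := h t ht
    nlinarith
  have h1T : 0 ≤ (flow ham T (0, p₁)).1 := by
    have hcl : IsClosed {t | 0 ≤ (flow ham t (0, p₁)).1} :=
      isClosed_le continuous_const (continuous_fst.comp (continuous_flow_time _))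
    have : closure (Ioo 0 T) ⊆ {t | 0 ≤ (flow ham t (0, p₁)).1} :=
      hcl.closure_subset_iff.2 fun s hs => (h s hs).le
    rw [closure_Ioo hT.ne] at this
    exact this ⟨hT.le, le_rfl⟩
  have h2T := hratio T ⟨hT.le, le_rfl⟩
  by_contra! hle
  have hz2 : (flow ham T (0, p₂)).1 = 0 := by nlinarith
  have hz1 : (flow ham T (0, p₁)).1 = 0 := by
    rw [hz2] at h2T; nlinarith
  have hW := wronskian_monotoneOn (z := (0, p₁)) (w := (0, p₂)) (T := T) fun t ht =>
    ⟨h t ht, (hlt t ht).le⟩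
  -- Both positions vanish at 0 and at T, so the monotone Wronskian vanishes at both ends and hence
  -- throughout.
  have hWT : ∀ t ∈ Icc 0 T, (flow ham t (0, p₂)).2 * (flow ham t (0, p₁)).1
      - (flow ham t (0, p₂)).1 * (flow ham t (0, p₁)).2 = 0 := by
    intro t ht
    have e1 := hW (left_mem_Icc.2 hT.le) ht ht.1
    have e2 := hW ht (right_mem_Icc.2 hT.le) ht.2
    simp only [flow_zero, mul_zero, zero_mul, sub_zero, hz1, hz2] at e1 e2
    exact le_antisymm e2 e1
  -- Within |x| < 1 the stiffness is strictly decreasing, so at such a time the Wronskian has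
  -- positive derivative, against its vanishing identically.
  have hsmall : ∀ᶠ t in 𝓝[>] (0 : ℝ), (flow ham t (0, p₂)).1 < 1 := by
    have : ContinuousAt (fun t => (flow ham t (0, p₂)).1) 0 :=
      (continuous_fst.comp (continuous_flow_time _)).continuousAt
    exact nhdsWithin_le_nhds (this.eventually_lt_const (by simp [flow_zero]))
  obtain ⟨t, ht1, ht⟩ := (hsmall.and (Ioo_mem_nhdsGT hT)).exists
  have hd := hasDerivAt_wronskian (0, p₁) (0, p₂) t
  have hd0 : HasDerivAt (fun t => (flow ham t (0, p₂)).2 * (flow ham t (0, p₁)).1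
      - (flow ham t (0, p₂)).1 * (flow ham t (0, p₁)).2) 0 t := by
    refine (hasDerivAt_const t (0 : ℝ)).congr_of_eventuallyEq ?_
    filter_upwards [Icc_mem_nhds ht.1 ht.2] with s hs using hWT s hs
  have h1 := h t ht
  have h2 := hlt t ht
  have hst : stiffness (flow ham t (0, p₂)).1 < stiffness (flow ham t (0, p₁)).1 := by
    unfold stiffness
    rw [max_eq_left (by nlinarith), max_eq_left (by nlinarith)]
    have : (1 - (flow ham t (0, p₂)).1 ^ 2) ^ 3 < (1 - (flow ham t (0, p₁)).1 ^ 2) ^ 3 :=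
      pow_lt_pow_left₀ (by nlinarith) (by nlinarith) (by norm_num)
    linarith
  have h3 : 0 < (flow ham t (0, p₁)).1 * (flow ham t (0, p₂)).1 := mul_pos h1 (h1.trans h2)
  have h4 := hd.unique hd0
  have h5 := mul_pos h3 (sub_pos.2 hst)
  linarith

end Fan

theorem g_mono {x y : ℝ} (hx : 0 ≤ x) (h : x ≤ y) : g x ≤ g y := by
  rw [g_eq, g_eq]
  gcongr

/-! ### Trajectories issuing from the half-line p = 2 -/

section Straight

/-- The energy is at least 2 and the potential at most 1, so the squared velocity is at least 2. It
cannot vanish, and it starts positive. The constant 4/3 is a rational lower bound for √2. -/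
theorem velocity_straight_bounds {s : ℝ} (t : ℝ) :
    4 / 3 ≤ (flow ham t (s, 2)).2 := by
  have hsq : ∀ t, 2 ≤ (flow ham t (s, 2)).2 ^ 2 := by
    intro t
    have := ham_flow (s, 2) t
    simp only [ham] at this
    nlinarith [g_nonneg s, g_le_one (flow ham t (s, 2)).1]
  have hpos : 0 < (flow ham t (s, 2)).2 := by
    by_contra! hle
    have hc : Continuous fun t => (flow ham t (s, 2)).2 :=
      continuous_snd.comp (continuous_flow_time _)
    have h0 : (flow ham 0 (s, 2)).2 = 2 := by rw [flow_zero]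
    obtain ⟨r, hr⟩ := mem_range_of_exists_le_of_exists_ge hc ⟨t, hle⟩ ⟨0, by rw [h0]; norm_num⟩
    have := hsq r
    simp only at hr
    rw [hr] at this
    norm_num at this
  nlinarith [hsq t]

/-- Trajectories issuing from `(s, 2)` do not approach each other too much. -/
theorem straight_sub_ge {s₁ s₂ t : ℝ} (h₁ : 0 ≤ s₁) (h : s₁ ≤ s₂) (ht : 0 ≤ t) :
    (s₂ - s₁) / 2 ≤ (flow ham t (s₂, 2)).1 - (flow ham t (s₁, 2)).1 := by
  -- Here w x is the speed at x on the trajectory from s₁, by conservation of energy, and Φ below is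
  -- the corresponding travel time. Since 2 ≤ w² ≤ 6, the slope of Φ lies between 2/5 and 3/4.
  set w : ℝ → ℝ := fun x => √(2 * (2 + g s₁ - g x)) with hw
  have hwsq : ∀ x, w x ^ 2 = 2 * (2 + g s₁ - g x) := fun x =>
    Real.sq_sqrt (by nlinarith [g_nonneg s₁, g_le_one x])
  have hw0 : ∀ x, 0 ≤ w x := fun x => Real.sqrt_nonneg _
  have hwl : ∀ x, 4 / 3 ≤ w x := fun x => by
    nlinarith [hwsq x, hw0 x, g_nonneg s₁, g_le_one x]
  have hwu : ∀ x, w x ≤ 5 / 2 := fun x => by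
    nlinarith [hwsq x, hw0 x, g_nonneg x, g_le_one s₁]
  have hwpos : ∀ x, 0 < w x := fun x => by linarith [hwl x]
  have hwc : Continuous fun x => (w x)⁻¹ :=
    (Real.continuous_sqrt.comp (continuous_const.mul
      (continuous_const.sub continuous_g))).inv₀ fun x => (hwpos x).ne'
  set Φ : ℝ → ℝ := fun x => ∫ y in (0 : ℝ)..x, (w y)⁻¹ with hΦ
  have hΦd : ∀ x, HasDerivAt Φ (w x)⁻¹ x := fun x =>
    intervalIntegral.integral_hasDerivAt_right (hwc.intervalIntegrable _ _)
      hwc.stronglyMeasurable.stronglyMeasurableAtFilter hwc.continuousAt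
  have hlow : Monotone fun x => Φ x - 2 / 5 * x := by
    refine monotone_of_hasDerivAt_nonneg
      (fun x => (hΦd x).sub ((hasDerivAt_id x).const_mul (2 / 5))) fun x => ?_
    have : (5 / 2 : ℝ)⁻¹ ≤ (w x)⁻¹ := inv_anti₀ (hwpos x) (hwu x)
    simp only [Pi.zero_apply, mul_one, sub_nonneg]
    norm_num at this ⊢
    exact this
  have hup : Monotone fun x => 3 / 4 * x - Φ x := by
    refine monotone_of_hasDerivAt_nonneg
      (fun x => ((hasDerivAt_id x).const_mul (3 / 4)).sub (hΦd x)) fun x => ?_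
    have : (w x)⁻¹ ≤ (4 / 3 : ℝ)⁻¹ := inv_anti₀ (by norm_num) (hwl x)
    simp only [Pi.zero_apply, mul_one, sub_nonneg]
    norm_num at this ⊢
    exact this
  have hv₁ : ∀ r, (flow ham r (s₁, 2)).2 = w (flow ham r (s₁, 2)).1 := by
    intro r
    have := ham_flow (s₁, 2) r
    simp only [ham] at this
    rw [hw]
    simp only
    rw [show 2 * (2 + g s₁ - g (flow ham r (s₁, 2)).1) = (flow ham r (s₁, 2)).2 ^ 2 by linarith,
      Real.sqrt_sq (by linarith [velocity_straight_bounds (s := s₁) r])]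
  have hv₂ : ∀ r, w (flow ham r (s₂, 2)).1 ≤ (flow ham r (s₂, 2)).2 := by
    intro r
    have := ham_flow (s₂, 2) r
    simp only [ham] at this
    refine Real.sqrt_le_iff.2 ⟨by linarith [velocity_straight_bounds (s := s₂) r], ?_⟩
    linarith [g_mono h₁ h]
  -- Along the trajectory from s₁, Φ grows at rate exactly 1; along the one from s₂, whose energy is
  -- at least as large, at rate at least 1. The ratio (2/5)/(3/4) of the slopes of Φ exceeds the 1/2
  -- claimed.
  have hmono : Monotone fun r => Φ (flow ham r (s₂, 2)).1 - Φ (flow ham r (s₁, 2)).1 := by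
    refine monotone_of_hasDerivAt_nonneg
      (fun r => ((hΦd _).comp r (hasDerivAt_flow_fst (s₂, 2) r)).sub
        ((hΦd _).comp r (hasDerivAt_flow_fst (s₁, 2) r))) fun r => ?_
    have e1 := hv₂ r
    rw [hv₁ r, inv_mul_cancel₀ (hwpos _).ne']
    simp only [Pi.zero_apply, sub_nonneg]
    rw [← div_eq_inv_mul, one_le_div (hwpos _)]
    exact e1
  have k1 := hmono ht
  simp only [flow_zero] at k1
  have k2 := hlow h
  simp only at k2
  rcases le_total (flow ham t (s₁, 2)).1 (flow ham t (s₂, 2)).1 with hle | hle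
  · have := hup hle
    simp only at this
    linarith
  · have := hlow hle
    simp only at this
    linarith

end Straight

/-! ### The family of trajectories issuing from the set of starting points -/

/-- A parametrization of the starting points by the interval `(-2, ∞)`. -/
noncomputable def ray (s : ℝ) : ℝ × ℝ := (max s 0, 2 + min s 0)

/-- The position at time `t` on the trajectory with parameter `s`. -/
noncomputable def rayPos (t s : ℝ) : ℝ := (flow ham t (ray s)).1

/-- The velocity at time `t` on the trajectory with parameter `s`. -/
noncomputable def rayVel (t s : ℝ) : ℝ := (flow ham t (ray s)).2

theorem ray_of_nonpos {s : ℝ} (h : s ≤ 0) : ray s = (0, 2 + s) := by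
  simp [ray, max_eq_right h, min_eq_left h]

theorem ray_of_nonneg {s : ℝ} (h : 0 ≤ s) : ray s = (s, 2) := by
  simp [ray, max_eq_left h, min_eq_right h]

theorem continuous_ray : Continuous ray := by unfold ray; fun_prop

theorem ray_injective : Function.Injective ray := by
  intro s r h
  have h1 : max s 0 = max r 0 := congrArg Prod.fst h
  have h2 : 2 + min s 0 = 2 + min r 0 := congrArg Prod.snd h
  have := max_add_min s 0
  have := max_add_min r 0
  linarith

theorem mem_startSet_iff {d : ℝ × ℝ} : d ∈ startSet ↔ ∃ s, -2 < s ∧ ray s = d := by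
  constructor
  · rintro (⟨h1, h2⟩ | ⟨h1, h2⟩)
    · have h1 : 0 ≤ d.1 := h1
      have h2 : d.2 = 2 := h2
      exact ⟨d.1, by linarith, by rw [ray_of_nonneg h1, ← h2]⟩
    · have h1 : d.1 = 0 := h1
      refine ⟨d.2 - 2, by linarith [h2.1], ?_⟩
      rw [ray_of_nonpos (by linarith [h2.2]), ← h1, add_sub_cancel]
  · rintro ⟨s, hs, rfl⟩
    rcases le_total s 0 with h | h
    · rw [ray_of_nonpos h]
      exact Or.inr ⟨rfl, ⟨by simp only; linarith, by simp only; linarith⟩⟩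
    · rw [ray_of_nonneg h]
      exact Or.inl ⟨h, rfl⟩

theorem hasDerivAt_rayPos (t s : ℝ) : HasDerivAt (fun t => rayPos t s) (rayVel t s) t :=
  hasDerivAt_flow_fst _ t

theorem hasDerivAt_rayVel (t s : ℝ) :
    HasDerivAt (fun t => rayVel t s) (-force (rayPos t s)) t :=
  hasDerivAt_flow_snd _ t

theorem continuous_rayPos_time (s : ℝ) : Continuous fun t => rayPos t s :=
  continuous_iff_continuousAt.2 fun t => (hasDerivAt_rayPos t s).continuousAt

theorem rayPos_zero (s : ℝ) : rayPos 0 s = max s 0 := by rw [rayPos, flow_zero, ray]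

theorem rayVel_zero (s : ℝ) : rayVel 0 s = 2 + min s 0 := by rw [rayVel, flow_zero, ray]

theorem continuousAt_flow_ray {t : ℝ} (ht : 0 < t) (s : ℝ) :
    ContinuousAt (fun y : ℝ × ℝ => flow ham y.1 (ray y.2)) (t, s) :=
  ContinuousAt.comp (x := (t, s)) (f := fun y : ℝ × ℝ => (y.1, ray y.2))
    (continuousAt_flow ht _)
    (continuous_fst.prodMk (continuous_ray.comp continuous_snd)).continuousAt

theorem continuousAt_rayPos {t : ℝ} (ht : 0 < t) (s : ℝ) :
    ContinuousAt (fun y : ℝ × ℝ => rayPos y.1 y.2) (t, s) :=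
  continuous_fst.continuousAt.comp (continuousAt_flow_ray ht s)

theorem continuousAt_rayVel {t : ℝ} (ht : 0 < t) (s : ℝ) :
    ContinuousAt (fun y : ℝ × ℝ => rayVel y.1 y.2) (t, s) :=
  continuous_snd.continuousAt.comp (continuousAt_flow_ray ht s)

theorem continuous_rayPos_param {t : ℝ} (ht : 0 < t) : Continuous fun s => rayPos t s :=
  continuous_iff_continuousAt.2 fun s =>
    ContinuousAt.comp (x := s) (f := fun s : ℝ => (t, s)) (continuousAt_rayPos ht s)
      (Continuous.prodMk_right t).continuousAt

theorem sq_rayVel_le (t s : ℝ) : rayVel t s ^ 2 ≤ 2 * ((2 + min s 0) ^ 2 / 2 + 1) := by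
  have := ham_flow (ray s) t
  simp only [ham, ← rayPos.eq_1, ← rayVel.eq_1] at this
  have h1 : (ray s).2 = 2 + min s 0 := rfl
  rw [h1] at this
  linarith [g_le_one (ray s).1, g_nonneg (rayPos t s)]

/-- The initial speed is at most 2 and the potential varies by at most 1, so the squared velocity is
at most 6. -/
theorem abs_rayVel_le (t : ℝ) {s : ℝ} (hs : -2 < s) : |rayVel t s| ≤ 3 := by
  refine abs_le_of_sq_le_sq ?_ (by norm_num)
  have h1 := sq_rayVel_le t s
  have h2 : 0 ≤ 2 + min s 0 := by
    have : -2 ≤ min s 0 := le_min hs.le (by norm_num)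
    linarith
  have h3 : 2 + min s 0 ≤ 2 := by linarith [min_le_right s 0]
  nlinarith

theorem rayVel_ge (s : ℝ) {t : ℝ} (ht : 0 ≤ t) : 2 + min s 0 - 8 * t ≤ rayVel t s := by
  have hm : Monotone fun t => rayVel t s + 8 * t := by
    refine monotone_of_hasDerivAt_nonneg
      (fun t => (hasDerivAt_rayVel t s).add ((hasDerivAt_id t).const_mul 8)) fun t => ?_
    have := abs_le.1 (abs_force_le (rayPos t s))
    simp only [Pi.zero_apply]
    linarith
  have := hm ht
  simp only [rayVel_zero] at this
  linarith

theorem rayVel_le (s : ℝ) {t : ℝ} (ht : 0 ≤ t) : rayVel t s ≤ 2 + min s 0 + 8 * t := by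
  have hm : Monotone fun t => 8 * t - rayVel t s := by
    refine monotone_of_hasDerivAt_nonneg
      (fun t => ((hasDerivAt_id t).const_mul 8).sub (hasDerivAt_rayVel t s)) fun t => ?_
    have := abs_le.1 (abs_force_le (rayPos t s))
    simp only [Pi.zero_apply]
    linarith
  have := hm ht
  simp only [rayVel_zero] at this
  linarith

/-- Obtained by integrating `rayVel_ge`. It gives positivity for small times locally uniformly in s
> -2, where fan trajectories start at 0 and continuity alone does not suffice. -/
theorem rayPos_ge (s : ℝ) {t : ℝ} (ht : 0 ≤ t) : (2 + min s 0) * t - 4 * t ^ 2 ≤ rayPos t s := by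
  have hm : MonotoneOn (fun t => rayPos t s - ((2 + min s 0) * t - 4 * t ^ 2)) (Ici 0) := by
    have hd : ∀ t, HasDerivAt (fun t => rayPos t s - ((2 + min s 0) * t - 4 * t ^ 2))
        (rayVel t s - ((2 + min s 0) - 8 * t)) t := by
      intro t
      refine HasDerivAt.congr_deriv ((hasDerivAt_rayPos t s).sub
        (((hasDerivAt_id t).const_mul (2 + min s 0)).sub ((hasDerivAt_pow 2 t).const_mul 4))) ?_
      push_cast
      ring
    refine monotoneOn_of_hasDerivWithinAt_nonneg (convex_Ici 0)
      (fun t _ => (hd t).continuousAt.continuousWithinAt)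
      (fun t _ => (hd t).hasDerivWithinAt) fun t ht => ?_
    have := rayVel_ge s (interior_subset ht : (0 : ℝ) ≤ t)
    linarith
  have := hm self_mem_Ici (ht : t ∈ Ici 0) ht
  simp only [rayPos_zero] at this
  nlinarith [le_max_right s 0]

theorem rayPos_le_add {s t : ℝ} (hs : -2 < s) (ht : 0 ≤ t) : rayPos t s ≤ max s 0 + 3 * t := by
  have hm : Monotone fun t => 3 * t - rayPos t s := by
    refine monotone_of_hasDerivAt_nonneg
      (fun t => ((hasDerivAt_id t).const_mul 3).sub (hasDerivAt_rayPos t s)) fun t => ?_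
    have := abs_le.1 (abs_rayVel_le t hs)
    simp only [Pi.zero_apply]
    linarith
  have := hm ht
  simp only [rayPos_zero] at this
  linarith

theorem rayVel_pos_of_nonneg {s : ℝ} (hs : 0 ≤ s) (t : ℝ) : 4 / 3 ≤ rayVel t s := by
  rw [rayVel, ray_of_nonneg hs]
  exact velocity_straight_bounds t

theorem add_le_rayPos {s t : ℝ} (hs : 0 ≤ s) (ht : 0 ≤ t) : s + t ≤ rayPos t s := by
  have hm : Monotone fun t => rayPos t s - t := by
    refine monotone_of_hasDerivAt_nonneg
      (fun t => (hasDerivAt_rayPos t s).sub (hasDerivAt_id t)) fun t => ?_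
    have := rayVel_pos_of_nonneg hs t
    simp only [Pi.zero_apply]
    linarith
  have := hm ht
  simp only [rayPos_zero, max_eq_left hs] at this
  linarith

/-! ### Admissible parameters and their threshold -/

/-- The trajectory with parameter `s` is positive on `(0, t]`. -/
def Admissible (t s : ℝ) : Prop := -2 < s ∧ ∀ r ∈ Ioc 0 t, 0 < rayPos r s

theorem Admissible.pos {t s : ℝ} (h : Admissible t s) (ht : 0 < t) : 0 < rayPos t s :=
  h.2 t ⟨ht, le_rfl⟩

theorem admissible_of_nonneg {t s : ℝ} (hs : 0 ≤ s) : Admissible t s :=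
  ⟨by linarith, fun r hr => by linarith [add_le_rayPos hs hr.1.le, hr.1]⟩

/-- Positivity of the slower trajectory is needed only before t: it may return to 0 exactly at t,
because half-periods increase strictly with the initial speed. -/
theorem rayPos_pos_of_lt {t s₁ s₂ : ℝ} (ht : 0 < t) (h₁ : -2 < s₁) (h : s₁ < s₂)
    (hpos : ∀ r ∈ Ioo 0 t, 0 < rayPos r s₁) : 0 < rayPos t s₂ := by
  rcases le_total s₂ 0 with h2 | h2
  · simp only [rayPos, ray_of_nonpos h2, ray_of_nonpos (h.le.trans h2)] at hpos ⊢
    exact fan_pos (by linarith) (by linarith) ht hpos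
  · exact (admissible_of_nonneg h2).pos ht

theorem admissible_of_lt {t s₁ s₂ : ℝ} (h₁ : -2 < s₁) (h : s₁ < s₂)
    (hpos : ∀ r ∈ Ioo 0 t, 0 < rayPos r s₁) : Admissible t s₂ :=
  ⟨h₁.trans h, fun _ hr => rayPos_pos_of_lt hr.1 h₁ h
    fun r' hr' => hpos r' ⟨hr'.1, hr'.2.trans_le hr.2⟩⟩

theorem Admissible.mono {t s₁ s₂ : ℝ} (h₁ : Admissible t s₁) (h : s₁ ≤ s₂) : Admissible t s₂ := by
  rcases h.eq_or_lt with rfl | h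
  · exact h₁
  · exact admissible_of_lt h₁.1 h fun r hr => h₁.2 r ⟨hr.1, hr.2.le⟩

/-- A lower bound for the increments of the position in the fan. -/
theorem rayPos_sub_ge_fan {t s₁ s₂ : ℝ} (ht : 0 < t) (h₁ : Admissible t s₁) (h : s₁ < s₂)
    (h₂ : s₂ ≤ 0) : rayPos t s₁ / (2 + s₁) * (s₂ - s₁) ≤ rayPos t s₂ - rayPos t s₁ := by
  have hp : 0 < 2 + s₁ := by linarith [h₁.1]
  have := fan_ratio_le (p₁ := 2 + s₁) (p₂ := 2 + s₂) (T := t) hp (by linarith)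
    (fun r hr => by
      have := h₁.2 r ⟨hr.1, hr.2.le⟩
      rwa [rayPos, ray_of_nonpos (h.le.trans h₂)] at this) t ⟨ht.le, le_rfl⟩
  rw [← ray_of_nonpos h₂, ← ray_of_nonpos (h.le.trans h₂), ← rayPos.eq_1, ← rayPos.eq_1] at this
  rw [div_mul_eq_mul_div, div_le_iff₀ hp]
  nlinarith

/-- A lower bound for the increments of the position outside the fan. -/
theorem rayPos_sub_ge_straight {t s₁ s₂ : ℝ} (ht : 0 ≤ t) (h₁ : 0 ≤ s₁) (h : s₁ ≤ s₂) :
    (s₂ - s₁) / 2 ≤ rayPos t s₂ - rayPos t s₁ := by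
  have := straight_sub_ge h₁ h ht
  rwa [← ray_of_nonneg h₁, ← ray_of_nonneg (h₁.trans h)] at this

theorem rayPos_lt {t s₁ s₂ : ℝ} (ht : 0 < t) (h₁ : Admissible t s₁) (h : s₁ < s₂) :
    rayPos t s₁ < rayPos t s₂ := by
  have fan : ∀ s₂, s₁ < s₂ → s₂ ≤ 0 → rayPos t s₁ < rayPos t s₂ := by
    intro s₂ h h2
    have hp : 0 < 2 + s₁ := by linarith [h₁.1]
    have h3 := rayPos_sub_ge_fan ht h₁ h h2
    have h4 : 0 < rayPos t s₁ / (2 + s₁) * (s₂ - s₁) :=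
      mul_pos (div_pos (h₁.pos ht) hp) (by linarith)
    linarith
  -- When s₁ < 0 < s₂ the comparison goes through s = 0, which belongs to both pieces of the family.
  rcases le_or_gt s₂ 0 with h2 | h2
  · exact fan s₂ h h2
  rcases lt_or_ge s₁ 0 with h0 | h0
  · have := rayPos_sub_ge_straight ht.le le_rfl h2.le
    linarith [fan 0 h0 le_rfl]
  · have := rayPos_sub_ge_straight ht.le h0 h.le
    linarith

theorem rayPos_le_iff {t s₁ s₂ : ℝ} (ht : 0 < t) (h₁ : Admissible t s₁) (h₂ : Admissible t s₂) :
    rayPos t s₁ ≤ rayPos t s₂ ↔ s₁ ≤ s₂ := by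
  constructor
  · intro h
    by_contra! hlt
    exact absurd (rayPos_lt ht h₂ hlt) (not_lt.2 h)
  · intro h
    rcases h.eq_or_lt with rfl | h
    · exact le_rfl
    · exact (rayPos_lt ht h₁ h).le

/-- The time interval is cut at ε/8. Before it, `rayPos_ge` gives positivity for all nearby
parameters; after it, compactness and joint continuity do. -/
theorem isOpen_admissible : IsOpen {y : ℝ × ℝ | 0 < y.1 ∧ Admissible y.1 y.2} := by
  rw [isOpen_iff_mem_nhds]
  rintro ⟨t, s⟩ ⟨ht, hs, hpos⟩
  simp only at ht hs hpos
  have hmin : 0 < 2 + min s 0 := by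
    have : -2 < min s 0 := lt_min hs (by norm_num)
    linarith
  set ε := (2 + min s 0) / 2 with hε
  have hε0 : 0 < ε := by positivity
  have h1 : ∀ᶠ r in 𝓝 s, ε < 2 + min r 0 :=
    (by fun_prop : Continuous fun r : ℝ => 2 + min r 0).continuousAt.eventually_const_lt
      (by linarith)
  obtain ⟨t₁, ht₁, hpos₁⟩ : ∃ t₁, t < t₁ ∧ ∀ r ∈ Icc t t₁, 0 < rayPos r s := by
    have : ∀ᶠ r in 𝓝 t, 0 < rayPos r s :=
      (continuous_rayPos_time s).continuousAt.eventually_const_lt (hpos t ⟨ht, le_rfl⟩)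
    obtain ⟨δ, hδ, hb⟩ := Metric.eventually_nhds_iff.1 this
    refine ⟨t + δ / 2, by linarith, fun r hr => hb ?_⟩
    rw [Real.dist_eq, abs_lt]
    constructor <;> linarith [hr.1, hr.2]
  have h2 : ∀ᶠ r in 𝓝 s, ∀ τ ∈ Icc (ε / 8) t₁, 0 < rayPos τ r := by
    refine isCompact_Icc.eventually_forall_of_forall_eventually fun τ hτ => ?_
    have hτ0 : 0 < τ := by linarith [hτ.1]
    have hτpos : 0 < rayPos τ s := by
      rcases le_total τ t with h | h
      · exact hpos τ ⟨hτ0, h⟩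
      · exact hpos₁ τ ⟨h, hτ.2⟩
    have hc : ContinuousAt (fun y : ℝ × ℝ => rayPos y.2 y.1) (s, τ) :=
      ContinuousAt.comp (x := (s, τ)) (f := fun y : ℝ × ℝ => (y.2, y.1))
        (continuousAt_rayPos hτ0 s) continuous_swap.continuousAt
    exact hc.eventually_const_lt hτpos
  have h3 : ∀ᶠ r in 𝓝 t, 0 < r ∧ r < t₁ :=
    (eventually_gt_nhds ht).and (eventually_lt_nhds ht₁)
  filter_upwards [h3.prod_nhds (h1.and (h2.and (eventually_gt_nhds hs)))] with y hy
  obtain ⟨⟨hy0, hy1⟩, hy2, hy3, hy4⟩ := hy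
  refine ⟨hy0, hy4, fun r hr => ?_⟩
  rcases lt_or_ge r (ε / 8) with h | h
  · have := rayPos_ge y.2 hr.1.le
    have hr0 := hr.1
    nlinarith
  · exact hy3 r ⟨h, hr.2.trans hy1.le⟩

/-- The infimum of the parameters whose trajectories are positive on `(0, t]`. -/
noncomputable def threshold (t : ℝ) : ℝ := sInf {s | Admissible t s}

theorem bddBelow_admissible (t : ℝ) : BddBelow {s | Admissible t s} := ⟨-2, fun _ h => h.1.le⟩

theorem neg_two_le_threshold (t : ℝ) : -2 ≤ threshold t :=
  le_csInf ⟨0, admissible_of_nonneg le_rfl⟩ fun _ h => h.1.le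

theorem threshold_nonpos (t : ℝ) : threshold t ≤ 0 :=
  csInf_le (bddBelow_admissible t) (admissible_of_nonneg le_rfl)

theorem admissible_of_threshold_lt {t s : ℝ} (h : threshold t < s) : Admissible t s := by
  obtain ⟨r, hr, hrs⟩ := exists_lt_of_csInf_lt ⟨0, admissible_of_nonneg le_rfl⟩ h
  exact Admissible.mono hr hrs.le

/-- By openness, an admissible infimum would have smaller admissible parameters next to it. -/
theorem not_admissible_threshold {t : ℝ} (ht : 0 < t) : ¬ Admissible t (threshold t) := by
  intro h
  have h1 : ∀ᶠ s in 𝓝 (threshold t), Admissible t s := by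
    have := isOpen_admissible.mem_nhds (x := (t, threshold t)) ⟨ht, h⟩
    have hc : ContinuousAt (fun s : ℝ => (t, s)) (threshold t) :=
      (Continuous.prodMk_right t).continuousAt
    exact (hc.eventually this).mono fun s hs => hs.2
  obtain ⟨s, hs1, hs2⟩ := (h1.filter_mono nhdsWithin_le_nhds |>.and
    (self_mem_nhdsWithin : Iio (threshold t) ∈ 𝓝[<] (threshold t))).exists
  exact absurd (csInf_le (bddBelow_admissible t) hs1) (not_le.2 hs2)

theorem threshold_lt_of_admissible {t s : ℝ} (ht : 0 < t) (h : Admissible t s) :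
    threshold t < s := by
  refine lt_of_le_of_ne (csInf_le (bddBelow_admissible t) h) fun he => ?_
  exact not_admissible_threshold ht (he ▸ h)

theorem ray_neg_two : ray (-2) = 0 := by
  rw [ray_of_nonpos (by norm_num)]; norm_num

theorem flow_zero_point (t : ℝ) : flow ham t 0 = 0 := by
  have h0 : ∀ t : ℝ, HasDerivAt (fun _ : ℝ => (0 : ℝ × ℝ)) (hamField 0) t := by
    intro t
    have : hamField 0 = 0 := by ext <;> simp [hamField, force]
    rw [this]
    exact hasDerivAt_const _ _
  exact congrFun (ODE_solution_unique_univ (v := fun _ => hamField) (s := fun _ => univ) (t₀ := 0)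
    (fun _ => lipschitzWith_hamField.lipschitzOnWith)
    (fun t => ⟨hasDerivAt_flow 0 t, mem_univ _⟩) (fun t => ⟨h0 t, mem_univ _⟩)
    (flow_zero _)) t

theorem rayPos_threshold_nonneg {t r : ℝ} (hr : r ∈ Ioc 0 t) : 0 ≤ rayPos r (threshold t) := by
  have h1 : Tendsto (fun s => rayPos r s) (𝓝[>] (threshold t)) (𝓝 (rayPos r (threshold t))) :=
    (continuous_rayPos_param hr.1).continuousAt.tendsto.mono_left nhdsWithin_le_nhds
  refine ge_of_tendsto h1 ?_
  filter_upwards [self_mem_nhdsWithin] with s hs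
  exact ((admissible_of_threshold_lt hs).2 r hr).le

theorem eq_neg_two_of_pos_vel_zero {t s : ℝ} (h1 : rayPos t s = 0) (h2 : rayVel t s = 0) :
    s = -2 := by
  have : ray s = 0 := flow_eq_zero (t := t) (Prod.ext h1 h2)
  rw [← ray_neg_two] at this
  exact ray_injective this

/-- As a limit of positive positions, the position at the threshold is nonnegative. A zero before
time t would be a local minimum, hence a zero of the velocity too, and the trajectory would be the
equilibrium s = -2. -/
theorem rayPos_threshold_pos {t : ℝ} (h : -2 < threshold t) :
    ∀ r ∈ Ioo 0 t, 0 < rayPos r (threshold t) := by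
  intro r hr
  refine lt_of_le_of_ne (rayPos_threshold_nonneg ⟨hr.1, hr.2.le⟩) fun h0 => ?_
  have hmin : IsLocalMin (fun r => rayPos r (threshold t)) r := by
    filter_upwards [Ioo_mem_nhds hr.1 hr.2] with r' hr'
    rw [← h0]
    exact rayPos_threshold_nonneg ⟨hr'.1, hr'.2.le⟩
  have := hmin.hasDerivAt_eq_zero (hasDerivAt_rayPos r _)
  linarith [eq_neg_two_of_pos_vel_zero h0.symm this]

theorem rayPos_threshold {t : ℝ} (ht : 0 < t) : rayPos t (threshold t) = 0 := by
  rcases (neg_two_le_threshold t).eq_or_lt with h | h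
  · rw [← h, rayPos, ray_neg_two, flow_zero_point]; rfl
  · refine le_antisymm ?_ (rayPos_threshold_nonneg ⟨ht, le_rfl⟩)
    by_contra! hpos
    refine not_admissible_threshold ht ⟨h, fun r hr => ?_⟩
    rcases hr.2.eq_or_lt with rfl | hlt
    · exact hpos
    · exact rayPos_threshold_pos h r ⟨hr.1, hlt⟩

/-- The position is nonnegative before t and zero at t, so its left difference quotients at t are
nonpositive. -/
theorem rayVel_threshold_nonpos {t : ℝ} (ht : 0 < t) : rayVel t (threshold t) ≤ 0 := by
  have h1 := (hasDerivAt_iff_tendsto_slope.1 (hasDerivAt_rayPos t (threshold t))).mono_left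
    (nhdsWithin_mono (s := Iio t) t fun r (hr : r < t) => hr.ne)
  refine le_of_tendsto h1 ?_
  filter_upwards [Ioo_mem_nhdsLT ht] with r hr
  rw [slope_def_field, rayPos_threshold ht, sub_zero]
  exact div_nonpos_of_nonneg_of_nonpos (rayPos_threshold_nonneg ⟨hr.1, hr.2.le⟩) (by linarith [hr.2])

theorem rayVel_threshold_neg {t : ℝ} (ht : 0 < t) (h : -2 < threshold t) :
    rayVel t (threshold t) < 0 := by
  refine lt_of_le_of_ne (rayVel_threshold_nonpos ht) fun h0 => ?_
  linarith [eq_neg_two_of_pos_vel_zero (rayPos_threshold ht) h0]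

/-! ### The trajectory through a given point -/

/-- Every point is reached by exactly one admissible trajectory. -/
theorem existsUnique_param {t x : ℝ} (ht : 0 < t) (hx : 0 < x) :
    ∃! s, Admissible t s ∧ rayPos t s = x := by
  have hc : Continuous fun s => rayPos t s := continuous_rayPos_param ht
  -- The position is 0 at the threshold and at least x + t at the parameter x.
  obtain ⟨s, hs, hsx⟩ : x ∈ (fun s => rayPos t s) '' Icc (threshold t) x := by
    refine intermediate_value_Icc (by linarith [threshold_nonpos t]) hc.continuousOn ⟨?_, ?_⟩
    · simp only [rayPos_threshold ht]; exact hx.le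
    · linarith [add_le_rayPos hx.le ht.le]
  simp only at hsx
  have hne : threshold t ≠ s := by
    rintro rfl
    rw [rayPos_threshold ht] at hsx
    exact hx.ne hsx
  have hadm := admissible_of_threshold_lt (lt_of_le_of_ne hs.1 hne)
  refine ⟨s, ⟨hadm, hsx⟩, fun r ⟨hr, hrx⟩ => ?_⟩
  exact le_antisymm ((rayPos_le_iff ht hr hadm).1 (by rw [hrx, hsx]))
    ((rayPos_le_iff ht hadm hr).1 (by rw [hrx, hsx]))

/-- The parameter of the trajectory through a point. -/
noncomputable def param (t x : ℝ) : ℝ :=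
  Classical.epsilon fun s => Admissible t s ∧ rayPos t s = x

theorem param_spec {t x : ℝ} (ht : 0 < t) (hx : 0 < x) :
    Admissible t (param t x) ∧ rayPos t (param t x) = x :=
  Classical.epsilon_spec (p := fun s => Admissible t s ∧ rayPos t s = x)
    (existsUnique_param ht hx).exists

/-- `IsStartingPoint` asks for positivity on (0, t) and `Admissible` on (0, t]; the assumption x > 0
supplies the endpoint. -/
theorem isStartingPoint_iff {t x : ℝ} (ht : 0 < t) (hx : 0 < x) {d : ℝ × ℝ} :
    IsStartingPoint t x d ↔ d = ray (param t x) := by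
  have key : ∀ s, IsStartingPoint t x (ray s) ↔ Admissible t s ∧ rayPos t s = x := by
    intro s
    constructor
    · rintro ⟨h1, h2, h3⟩
      obtain ⟨r, hr, hrs⟩ := mem_startSet_iff.1 h1
      rw [ray_injective hrs] at hr
      refine ⟨⟨hr, fun τ hτ => ?_⟩, h2⟩
      rcases hτ.2.eq_or_lt with rfl | hlt
      · rw [rayPos, h2]; exact hx
      · exact h3 τ ⟨hτ.1, hlt⟩
    · rintro ⟨h1, h2⟩
      exact ⟨mem_startSet_iff.2 ⟨s, h1.1, rfl⟩, h2, fun r hr => h1.2 r ⟨hr.1, hr.2.le⟩⟩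
  constructor
  · intro h
    obtain ⟨s, _, rfl⟩ := mem_startSet_iff.1 h.1
    rw [(existsUnique_param ht hx).unique ((key s).1 h) (param_spec ht hx)]
  · rintro rfl
    exact (key _).2 (param_spec ht hx)

theorem existsUnique_isStartingPoint {t x : ℝ} (ht : 0 < t) (hx : 0 < x) :
    ∃! d : ℝ × ℝ, IsStartingPoint t x d :=
  ⟨_, (isStartingPoint_iff ht hx).2 rfl, fun _ h => (isStartingPoint_iff ht hx).1 h⟩

theorem start_eq {t x : ℝ} (ht : 0 < t) (hx : 0 < x) : start t x = ray (param t x) :=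
  (isStartingPoint_iff ht hx).1
    (Classical.epsilon_spec (p := IsStartingPoint t x) (existsUnique_isStartingPoint ht hx).exists)

theorem sol_of_pos {t x : ℝ} (ht : 0 < t) (hx : 0 < x) : sol t x = rayVel t (param t x) := by
  rw [sol, if_pos hx, start_eq ht hx, rayVel]

theorem sol_neg {t : ℝ} (x : ℝ) : sol t (-x) = -sol t x := by
  unfold sol
  rcases lt_trichotomy x 0 with h | rfl | h
  · rw [if_pos (by linarith), if_neg (by linarith), if_pos h, neg_neg]
  · simp
  · rw [if_neg (by linarith), if_pos (by linarith), if_pos h, neg_neg]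

theorem abs_sol_le {t : ℝ} (ht : 0 < t) (x : ℝ) : |sol t x| ≤ 3 := by
  have hpos : ∀ x, 0 < x → |sol t x| ≤ 3 := fun x hx => by
    rw [sol_of_pos ht hx]
    exact abs_rayVel_le t (param_spec ht hx).1.1
  rcases lt_trichotomy x 0 with h | rfl | h
  · have := hpos (-x) (by linarith)
    rwa [sol_neg, abs_neg] at this
  · simp [sol]
  · exact hpos x h

theorem param_le_of_le {t s x : ℝ} (ht : 0 < t) (hx : 0 < x) (hs : Admissible t s)
    (h : x ≤ rayPos t s) : param t x ≤ s := by
  obtain ⟨h1, h2⟩ := param_spec ht hx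
  rw [← h2] at h
  exact (rayPos_le_iff ht h1 hs).1 h

theorem param_lt_of_lt {t s x : ℝ} (ht : 0 < t) (hx : 0 < x) (hs : Admissible t s)
    (h : x < rayPos t s) : param t x < s := by
  refine lt_of_le_of_ne (param_le_of_le ht hx hs h.le) fun he => ?_
  have := (param_spec ht hx).2
  rw [he] at this
  exact h.ne' this

theorem lt_param_of_lt {t s x : ℝ} (ht : 0 < t) (hx : 0 < x) (hs : Admissible t s)
    (h : rayPos t s < x) : s < param t x := by
  obtain ⟨h1, h2⟩ := param_spec ht hx
  rw [← h2] at h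
  by_contra! hle
  exact absurd ((rayPos_le_iff ht h1 hs).2 hle) (not_le.2 h)

theorem eventually_admissible {t s : ℝ} (ht : 0 < t) (hs : Admissible t s) :
    ∀ᶠ r in 𝓝 t, Admissible r s := by
  have hc : ContinuousAt (fun r : ℝ => (r, s)) t := (Continuous.prodMk_left s).continuousAt
  exact (hc.eventually (isOpen_admissible.mem_nhds (x := (t, s)) ⟨ht, hs⟩)).mono fun s hs => hs.2

/-- Monotonicity in s replaces an implicit function argument: a parameter s on one side of `param t
x` has its position strictly on that side of x, and this persists for nearby (t, x). The argument is
insensitive to the corner of the family at s = 0. -/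
theorem continuousAt_param {t x : ℝ} (ht : 0 < t) (hx : 0 < x) :
    ContinuousAt (fun y : ℝ × ℝ => param y.1 y.2) (t, x) := by
  obtain ⟨hadm, hpos⟩ := param_spec ht hx
  have hpos2 : ∀ᶠ y : ℝ × ℝ in 𝓝 (t, x), 0 < y.1 ∧ 0 < y.2 :=
    (eventually_gt_nhds ht).prod_nhds (eventually_gt_nhds hx)
  have hposc : ∀ s, ∀ᶠ y : ℝ × ℝ in 𝓝 (t, x), Admissible t s → Admissible y.1 s := by
    intro s
    by_cases hs : Admissible t s
    · exact (continuous_fst.continuousAt.eventually (eventually_admissible ht hs)).mono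
        fun y hy _ => hy
    · exact Eventually.of_forall fun y hy => absurd hy hs
  have hcont : ∀ s, ContinuousAt (fun y : ℝ × ℝ => y.2 - rayPos y.1 s) (t, x) := fun s =>
    (continuous_snd.sub ((continuous_rayPos_time s).comp continuous_fst)).continuousAt
  refine tendsto_order.2 ⟨fun a ha => ?_, fun b hb => ?_⟩
  · have hthr := threshold_lt_of_admissible ht hadm
    obtain ⟨s, hs1, hs2⟩ := exists_between (max_lt ha hthr)
    have hs : Admissible t s := admissible_of_threshold_lt ((le_max_right _ _).trans_lt hs1)
    have hlt := rayPos_lt ht hs hs2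
    simp only at hlt
    rw [hpos] at hlt
    filter_upwards [hpos2, hposc s, (hcont s).eventually_const_lt (sub_pos.2 hlt)] with y h1 h2 h3
    exact ((le_max_left _ _).trans_lt hs1).trans (lt_param_of_lt h1.1 h1.2 (h2 hs) (by linarith))
  · obtain ⟨s, hs1, hs2⟩ := exists_between hb
    have hs : Admissible t s := hadm.mono hs1.le
    have hlt := rayPos_lt ht hadm hs1
    rw [hpos] at hlt
    filter_upwards [hpos2, hposc s, (hcont s).eventually_lt_const (sub_neg.2 hlt)] with y h1 h2 h3
    exact (param_lt_of_lt h1.1 h1.2 (h2 hs) (by linarith)).trans hs2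

theorem continuousAt_sol_pos {t x : ℝ} (ht : 0 < t) (hx : 0 < x) :
    ContinuousAt (fun y : ℝ × ℝ => sol y.1 y.2) (t, x) := by
  have h1 : ContinuousAt (fun y : ℝ × ℝ => rayVel y.1 (param y.1 y.2)) (t, x) :=
    ContinuousAt.comp (x := (t, x)) (f := fun y : ℝ × ℝ => (y.1, param y.1 y.2))
      (continuousAt_rayVel ht _) (continuousAt_fst.prodMk (continuousAt_param ht hx))
  refine h1.congr ?_
  filter_upwards [(eventually_gt_nhds ht).prod_nhds (eventually_gt_nhds hx)] with y hy
  exact (sol_of_pos hy.1 hy.2).symm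

theorem continuousAt_sol {t x : ℝ} (ht : 0 < t) (hx : x ≠ 0) :
    ContinuousAt (fun y : ℝ × ℝ => sol y.1 y.2) (t, x) := by
  rcases hx.lt_or_gt with h | h
  · have h1 : ContinuousAt (fun y : ℝ × ℝ => -sol y.1 (-y.2)) (t, x) :=
      (ContinuousAt.comp (x := (t, x)) (f := fun y : ℝ × ℝ => (y.1, -y.2))
        (continuousAt_sol_pos ht (by linarith : 0 < -x)) (by fun_prop)).neg
    simpa only [sol_neg, neg_neg] using h1
  · exact continuousAt_sol_pos ht h

/-! ### Regularity of the solution off the discontinuity -/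

/-- The points `(0, 2) + s • e`. -/
noncomputable def branch (e : ℝ × ℝ) (s : ℝ) : ℝ × ℝ := (0, 2) + s • e

theorem branch_fan {s : ℝ} (h : s ≤ 0) : branch (0, 1) s = ray s := by
  rw [ray_of_nonpos h]; simp [branch]

theorem branch_straight {s : ℝ} (h : 0 ≤ s) : branch (1, 0) s = ray s := by
  rw [ray_of_nonneg h]; simp [branch]

/-- The derivative of the flow along a branch of starting points. -/
noncomputable def branchVar (e : ℝ × ℝ) (t s : ℝ) : ℝ × ℝ := variation (branch e s) e t

/-- The spatial derivative of the solution, as a function of time and of the parameter. -/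
noncomputable def branchSlope (e : ℝ × ℝ) (t s : ℝ) : ℝ :=
  (branchVar e t s).2 / (branchVar e t s).1

theorem continuousAt_branchVar (e : ℝ × ℝ) {t : ℝ} (ht : 0 < t) (s : ℝ) :
    ContinuousAt (fun y : ℝ × ℝ => branchVar e y.1 y.2) (t, s) :=
  ContinuousAt.comp (x := (t, s)) (f := fun y : ℝ × ℝ => (y.1, (0, 2) + y.2 • e))
    (continuousAt_variation ht _ e) (continuousAt_line (0, 2) e (t, s))

theorem continuousAt_branchSlope (e : ℝ × ℝ) {t : ℝ} (ht : 0 < t) {s : ℝ}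
    (h : (branchVar e t s).1 ≠ 0) :
    ContinuousAt (fun y : ℝ × ℝ => branchSlope e y.1 y.2) (t, s) :=
  (continuousAt_branchVar e ht s).snd.div (continuousAt_branchVar e ht s).fst h

theorem hasDerivAt_branch_fst (e : ℝ × ℝ) {t : ℝ} (ht : 0 ≤ t) (s : ℝ) :
    HasDerivAt (fun s => (flow ham t (branch e s)).1) (branchVar e t s).1 s :=
  (hasDerivAt_flow_line' (0, 2) e ht s).fst

/-- The lower bound of `rayPos_sub_ge_fan` passes to the limit in the difference quotients. Left
quotients are used so that both parameters stay in the fan even when s = 0. -/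
theorem branchVar_fan_pos {t s : ℝ} (ht : 0 < t) (hs : Admissible t s) (h0 : s ≤ 0) :
    0 < (branchVar (0, 1) t s).1 := by
  have hp : 0 < 2 + s := by linarith [hs.1]
  have h1 := (hasDerivAt_iff_tendsto_slope.1 (hasDerivAt_branch_fst (0, 1) ht.le s)).mono_left
    (nhdsWithin_mono (s := Iio s) s fun r (hr : r < s) => hr.ne)
  have h2 : Tendsto (fun r => rayPos t r / (2 + r)) (𝓝[<] s) (𝓝 (rayPos t s / (2 + s))) :=
    (((continuous_rayPos_param ht).continuousAt (x := s)).div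
      (by fun_prop) hp.ne').tendsto.mono_left nhdsWithin_le_nhds
  have h3 : ∀ᶠ r in 𝓝[<] s, threshold t < r :=
    nhdsWithin_le_nhds (eventually_gt_nhds (threshold_lt_of_admissible ht hs))
  refine (div_pos (hs.pos ht) hp).trans_le (le_of_tendsto_of_tendsto h2 h1 ?_)
  filter_upwards [h3, self_mem_nhdsWithin] with r hr hrs
  have hrs : r < s := hrs
  have := rayPos_sub_ge_fan ht (admissible_of_threshold_lt hr) hrs h0
  rw [slope_comm, slope_def_field, branch_fan h0, branch_fan (hrs.le.trans h0),
    le_div_iff₀ (by linarith)]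
  exact this

theorem branchVar_straight_pos {t s : ℝ} (ht : 0 < t) (h0 : 0 ≤ s) :
    0 < (branchVar (1, 0) t s).1 := by
  have h1 := (hasDerivAt_iff_tendsto_slope.1 (hasDerivAt_branch_fst (1, 0) ht.le s)).mono_left
    (nhdsWithin_mono (s := Ioi s) s fun r (hr : s < r) => hr.ne')
  refine lt_of_lt_of_le (by norm_num : (0 : ℝ) < 1 / 2) (ge_of_tendsto h1 ?_)
  filter_upwards [self_mem_nhdsWithin] with r hrs
  have hrs : s < r := hrs
  have := rayPos_sub_ge_straight ht.le h0 hrs.le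
  rw [slope_def_field, branch_straight h0, branch_straight (h0.trans hrs.le),
    le_div_iff₀ (by linarith)]
  simp only [rayPos] at this
  linarith

/-- If the starting points of the trajectories near `(t, x)` belong to a branch, the solution is of
class `C¹` near `(t, x)`, with explicit derivatives. -/
theorem sol_regular_of_branch {e : ℝ × ℝ} {t x : ℝ} (ht : 0 < t) (hx : 0 < x)
    (hb : ∀ᶠ s in 𝓝 (param t x), branch e s = ray s) (hv : (branchVar e t (param t x)).1 ≠ 0) :
    ContDiffAt ℝ 1 (fun y : ℝ × ℝ => sol y.1 y.2) (t, x) ∧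
    HasDerivAt (fun y => sol t y) (branchSlope e t (param t x)) x ∧
    HasDerivAt (fun r => sol r x)
      (-force x - sol t x * branchSlope e t (param t x)) t := by
  set s := param t x with hs
  obtain ⟨hadm, hpos⟩ := param_spec ht hx
  rw [← hs] at hadm hpos
  set F : ℝ × ℝ → ℝ × ℝ := fun y => flow ham y.1 ((0, 2) + y.2 • e) with hF
  have hF1 : ContDiffAt ℝ 1 F (t, s) := contDiffAt_flow_line (0, 2) e ht
  have hF2 : HasFDerivAt F (lineDeriv (0, 2) e (t, s)) (t, s) :=
    (continuousAt_lineDeriv (0, 2) e (y := (t, s)) ht).2.hasFDerivAt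
  set V := branchVar e t s with hV
  have hray : (0, 2) + s • e = ray s := hb.self_of_nhds
  have hL : ∀ w : ℝ × ℝ, lineDeriv (0, 2) e (t, s) w
      = (w.1 * rayVel t s + w.2 * V.1, w.1 * (-force x) + w.2 * V.2) := by
    intro w
    have h1 : hamField (flow ham t (ray s)) = (rayVel t s, -force x) := by
      rw [← hpos]; rfl
    have h2 : variation (ray s) e t = V := by rw [← hray]; rfl
    rw [lineDeriv_apply]
    simp only [hray, h1, h2]
    ext <;> simp
  -- L is the derivative of (t, s) ↦ (t, position). It is triangular with diagonal entries 1 and V.1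
  -- ≠ 0, which gives the inverse explicitly.
  set L : ℝ × ℝ →L[ℝ] ℝ × ℝ := (ContinuousLinearMap.fst ℝ ℝ ℝ).prod
    (rayVel t s • ContinuousLinearMap.fst ℝ ℝ ℝ + V.1 • ContinuousLinearMap.snd ℝ ℝ ℝ) with hLdef
  let A : (ℝ × ℝ) ≃L[ℝ] (ℝ × ℝ) := ContinuousLinearEquiv.equivOfInverse L
    ((ContinuousLinearMap.fst ℝ ℝ ℝ).prod
      (V.1⁻¹ • (ContinuousLinearMap.snd ℝ ℝ ℝ - rayVel t s • ContinuousLinearMap.fst ℝ ℝ ℝ)))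
    (fun w => by ext <;> simp [L, hv]) (fun w => by ext <;> simp [L, hv])
  set G : ℝ × ℝ → ℝ × ℝ := fun y => (y.1, (F y).1) with hG
  have hG1 : ContDiffAt ℝ 1 G (t, s) := contDiffAt_fst.prodMk (contDiffAt_fst.comp (t, s) hF1)
  have hG2 : HasFDerivAt G (A : ℝ × ℝ →L[ℝ] ℝ × ℝ) (t, s) := by
    have h := (hasFDerivAt_fst (𝕜 := ℝ) (p := (t, s))).prodMk hF2.fst
    refine h.congr_fderiv ?_
    refine ContinuousLinearMap.ext fun w => ?_
    change (w.1, (lineDeriv (0, 2) e (t, s) w).1) = L w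
    rw [hL]
    ext <;> simp [L, mul_comm]
  have hGval : G (t, s) = (t, x) := by
    simp only [hG, hF, hray]
    exact Prod.ext rfl hpos
  have hcp := continuousAt_param ht hx
  have hcp2 : Tendsto (fun y : ℝ × ℝ => (y.1, param y.1 y.2)) (𝓝 (t, x)) (𝓝 (t, s)) :=
    continuousAt_fst.prodMk hcp
  have hpos2 : ∀ᶠ y : ℝ × ℝ in 𝓝 (t, x), 0 < y.1 ∧ 0 < y.2 :=
    (eventually_gt_nhds ht).prod_nhds (eventually_gt_nhds hx)
  have hb2 : ∀ᶠ y : ℝ × ℝ in 𝓝 (t, x), branch e (param y.1 y.2) = ray (param y.1 y.2) :=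
    hcp.eventually hb
  have hGp : ∀ᶠ y : ℝ × ℝ in 𝓝 (t, x), G (y.1, param y.1 y.2) = y := by
    filter_upwards [hpos2, hb2] with y hy hby
    have hby : (0, 2) + param y.1 y.2 • e = ray (param y.1 y.2) := hby
    simp only [hG, hF, hby]
    exact Prod.ext rfl (param_spec hy.1 hy.2).2
  have hparam : ContDiffAt ℝ 1 (fun y : ℝ × ℝ => (y.1, param y.1 y.2)) (t, x) := by
    have h1 := hG1.to_localInverse hG2 one_ne_zero
    rw [hGval] at h1
    refine h1.congr_of_eventuallyEq ?_
    -- Continuity of `param` keeps (t, param t x) in the neighbourhood where the local inverse is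
    -- valid, so `param` coincides with its second component.
    have h2 := (hG1.hasStrictFDerivAt' hG2 one_ne_zero).eventually_left_inverse
    filter_upwards [hcp2.eventually h2, hGp] with y hy1 hy2
    rw [hy2] at hy1
    exact hy1.symm
  have hsol : (fun y : ℝ × ℝ => sol y.1 y.2) =ᶠ[𝓝 (t, x)]
      fun y => (F (y.1, param y.1 y.2)).2 := by
    filter_upwards [hpos2, hb2] with y hy hby
    have hby : (0, 2) + param y.1 y.2 • e = ray (param y.1 y.2) := hby
    simp only [hF, hby]
    exact sol_of_pos hy.1 hy.2
  have hFp : ContDiffAt ℝ 1 (fun y : ℝ × ℝ => F (y.1, param y.1 y.2)) (t, x) :=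
    ContDiffAt.comp (t, x) (f := fun y : ℝ × ℝ => (y.1, param y.1 y.2)) hF1 hparam
  refine ⟨(contDiffAt_snd.comp (t, x) hFp).congr_of_eventuallyEq hsol, ?_, ?_⟩
  · have hline : ContinuousAt (fun y : ℝ => (t, y)) x := (Continuous.prodMk_right t).continuousAt
    obtain ⟨d, hd⟩ : ∃ d, HasDerivAt (fun y => param t y) d x := by
      have h1 := (contDiffAt_snd.comp (t, x) hparam).differentiableAt one_ne_zero
      have h2 : DifferentiableAt ℝ (fun y : ℝ => (t, y)) x := by fun_prop
      exact ⟨_, (DifferentiableAt.comp (f := fun y : ℝ => (t, y)) x h1 h2).hasDerivAt⟩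
    have hd2 : HasDerivAt (fun y => F (t, param t y)) (lineDeriv (0, 2) e (t, s) (0, d)) x :=
      HasFDerivAt.comp_hasDerivAt (l := F) (f := fun y => (t, param t y)) x hF2 ((hasDerivAt_const x t).prodMk hd)
    rw [hL] at hd2
    have e1 : HasDerivAt (fun y => (F (t, param t y)).1) 1 x := by
      refine (hasDerivAt_id x).congr_of_eventuallyEq ?_
      filter_upwards [hline.eventually hGp] with y hy
      exact congrArg Prod.snd hy
    -- Differentiating "position of `param t y` is y" gives d * V.1 = 1, so the velocity has slope d
    -- * V.2 = V.2 / V.1.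
    have e2 := HasDerivAt.unique (hd2.fst : HasDerivAt (fun y => (F (t, param t y)).1) _ x) e1
    have e3 := HasDerivAt.congr_of_eventuallyEq
      (hd2.snd : HasDerivAt (fun y => (F (t, param t y)).2) _ x) (hline.eventually hsol)
    refine e3.congr_deriv ?_
    simp only [zero_mul, zero_add] at e2 ⊢
    rw [branchSlope, eq_div_iff hv]
    linear_combination V.2 * e2
  · have hline : ContinuousAt (fun r : ℝ => (r, x)) t := (Continuous.prodMk_left x).continuousAt
    obtain ⟨d, hd⟩ : ∃ d, HasDerivAt (fun r => param r x) d t := by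
      have h1 := (contDiffAt_snd.comp (t, x) hparam).differentiableAt one_ne_zero
      have h2 : DifferentiableAt ℝ (fun r : ℝ => (r, x)) t := by fun_prop
      exact ⟨_, (DifferentiableAt.comp (f := fun r : ℝ => (r, x)) t h1 h2).hasDerivAt⟩
    have hd2 : HasDerivAt (fun r => F (r, param r x)) (lineDeriv (0, 2) e (t, s) (1, d)) t :=
      HasFDerivAt.comp_hasDerivAt (l := F) (f := fun r => (r, param r x)) t hF2 ((hasDerivAt_id t).prodMk hd)
    rw [hL] at hd2
    have e1 : HasDerivAt (fun r => (F (r, param r x)).1) 0 t := by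
      refine (hasDerivAt_const t x).congr_of_eventuallyEq ?_
      filter_upwards [hline.eventually hGp] with y hy
      exact congrArg Prod.snd hy
    -- At fixed x the position is constant in time, so d * V.1 = -u; this turns the time derivative
    -- of the velocity into -force x - u * (V.2 / V.1).
    have e2 := HasDerivAt.unique (hd2.fst : HasDerivAt (fun r => (F (r, param r x)).1) _ t) e1
    have e3 := HasDerivAt.congr_of_eventuallyEq
      (hd2.snd : HasDerivAt (fun r => (F (r, param r x)).2) _ t) (hline.eventually hsol)
    refine e3.congr_deriv ?_
    simp only [one_mul] at e2 ⊢
    rw [sol_of_pos ht hx, branchSlope]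
    rw [← hs, ← hV]
    field_simp
    linear_combination V.2 * e2

theorem qSharp_eq (t : ℝ) : qSharp t = rayPos t 0 := by
  rw [qSharp, rayPos, ray_of_nonneg le_rfl]

/-- The spatial derivative of the solution on the right half-line. -/
noncomputable def solSlope (t x : ℝ) : ℝ :=
  if x ≤ qSharp t then branchSlope (0, 1) t (param t x) else branchSlope (1, 0) t (param t x)

theorem param_nonpos_iff {t x : ℝ} (ht : 0 < t) (hx : 0 < x) : param t x ≤ 0 ↔ x ≤ qSharp t := by
  obtain ⟨h1, h2⟩ := param_spec ht hx
  rw [← rayPos_le_iff ht h1 (admissible_of_nonneg le_rfl), h2, qSharp_eq]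

theorem param_nonneg_iff {t x : ℝ} (ht : 0 < t) (hx : 0 < x) : 0 ≤ param t x ↔ qSharp t ≤ x := by
  obtain ⟨h1, h2⟩ := param_spec ht hx
  rw [← rayPos_le_iff ht (admissible_of_nonneg le_rfl) h1, h2, qSharp_eq]

theorem sol_regular {t x : ℝ} (ht : 0 < t) (hx : 0 < x) (hq : x ≠ qSharp t) :
    ContDiffAt ℝ 1 (fun y : ℝ × ℝ => sol y.1 y.2) (t, x) ∧
    HasDerivAt (fun y => sol t y) (solSlope t x) x ∧
    HasDerivAt (fun r => sol r x) (-force x - sol t x * solSlope t x) t := by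
  unfold solSlope
  have hadm := (param_spec ht hx).1
  rcases hq.lt_or_gt with h | h
  · have hp : param t x < 0 := by
      rw [← not_le, param_nonneg_iff ht hx]; exact not_le.2 h
    rw [if_pos h.le]
    exact sol_regular_of_branch ht hx
      ((eventually_lt_nhds hp).mono fun s hs => branch_fan hs.le)
      (branchVar_fan_pos ht hadm hp.le).ne'
  · have hp : 0 < param t x := by
      rw [← not_le, param_nonpos_iff ht hx]; exact not_le.2 h
    rw [if_neg (not_le.2 h)]
    exact sol_regular_of_branch ht hx
      ((eventually_gt_nhds hp).mono fun s hs => branch_straight hs.le)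
      (branchVar_straight_pos ht hp.le).ne'

theorem isClassicalSolutionAt_sol {t x : ℝ} (ht : 0 < t) (hx : x ≠ 0) (hq : |x| ≠ qSharp t) :
    IsClassicalSolutionAt ham sol t x := by
  have hd : ∀ {ux : ℝ}, HasDerivAt (fun y => sol t y) ux x →
      deriv (fun y => ham y (sol t y)) x = sol t x * ux + force x := by
    intro ux h
    have h1 : HasDerivAt (fun y => ham y (sol t y)) (sol t x * ux + force x) x := by
      refine HasDerivAt.congr_deriv (((h.pow 2).div_const 2).add (hasDerivAt_g x)) ?_
      push_cast
      ring
    exact h1.deriv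
  rcases hx.lt_or_gt with h | h
  · rw [abs_of_neg h] at hq
    obtain ⟨h1, h2, h3⟩ := sol_regular ht (by linarith : 0 < -x) hq
    have e1 : ContDiffAt ℝ 1 (fun y : ℝ × ℝ => sol y.1 y.2) (t, x) := by
      have : ContDiffAt ℝ 1 (fun y : ℝ × ℝ => -sol y.1 (-y.2)) (t, x) :=
        (ContDiffAt.comp (t, x) (f := fun y : ℝ × ℝ => (y.1, -y.2)) h1
          (contDiffAt_fst.prodMk contDiffAt_snd.neg)).neg
      simpa only [sol_neg, neg_neg] using this
    have e2 : HasDerivAt (fun y => sol t y) (solSlope t (-x)) x := by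
      have := (HasDerivAt.comp x (h := fun y : ℝ => -y) h2 (hasDerivAt_neg x)).neg
      have h4 : HasDerivAt (fun y => -sol t (-y)) (solSlope t (-x)) x :=
        HasDerivAt.congr_deriv this (by ring)
      simpa only [sol_neg, neg_neg] using h4
    have e3 : HasDerivAt (fun r => sol r x) (-force x - sol t x * solSlope t (-x)) t := by
      have := h3.neg
      have h4 : HasDerivAt (fun r => -sol r (-x)) (-force x - sol t x * solSlope t (-x)) t := by
        refine HasDerivAt.congr_deriv this ?_
        rw [force_neg, sol_neg]; ring
      simpa only [sol_neg, neg_neg] using h4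
    refine ⟨e1, ?_⟩
    rw [e3.deriv, hd e2]
    ring
  · rw [abs_of_pos h] at hq
    obtain ⟨h1, h2, h3⟩ := sol_regular ht h hq
    refine ⟨h1, ?_⟩
    rw [h3.deriv, hd h2]
    ring

/-! ### The initial datum -/

/-- Speeds are at most 3, so before time x / 3 the fan has not reached x. The trajectory through x
then starts with velocity 2, which changes by at most 8 times the elapsed time. -/
theorem tendsto_sol_zero_pos {x : ℝ} (hx : 0 < x) {f : ℕ → ℝ} (hf : Tendsto f atTop (𝓝[>] 0)) :
    Tendsto (fun n => sol (f n) x) atTop (𝓝 2) := by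
  have hf0 : Tendsto f atTop (𝓝 0) := hf.mono_right nhdsWithin_le_nhds
  have hev : ∀ᶠ n in atTop, |sol (f n) x - 2| ≤ 8 * f n := by
    filter_upwards [hf.eventually self_mem_nhdsWithin,
      hf0.eventually (gt_mem_nhds (by positivity : 0 < x / 3))] with n h1 h2
    have h1 : 0 < f n := h1
    have h3 : rayPos (f n) 0 < x := by
      have := rayPos_le_add (by norm_num : (-2 : ℝ) < 0) h1.le
      simp only [max_self] at this
      linarith
    have h4 := lt_param_of_lt h1 hx (admissible_of_nonneg le_rfl) h3
    have h5 := rayVel_ge (param (f n) x) h1.le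
    have h6 := rayVel_le (param (f n) x) h1.le
    rw [min_eq_right h4.le] at h5 h6
    rw [sol_of_pos h1 hx, abs_le]
    constructor <;> linarith
  rw [tendsto_iff_norm_sub_tendsto_zero]
  refine squeeze_zero' (Eventually.of_forall fun _ => norm_nonneg _) hev ?_
  simpa using hf0.const_mul 8

theorem tendsto_sol_datum {x : ℝ} (hx : x ≠ 0) :
    Tendsto (fun t => sol t x) (𝓝[>] 0) (𝓝 (datum x)) := by
  refine tendsto_of_seq_tendsto fun f hf => ?_
  rcases hx.lt_or_gt with h | h
  · have := (tendsto_sol_zero_pos (by linarith : 0 < -x) hf).neg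
    rw [datum, if_pos h]
    simpa only [sol_neg, neg_neg, Function.comp_def] using this
  · rw [datum, if_neg (not_lt.2 h.le)]
    exact tendsto_sol_zero_pos h hf

/-! ### The traces along the discontinuity -/

theorem tendsto_param_zero {t : ℝ} (ht : 0 < t) :
    Tendsto (fun y : ℝ × ℝ => param y.1 y.2) (𝓝[{z | 0 < z.2}] (t, 0)) (𝓝 (threshold t)) := by
  have hpos : ∀ᶠ y : ℝ × ℝ in 𝓝[{z | 0 < z.2}] (t, 0), 0 < y.1 ∧ 0 < y.2 := by
    have : ∀ᶠ y : ℝ × ℝ in 𝓝 (t, 0), 0 < y.1 := continuousAt_fst.eventually_const_lt ht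
    filter_upwards [nhdsWithin_le_nhds this, self_mem_nhdsWithin] with y h1 h2 using ⟨h1, h2⟩
  refine tendsto_order.2 ⟨fun a ha => ?_, fun b hb => ?_⟩
  · rcases le_or_gt a (-2) with h2 | h2
    · filter_upwards [hpos] with y hy
      exact h2.trans_lt (param_spec hy.1 hy.2).1.1
    -- Below the threshold the trajectory fails to be positive strictly before t: otherwise every
    -- larger parameter would be admissible at t. Being strict, this excludes the parameter a, and
    -- those below it, at nearby times as well.
    · obtain ⟨r, hr, hra⟩ : ∃ r ∈ Ioo 0 t, rayPos r a ≤ 0 := by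
        by_contra! hall
        obtain ⟨s, hs1, hs2⟩ := exists_between ha
        exact absurd (threshold_lt_of_admissible ht (admissible_of_lt h2 hs1 hall)) hs2.not_gt
      have : ∀ᶠ y : ℝ × ℝ in 𝓝 (t, 0), r < y.1 := continuousAt_fst.eventually_const_lt hr.2
      filter_upwards [hpos, nhdsWithin_le_nhds this] with y hy hry
      by_contra! hle
      exact absurd (((param_spec hy.1 hy.2).1.mono hle).2 r ⟨hr.1, hry.le⟩) (not_lt.2 hra)
  · obtain ⟨s, hs1, hs2⟩ := exists_between hb
    have hs := admissible_of_threshold_lt hs1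
    have h1 : ∀ᶠ y : ℝ × ℝ in 𝓝 (t, 0), Admissible y.1 s :=
      continuousAt_fst.eventually (eventually_admissible ht hs)
    have h2 : ContinuousAt (fun y : ℝ × ℝ => y.2 - rayPos y.1 s) (t, 0) :=
      (continuous_snd.sub ((continuous_rayPos_time s).comp continuous_fst)).continuousAt
    have h3 := h2.eventually_lt_const (u := 0) (by have := hs.pos ht; simp only; linarith)
    filter_upwards [hpos, nhdsWithin_le_nhds h1, nhdsWithin_le_nhds h3] with y h4 h5 h6
    exact (param_lt_of_lt h4.1 h4.2 h5 (by linarith)).trans hs2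

/-- The trace of the solution on the right of the line `x = 0`. -/
noncomputable def trace (t : ℝ) : ℝ := rayVel t (threshold t)

theorem tendsto_sol_right {t : ℝ} (ht : 0 < t) :
    Tendsto (fun y : ℝ × ℝ => sol y.1 y.2) (𝓝[{z | 0 < z.2}] (t, 0)) (𝓝 (trace t)) := by
  have h1 : Tendsto (fun y : ℝ × ℝ => rayVel y.1 (param y.1 y.2)) (𝓝[{z | 0 < z.2}] (t, 0))
      (𝓝 (trace t)) := by
    refine (continuousAt_rayVel ht (threshold t)).tendsto.comp
      (Tendsto.prodMk_nhds ?_ (tendsto_param_zero ht))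
    exact continuousAt_fst.tendsto.mono_left nhdsWithin_le_nhds
  refine h1.congr' ?_
  have : ∀ᶠ y : ℝ × ℝ in 𝓝 (t, 0), 0 < y.1 := continuousAt_fst.eventually_const_lt ht
  filter_upwards [nhdsWithin_le_nhds this, self_mem_nhdsWithin] with y h1 h2
  exact (sol_of_pos h1 h2).symm

theorem tendsto_sol_left {t : ℝ} (ht : 0 < t) :
    Tendsto (fun y : ℝ × ℝ => sol y.1 y.2) (𝓝[{z | z.2 < 0}] (t, 0)) (𝓝 (-trace t)) := by
  have h1 : Tendsto (fun y : ℝ × ℝ => (y.1, -y.2)) (𝓝[{z | z.2 < 0}] (t, 0))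
      (𝓝[{z | 0 < z.2}] (t, 0)) := by
    refine tendsto_nhdsWithin_iff.2 ⟨?_, ?_⟩
    · have : ContinuousAt (fun y : ℝ × ℝ => (y.1, -y.2)) (t, 0) := by fun_prop
      have h := this.tendsto.mono_left (nhdsWithin_le_nhds (s := {z : ℝ × ℝ | z.2 < 0}))
      simpa using h
    · filter_upwards [self_mem_nhdsWithin] with y (hy : y.2 < 0)
      exact neg_pos.2 hy
  have h2 := ((tendsto_sol_right ht).comp h1).neg
  simpa only [Function.comp_def, sol_neg, neg_neg] using h2

/-- Sturm comparison. If the threshold were -2, trajectories of arbitrarily small amplitude would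
stay positive up to t. But near 0 the stiffness exceeds w² for some w < 2√2 with π / w < t, so they
must return to 0 no later than sin(wr) does. -/
theorem neg_two_lt_threshold {t : ℝ} (h : Real.pi / (2 * √2) < t) : -2 < threshold t := by
  have hpi := Real.pi_pos
  have ht : 0 < t := lt_of_le_of_lt (by positivity) h
  have h8 : (2 * √2) ^ 2 = 8 := by rw [mul_pow, Real.sq_sqrt (by norm_num)]; norm_num
  obtain ⟨w, hw1, hw2⟩ : ∃ w, Real.pi / t < w ∧ w < 2 * √2 := by
    refine exists_between ?_
    rw [div_lt_iff₀ (by positivity)] at h ⊢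
    linarith
  have hw0 : 0 < w := lt_trans (by positivity) hw1
  have hwsq : w ^ 2 < 8 := by rw [← h8]; gcongr
  have hπt : Real.pi / w < t := by
    rw [div_lt_iff₀ ht] at hw1
    rw [div_lt_iff₀ hw0]; linarith
  have hπ0 : 0 < Real.pi / w := by positivity
  refine lt_of_le_of_ne (neg_two_le_threshold t) fun hthr => ?_
  have hst : ∀ᶠ q in 𝓝 (0 : ℝ), w ^ 2 < stiffness q := by
    have hc : Continuous stiffness := by unfold stiffness; fun_prop
    exact hc.continuousAt.eventually_const_lt (by simpa [stiffness] using hwsq)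
  obtain ⟨η, hη, hst⟩ := Metric.eventually_nhds_iff.1 hst
  -- By energy the speed never exceeds p, so up to time π / w the position stays below pπ / w ≤ η /
  -- 2, where the stiffness exceeds w². The bound 1 keeps -2 + p in the fan.
  set p := min 1 (η * w / (2 * Real.pi)) with hp
  have hp0 : 0 < p := lt_min one_pos (by positivity)
  have hp1 : p ≤ 1 := min_le_left _ _
  have hpη : p * (Real.pi / w) < η := by
    have : p ≤ η * w / (2 * Real.pi) := min_le_right _ _
    calc p * (Real.pi / w) ≤ η * w / (2 * Real.pi) * (Real.pi / w) := by gcongr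
      _ = η / 2 := by field_simp
      _ < η := by linarith
  have hadm : Admissible t (-2 + p) := admissible_of_threshold_lt (by linarith)
  have hvel : ∀ r, rayVel r (-2 + p) ≤ p := by
    intro r
    have h1 := ham_flow (ray (-2 + p)) r
    simp only [ham, ← rayPos.eq_1, ← rayVel.eq_1] at h1
    rw [ray_of_nonpos (by linarith)] at h1
    simp only [g_zero] at h1
    have h2 := g_nonneg (rayPos r (-2 + p))
    exact abs_le_of_sq_le_sq' (by nlinarith) hp0.le |>.2
  have hpos : ∀ r, 0 ≤ r → rayPos r (-2 + p) ≤ p * r := by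
    intro r hr
    have hm : Monotone fun r => p * r - rayPos r (-2 + p) := by
      refine monotone_of_hasDerivAt_nonneg
        (fun r => ((hasDerivAt_id r).const_mul p).sub (hasDerivAt_rayPos r (-2 + p))) fun r => ?_
      have := hvel r
      simp only [Pi.zero_apply]
      linarith
    have := hm hr
    simp only [rayPos_zero, max_eq_right (by linarith : -2 + p ≤ 0)] at this
    linarith
  have hd : ∀ r, HasDerivAt (fun r => rayVel r (-2 + p) * Real.sin (w * r)
      - w * rayPos r (-2 + p) * Real.cos (w * r))
      ((w ^ 2 - stiffness (rayPos r (-2 + p))) * rayPos r (-2 + p) * Real.sin (w * r)) r := by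
    intro r
    have hl : HasDerivAt (fun r => w * r) w r := by
      simpa using (hasDerivAt_id r).const_mul w
    refine HasDerivAt.congr_deriv (((hasDerivAt_rayVel r (-2 + p)).mul hl.sin).sub
      (((hasDerivAt_rayPos r (-2 + p)).const_mul w).mul hl.cos)) ?_
    simp only [force]
    ring
  have hanti : AntitoneOn (fun r => rayVel r (-2 + p) * Real.sin (w * r)
      - w * rayPos r (-2 + p) * Real.cos (w * r)) (Icc 0 (Real.pi / w)) := by
    refine antitoneOn_of_hasDerivWithinAt_nonpos (convex_Icc _ _)
      (fun r _ => (hd r).continuousAt.continuousWithinAt)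
      (fun r _ => (hd r).hasDerivWithinAt) fun r hr => ?_
    rw [interior_Icc] at hr
    have h1 : 0 < rayPos r (-2 + p) := hadm.2 r ⟨hr.1, (hr.2.trans hπt).le⟩
    have h2 : rayPos r (-2 + p) < η := by
      refine (hpos r hr.1.le).trans_lt (lt_of_le_of_lt ?_ hpη)
      gcongr
      exact hr.2.le
    have h3 := hst (y := rayPos r (-2 + p)) (by
      rw [Real.dist_eq, sub_zero, abs_of_pos h1]; exact h2)
    have h4 : 0 ≤ Real.sin (w * r) := by
      refine Real.sin_nonneg_of_nonneg_of_le_pi (by have := hr.1; positivity) ?_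
      have := (lt_div_iff₀ hw0).1 hr.2
      linarith
    exact mul_nonpos_of_nonpos_of_nonneg
      (mul_nonpos_of_nonpos_of_nonneg (by linarith) h1.le) h4
  -- The Wronskian with sin(wr) is 0 at time 0 and w times the position at π / w, hence positive
  -- there, although it is nonincreasing.
  have h1 := hanti (left_mem_Icc.2 hπ0.le) (right_mem_Icc.2 hπ0.le) hπ0.le
  have h2 : w * (Real.pi / w) = Real.pi := by field_simp
  have h3 : 0 < rayPos (Real.pi / w) (-2 + p) := hadm.2 _ ⟨hπ0, hπt.le⟩
  simp only [h2, Real.sin_pi, Real.cos_pi, mul_zero, Real.sin_zero, rayPos_zero,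
    max_eq_right (by linarith : -2 + p ≤ 0), zero_mul, sub_zero, zero_sub] at h1
  nlinarith [mul_pos hw0 h3]

theorem hasStationaryEntropicShock_sol {t : ℝ} (h : Real.pi / (2 * √2) < t) :
    HasStationaryEntropicShock ham sol t 0 := by
  have ht : 0 < t := lt_of_le_of_lt (by have := Real.pi_pos; positivity) h
  have hneg : trace t < 0 := rayVel_threshold_neg ht (neg_two_lt_threshold h)
  refine ⟨-trace t, trace t, tendsto_sol_left ht, tendsto_sol_right ht, by linarith, ?_, ?_, ?_⟩
  · simp [ham]
  · rw [deriv_ham_snd]; exact hneg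
  · rw [deriv_ham_snd]; linarith

theorem qSharp_pos {t : ℝ} (ht : 0 < t) : 0 < qSharp t := by
  rw [qSharp_eq]
  exact (admissible_of_nonneg le_rfl).pos ht

theorem trace_nonpos {t : ℝ} (ht : 0 < t) : trace t ≤ 0 := rayVel_threshold_nonpos ht

/-! ### The entropy balance on rectangles -/

/-- The time derivative of a test function. -/
noncomputable def dt (φ : ℝ × ℝ → ℝ) (z : ℝ × ℝ) : ℝ := fderiv ℝ φ z (1, 0)

/-- The space derivative of a test function. -/
noncomputable def dx (φ : ℝ × ℝ → ℝ) (z : ℝ × ℝ) : ℝ := fderiv ℝ φ z (0, 1)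

section TestFunction

variable {φ : ℝ × ℝ → ℝ}

theorem hasDerivAt_dt (hφ : ContDiff ℝ 1 φ) (t x : ℝ) :
    HasDerivAt (fun s => φ (s, x)) (dt φ (t, x)) t :=
  HasFDerivAt.comp_hasDerivAt (l := φ) (f := fun s => (s, x)) t
    (hφ.differentiable one_ne_zero (t, x)).hasFDerivAt
    ((hasDerivAt_id t).prodMk (hasDerivAt_const t x))

theorem hasDerivAt_dx (hφ : ContDiff ℝ 1 φ) (t x : ℝ) :
    HasDerivAt (fun y => φ (t, y)) (dx φ (t, x)) x :=
  HasFDerivAt.comp_hasDerivAt (l := φ) (f := fun y => (t, y)) x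
    (hφ.differentiable one_ne_zero (t, x)).hasFDerivAt
    ((hasDerivAt_const x t).prodMk (hasDerivAt_id x))

theorem continuous_dt (hφ : ContDiff ℝ 1 φ) : Continuous (dt φ) :=
  (hφ.continuous_fderiv one_ne_zero).clm_apply continuous_const

theorem continuous_dx (hφ : ContDiff ℝ 1 φ) : Continuous (dx φ) :=
  (hφ.continuous_fderiv one_ne_zero).clm_apply continuous_const

end TestFunction

theorem continuous_qSharp : Continuous qSharp := by
  rw [show qSharp = fun t => rayPos t 0 from funext qSharp_eq]
  exact continuous_rayPos_time 0

theorem strictMono_qSharp : StrictMono qSharp := by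
  rw [show qSharp = fun t => rayPos t 0 from funext qSharp_eq]
  refine strictMono_of_hasDerivAt_pos (fun t => hasDerivAt_rayPos t 0) fun t => ?_
  linarith [rayVel_pos_of_nonneg le_rfl t]

theorem continuousOn_sol {K : Set (ℝ × ℝ)} (hK : ∀ z ∈ K, 0 < z.1 ∧ 0 < z.2) :
    ContinuousOn (fun z : ℝ × ℝ => sol z.1 z.2) K := fun z hz =>
  (continuousAt_sol_pos (hK z hz).1 (hK z hz).2).continuousWithinAt

/-- The slope may jump across x = q♯(t), but each branch formula remains continuous up to that
curve, hence is integrable on its closed part of K. -/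
theorem integrableOn_solSlope {K : Set (ℝ × ℝ)} (hKc : IsCompact K)
    (hK : ∀ z ∈ K, 0 < z.1 ∧ 0 < z.2) :
    IntegrableOn (fun z : ℝ × ℝ => solSlope z.1 z.2) K := by
  have hcq : Continuous fun z : ℝ × ℝ => qSharp z.1 := continuous_qSharp.comp continuous_fst
  have hc : ∀ e, ∀ z ∈ K, (branchVar e z.1 (param z.1 z.2)).1 ≠ 0 →
      ContinuousAt (fun z : ℝ × ℝ => branchSlope e z.1 (param z.1 z.2)) z := fun e z hz h =>
    ContinuousAt.comp (x := z) (f := fun y : ℝ × ℝ => (y.1, param y.1 y.2))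
      (continuousAt_branchSlope e (hK z hz).1 h)
      (continuousAt_fst.prodMk (continuousAt_param (hK z hz).1 (hK z hz).2))
  have h1 : IntegrableOn (fun z : ℝ × ℝ => solSlope z.1 z.2) (K ∩ {z | z.2 ≤ qSharp z.1}) := by
    have hcl : IsClosed {z : ℝ × ℝ | z.2 ≤ qSharp z.1} := isClosed_le continuous_snd hcq
    have hint : IntegrableOn (fun z : ℝ × ℝ => branchSlope (0, 1) z.1 (param z.1 z.2))
        (K ∩ {z | z.2 ≤ qSharp z.1}) := by
      refine ContinuousOn.integrableOn_compact (hKc.inter_right hcl) fun z hz => ?_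
      obtain ⟨ht, hx⟩ := hK z hz.1
      exact (hc (0, 1) z hz.1 (branchVar_fan_pos ht (param_spec ht hx).1
        ((param_nonpos_iff ht hx).2 hz.2)).ne').continuousWithinAt
    refine hint.congr_fun (fun z hz => ?_) (hKc.inter_right hcl).measurableSet
    simp only [solSlope, if_pos (show z.2 ≤ qSharp z.1 from hz.2)]
  have h2 : IntegrableOn (fun z : ℝ × ℝ => solSlope z.1 z.2) (K ∩ {z | qSharp z.1 < z.2}) := by
    have hcl : IsClosed {z : ℝ × ℝ | qSharp z.1 ≤ z.2} := isClosed_le hcq continuous_snd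
    have hint : IntegrableOn (fun z : ℝ × ℝ => branchSlope (1, 0) z.1 (param z.1 z.2))
        (K ∩ {z | qSharp z.1 ≤ z.2}) := by
      refine ContinuousOn.integrableOn_compact (hKc.inter_right hcl) fun z hz => ?_
      obtain ⟨ht, hx⟩ := hK z hz.1
      exact (hc (1, 0) z hz.1 (branchVar_straight_pos ht
        ((param_nonneg_iff ht hx).2 hz.2)).ne').continuousWithinAt
    have hm : MeasurableSet (K ∩ {z : ℝ × ℝ | qSharp z.1 < z.2}) :=
      hKc.measurableSet.inter (isOpen_lt hcq continuous_snd).measurableSet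
    refine (hint.mono_set fun z hz => ⟨hz.1, (show qSharp z.1 < z.2 from hz.2).le⟩).congr_fun (fun z hz => ?_) hm
    simp only [solSlope, if_neg (not_le.2 (show qSharp z.1 < z.2 from hz.2))]
  refine (h1.union h2).mono_set fun z hz => ?_
  rcases le_or_gt z.2 (qSharp z.1) with h | h
  · exact Or.inl ⟨hz, h⟩
  · exact Or.inr ⟨hz, h⟩

/-- The density of the entropy balance, for an entropy `η` with flux `Q` and derivative `β`. -/
noncomputable def balance (β η Q : ℝ → ℝ) (φ : ℝ × ℝ → ℝ) (z : ℝ × ℝ) : ℝ :=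
  η (sol z.1 z.2) * dt φ z + Q (sol z.1 z.2) * dx φ z - β (sol z.1 z.2) * force z.2 * φ z

section Rectangle

variable {β η Q : ℝ → ℝ} {φ : ℝ × ℝ → ℝ} {a T b X : ℝ}

/-- The entropy balance on a rectangle, for a smooth entropy. -/
theorem integral_balance (hβ : Continuous β) (hη : ∀ w, HasDerivAt η (β w) w)
    (hQ : ∀ w, HasDerivAt Q (β w * w) w) (hφ : ContDiff ℝ 1 φ)
    (hT : ∀ x, φ (T, x) = 0) (hX : ∀ t, φ (t, X) = 0)
    (ha : 0 < a) (haT : a ≤ T) (hb : 0 < b) (hbX : b ≤ X) :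
    ∫ z in Ioc a T ×ˢ Ioc b X, balance β η Q φ z
      = -(∫ x in Ioc b X, η (sol a x) * φ (a, x)) - ∫ t in Ioc a T, Q (sol t b) * φ (t, b) := by
  have hηc : Continuous η := continuous_iff_continuousAt.2 fun w => (hη w).continuousAt
  have hQc : Continuous Q := continuous_iff_continuousAt.2 fun w => (hQ w).continuousAt
  have hφc : Continuous φ := hφ.continuous
  set K : Set (ℝ × ℝ) := Icc a T ×ˢ Icc b X with hKdef
  have hKc : IsCompact K := isCompact_Icc.prod isCompact_Icc
  have hK : ∀ z ∈ K, 0 < z.1 ∧ 0 < z.2 := fun z hz =>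
    ⟨ha.trans_le hz.1.1, hb.trans_le hz.2.1⟩
  have hsub : Ioc a T ×ˢ Ioc b X ⊆ K := prod_mono Ioc_subset_Icc_self Ioc_subset_Icc_self
  have hu := continuousOn_sol hK
  have hux := integrableOn_solSlope hKc hK
  have hf : Continuous fun z : ℝ × ℝ => force z.2 := continuous_force.comp continuous_snd
  -- Off the curve x = q♯(t), A is the time derivative of η(u)φ and B the space derivative of Q(u)φ.
  -- The terms with `solSlope` cancel in A + B.
  set A : ℝ × ℝ → ℝ := fun z => (β (sol z.1 z.2) * (-force z.2 - sol z.1 z.2 * solSlope z.1 z.2))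
    * φ z + η (sol z.1 z.2) * dt φ z with hA
  set B : ℝ × ℝ → ℝ := fun z => (β (sol z.1 z.2) * sol z.1 z.2 * solSlope z.1 z.2) * φ z
    + Q (sol z.1 z.2) * dx φ z with hB
  have hBint : IntegrableOn B K := by
    refine IntegrableOn.add ?_ ?_
    · have := hux.continuousOn_mul (((hβ.comp_continuousOn hu).mul hu).mul hφc.continuousOn) hKc
      refine this.congr_fun (fun z _ => ?_) hKc.measurableSet
      simp only [Function.comp, Pi.mul_apply]
      ring
    · exact ((hQc.comp_continuousOn hu).mul (continuous_dx hφ).continuousOn).integrableOn_compact hKc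
  have hAint : IntegrableOn A K := by
    refine IntegrableOn.add ?_ ?_
    · have h1 := hux.continuousOn_mul
        (((hβ.comp_continuousOn hu).mul hu).mul hφc.continuousOn).neg hKc
      have h2 : IntegrableOn (fun z => -(β (sol z.1 z.2) * force z.2 * φ z)) K :=
        (((hβ.comp_continuousOn hu).mul hf.continuousOn).mul
          hφc.continuousOn).neg.integrableOn_compact hKc
      refine (h1.add h2).congr_fun (fun z _ => ?_) hKc.measurableSet
      simp only [Function.comp, Pi.add_apply, Pi.mul_apply, Pi.neg_apply]
      ring
    · exact ((hηc.comp_continuousOn hu).mul (continuous_dt hφ).continuousOn).integrableOn_compact hKc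
  have hAint' := hAint.mono_set hsub
  have hBint' := hBint.mono_set hsub
  have hsum : ∀ z, balance β η Q φ z = A z + B z := fun z => by
    simp only [balance, hA, hB]; ring
  simp only [hsum]
  rw [integral_add hAint' hBint']
  have eA : ∫ z in Ioc a T ×ˢ Ioc b X, A z = -∫ x in Ioc b X, η (sol a x) * φ (a, x) := by
    rw [IntegrableOn, Measure.volume_eq_prod, ← Measure.prod_restrict] at hAint'
    rw [Measure.volume_eq_prod, ← Measure.prod_restrict, integral_prod_symm _ hAint',
      ← integral_neg]
    refine integral_congr_ae ?_
    filter_upwards [hAint'.prod_left_ae, ae_restrict_mem measurableSet_Ioc] with x hx1 hx2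
    have hx0 : 0 < x := hb.trans hx2.1
    -- A vertical or horizontal line meets the curve x = q♯(t) at most once, and u is continuous
    -- there, so no boundary term arises from it.
    have hftc := integral_eq_of_hasDerivAt_off_countable_of_le
      (fun t => η (sol t x) * φ (t, x)) (fun t => A (t, x)) haT (s := {t | qSharp t = x})
      (Subsingleton.countable fun s hs r hr => strictMono_qSharp.injective (hs.trans hr.symm)) ?_ ?_
      ((intervalIntegrable_iff_integrableOn_Ioc_of_le haT).2 hx1)
    · rw [intervalIntegral.integral_of_le haT] at hftc
      rw [hftc, hT]
      ring
    · intro t ht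
      have ht0 : 0 < t := ha.trans_le ht.1
      have h1 : ContinuousAt (fun t => sol t x) t :=
        ContinuousAt.comp (x := t) (f := fun t : ℝ => (t, x)) (continuousAt_sol_pos ht0 hx0)
          (Continuous.prodMk_left x).continuousAt
      have h2 : ContinuousAt (fun t => φ (t, x)) t :=
        (hφc.comp (Continuous.prodMk_left x)).continuousAt
      exact ((hηc.continuousAt.comp h1).mul h2).continuousWithinAt
    · intro t ht
      have ht0 : 0 < t := ha.trans ht.1.1
      obtain ⟨_, _, h3⟩ := sol_regular ht0 hx0 (fun h => ht.2 h.symm)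
      exact ((hη _).comp t h3).mul (hasDerivAt_dt hφ t x)
  have eB : ∫ z in Ioc a T ×ˢ Ioc b X, B z = -∫ t in Ioc a T, Q (sol t b) * φ (t, b) := by
    rw [IntegrableOn, Measure.volume_eq_prod, ← Measure.prod_restrict] at hBint'
    rw [Measure.volume_eq_prod, ← Measure.prod_restrict, integral_prod _ hBint',
      ← integral_neg]
    refine integral_congr_ae ?_
    filter_upwards [hBint'.prod_right_ae, ae_restrict_mem measurableSet_Ioc] with t ht1 ht2
    have ht0 : 0 < t := ha.trans ht2.1
    have hftc := integral_eq_of_hasDerivAt_off_countable_of_le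
      (fun x => Q (sol t x) * φ (t, x)) (fun x => B (t, x)) hbX (s := {qSharp t})
      (countable_singleton _) ?_ ?_
      ((intervalIntegrable_iff_integrableOn_Ioc_of_le hbX).2 ht1)
    · rw [intervalIntegral.integral_of_le hbX] at hftc
      rw [hftc, hX]
      ring
    · intro x hx
      have hx0 : 0 < x := hb.trans_le hx.1
      have h1 : ContinuousAt (fun x => sol t x) x :=
        ContinuousAt.comp (x := x) (f := fun x : ℝ => (t, x)) (continuousAt_sol_pos ht0 hx0)
          (Continuous.prodMk_right t).continuousAt
      have h2 : ContinuousAt (fun x => φ (t, x)) x :=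
        (hφc.comp (Continuous.prodMk_right t)).continuousAt
      exact ((hQc.continuousAt.comp h1).mul h2).continuousWithinAt
    · intro x hx
      have hx0 : 0 < x := hb.trans hx.1.1
      obtain ⟨_, h3, _⟩ := sol_regular ht0 hx0 hx.2
      exact ((hQ _).comp x h3).mul (hasDerivAt_dx hφ t x)
  rw [eA, eB]
  ring

end Rectangle

/-! ### Kruzhkov entropies -/

/-- The flux of the Kruzhkov entropy `|w - k|`. -/
noncomputable def kruzkovFlux (k w : ℝ) : ℝ := |w - k| * (w + k) / 2

theorem sign_mul_self_eq_abs (y : ℝ) : Real.sign y * y = |y| := by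
  rcases lt_trichotomy y 0 with h | rfl | h
  · rw [Real.sign_of_neg h, abs_of_neg h]; ring
  · simp
  · rw [Real.sign_of_pos h, abs_of_pos h]; ring

theorem abs_sign_le (y : ℝ) : |Real.sign y| ≤ 1 := by
  rcases Real.sign_apply_eq y with h | h | h <;> rw [h] <;> norm_num

theorem measurable_sign : Measurable Real.sign :=
  Measurable.ite measurableSet_Iio measurable_const
    (Measurable.ite measurableSet_Ioi measurable_const measurable_const)

theorem hasDerivAt_abs_sub {k y : ℝ} (h : y ≠ k) :
    HasDerivAt (fun y => |y - k|) (Real.sign (y - k)) y := by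
  rcases h.lt_or_gt with h | h
  · rw [Real.sign_of_neg (by linarith)]
    refine HasDerivAt.congr_of_eventuallyEq (((hasDerivAt_id y).sub_const k).neg) ?_
    filter_upwards [eventually_lt_nhds h] with z hz
    rw [abs_of_neg (by linarith)]
    rfl
  · rw [Real.sign_of_pos (by linarith)]
    refine HasDerivAt.congr_of_eventuallyEq ((hasDerivAt_id y).sub_const k) ?_
    filter_upwards [eventually_gt_nhds h] with z hz
    rw [abs_of_pos (by linarith)]
    rfl

theorem intervalIntegrable_of_bounded {f : ℝ → ℝ} (hf : Measurable f) {C : ℝ} {a b : ℝ}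
    (hC : ∀ x ∈ uIcc a b, |f x| ≤ C) : IntervalIntegrable f volume a b := by
  refine (intervalIntegrable_const (c := C) (μ := volume)).mono_fun hf.aestronglyMeasurable ?_
  filter_upwards [ae_restrict_mem measurableSet_uIoc] with x hx
  rw [Real.norm_eq_abs, Real.norm_eq_abs]
  exact (hC x (uIoc_subset_uIcc hx)).trans (le_abs_self C)

theorem measurable_sign_sub (k : ℝ) : Measurable fun y => Real.sign (y - k) :=
  measurable_sign.comp (measurable_id.sub_const k)

/-- Writing the entropy as an integral of its derivative reduces the convergence of `softAbs` to
dominated convergence of `softSign`. -/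
theorem integral_sign (k w : ℝ) : ∫ y in k..w, Real.sign (y - k) = |w - k| := by
  have := integral_eq_of_hasDerivAt_off_countable (fun y => |y - k|)
    (fun y => Real.sign (y - k)) (a := k) (b := w) (countable_singleton k)
    (by fun_prop) (fun y hy => hasDerivAt_abs_sub hy.2)
    (intervalIntegrable_of_bounded (measurable_sign_sub k) (C := 1) fun y _ => abs_sign_le _)
  rw [this]; simp

theorem integral_sign_mul (k w : ℝ) :
    ∫ y in k..w, Real.sign (y - k) * y = kruzkovFlux k w := by
  have hint : IntervalIntegrable (fun y => Real.sign (y - k) * y) volume k w :=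
    (intervalIntegrable_of_bounded (measurable_sign_sub k) (C := 1)
      fun y _ => abs_sign_le _).mul_continuousOn continuous_id.continuousOn
  have := integral_eq_of_hasDerivAt_off_countable (kruzkovFlux k)
    (fun y => Real.sign (y - k) * y) (a := k) (b := w) (countable_singleton k)
    (by unfold kruzkovFlux; fun_prop) (fun y hy => ?_) hint
  · rw [this]; simp [kruzkovFlux]
  · have h := ((hasDerivAt_abs_sub (k := k) hy.2).mul ((hasDerivAt_id y).add_const k)).div_const 2
    refine HasDerivAt.congr_deriv h ?_
    simp only [id]
    rw [← sign_mul_self_eq_abs (y - k)]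
    ring

/-- A continuous approximation of the sign of `y - k`. -/
noncomputable def softSign (k : ℝ) (n : ℕ) (y : ℝ) : ℝ := max (-1) (min 1 (n * (y - k)))

theorem continuous_softSign (k : ℝ) (n : ℕ) : Continuous (softSign k n) := by
  unfold softSign; fun_prop

theorem abs_softSign_le (k : ℝ) (n : ℕ) (y : ℝ) : |softSign k n y| ≤ 1 :=
  abs_le.2 ⟨le_max_left _ _, max_le (by norm_num) (min_le_left _ _)⟩

theorem tendsto_softSign (k y : ℝ) :
    Tendsto (fun n => softSign k n y) atTop (𝓝 (Real.sign (y - k))) := by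
  refine tendsto_const_nhds.congr' ?_
  have hlim := tendsto_natCast_atTop_atTop (R := ℝ)
  rcases lt_trichotomy y k with h | rfl | h
  · filter_upwards [hlim.eventually_ge_atTop (1 / (k - y))] with n hn
    rw [div_le_iff₀ (by linarith)] at hn
    rw [Real.sign_of_neg (by linarith), softSign, min_eq_right (by linarith),
      max_eq_left (by linarith)]
  · simp [softSign]
  · filter_upwards [hlim.eventually_ge_atTop (1 / (y - k))] with n hn
    rw [div_le_iff₀ (by linarith)] at hn
    rw [Real.sign_of_pos (by linarith), softSign, min_eq_left (by linarith),
      max_eq_right (by norm_num)]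

/-- The entropy with derivative `softSign`. -/
noncomputable def softAbs (k : ℝ) (n : ℕ) (w : ℝ) : ℝ := ∫ y in k..w, softSign k n y

/-- The flux of the entropy `softAbs`. -/
noncomputable def softFlux (k : ℝ) (n : ℕ) (w : ℝ) : ℝ := ∫ y in k..w, softSign k n y * y

theorem hasDerivAt_softAbs (k : ℝ) (n : ℕ) (w : ℝ) :
    HasDerivAt (softAbs k n) (softSign k n w) w :=
  ((continuous_softSign k n).integral_hasStrictDerivAt k w).hasDerivAt

theorem hasDerivAt_softFlux (k : ℝ) (n : ℕ) (w : ℝ) :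
    HasDerivAt (softFlux k n) (softSign k n w * w) w :=
  (((continuous_softSign k n).mul continuous_id).integral_hasStrictDerivAt k w).hasDerivAt

theorem tendsto_softAbs (k w : ℝ) : Tendsto (fun n => softAbs k n w) atTop (𝓝 |w - k|) := by
  rw [← integral_sign]
  refine intervalIntegral.tendsto_integral_filter_of_dominated_convergence (fun _ => 1)
    (Eventually.of_forall fun n => (continuous_softSign k n).aestronglyMeasurable)
    (Eventually.of_forall fun n => Eventually.of_forall fun y _ => abs_softSign_le k n y)
    intervalIntegrable_const (Eventually.of_forall fun y _ => tendsto_softSign k y)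

theorem tendsto_softFlux (k w : ℝ) :
    Tendsto (fun n => softFlux k n w) atTop (𝓝 (kruzkovFlux k w)) := by
  rw [← integral_sign_mul]
  refine intervalIntegral.tendsto_integral_filter_of_dominated_convergence (fun y => |y|)
    (Eventually.of_forall fun n =>
      ((continuous_softSign k n).mul continuous_id).aestronglyMeasurable)
    (Eventually.of_forall fun n => Eventually.of_forall fun y _ => ?_)
    (continuous_abs.intervalIntegrable _ _)
    (Eventually.of_forall fun y _ => (tendsto_softSign k y).mul_const y)
  rw [norm_mul, Real.norm_eq_abs, Real.norm_eq_abs]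
  exact mul_le_of_le_one_left (abs_nonneg _) (abs_softSign_le k n y)

theorem abs_softAbs_le (k : ℝ) (n : ℕ) (w : ℝ) : |softAbs k n w| ≤ |w - k| := by
  have := intervalIntegral.norm_integral_le_of_norm_le_const (a := k) (b := w) (C := 1)
    (f := softSign k n) fun y _ => abs_softSign_le k n y
  simpa [softAbs] using this

theorem abs_softFlux_le {k w M : ℝ} (n : ℕ) (hk : |k| ≤ M) (hw : |w| ≤ M) :
    |softFlux k n w| ≤ M * |w - k| := by
  have := intervalIntegral.norm_integral_le_of_norm_le_const (a := k) (b := w) (C := M)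
    (f := fun y => softSign k n y * y) fun y hy => by
      have hy' : |y| ≤ M := by
        rw [abs_le] at hk hw ⊢
        rcases uIoc_subset_uIcc hy with ⟨h1, h2⟩
        exact ⟨(le_min hk.1 hw.1).trans h1, h2.trans (max_le hk.2 hw.2)⟩
      rw [norm_mul, Real.norm_eq_abs, Real.norm_eq_abs]
      exact (mul_le_of_le_one_left (abs_nonneg _) (abs_softSign_le k n y)).trans hy'
  simpa [softFlux] using this

theorem continuous_kruzkovFlux (k : ℝ) : Continuous (kruzkovFlux k) := by
  unfold kruzkovFlux; fun_prop

theorem abs_kruzkovFlux_le {k w M : ℝ} (hk : |k| ≤ M) (hw : |w| ≤ M) :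
    |kruzkovFlux k w| ≤ M * |w - k| :=
  le_of_tendsto (tendsto_softFlux k w).abs
    (Eventually.of_forall fun n => abs_softFlux_le n hk hw)

/-- Bounded convergence with varying domains, by extending the integrands by zero. It serves both
the smoothing of the entropy, with fixed domains, and the exhaustion of the quadrant. -/
theorem tendsto_setIntegral_of_bounded {α : Type*} [MeasurableSpace α] {μ : Measure α}
    {S : Set α} {s : ℕ → Set α} {f : ℕ → α → ℝ} {g : α → ℝ} {C : ℝ} (hS : MeasurableSet S)
    (hμ : μ S ≠ ⊤) (hs : ∀ n, MeasurableSet (s n)) (hsS : ∀ n, s n ⊆ S)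
    (hf : ∀ n, AEStronglyMeasurable (f n) (μ.restrict (s n)))
    (hC : ∀ n, ∀ x ∈ s n, |f n x| ≤ C)
    (hlim : ∀ x ∈ S, (∀ᶠ n in atTop, x ∈ s n) ∧ Tendsto (fun n => f n x) atTop (𝓝 (g x))) :
    Tendsto (fun n => ∫ x in s n, f n x ∂μ) atTop (𝓝 (∫ x in S, g x ∂μ)) := by
  have heq : ∀ n, ∫ x in s n, f n x ∂μ = ∫ x in S, (s n).indicator (f n) x ∂μ := fun n => by
    rw [setIntegral_indicator (hs n), inter_eq_self_of_subset_right (hsS n)]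
  simp only [heq]
  refine tendsto_integral_of_dominated_convergence (fun _ => |C|) (fun n => ?_) ?_ (fun n => ?_) ?_
  · rw [aestronglyMeasurable_indicator_iff (hs n), Measure.restrict_restrict (hs n),
      inter_eq_self_of_subset_left (hsS n)]
    exact hf n
  · exact integrableOn_const hμ
  · refine Eventually.of_forall fun x => ?_
    by_cases hx : x ∈ s n
    · rw [indicator_of_mem hx]
      exact (hC n x hx).trans (le_abs_self C)
    · rw [indicator_of_notMem hx, norm_zero]
      exact abs_nonneg C
  · filter_upwards [ae_restrict_mem hS] with x hx
    obtain ⟨h1, h2⟩ := hlim x hx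
    refine h2.congr' ?_
    filter_upwards [h1] with n hn
    rw [indicator_of_mem hn]

/-! ### The Kruzhkov balance on the quadrant -/

section Balance

variable {β η Q : ℝ → ℝ} {φ : ℝ × ℝ → ℝ} {a T b X C k M : ℝ}

theorem aemeasurable_sol :
    AEMeasurable (fun z : ℝ × ℝ => sol z.1 z.2)
      (volume.restrict (Ioi (0 : ℝ) ×ˢ (univ : Set ℝ))) := by
  have hsplit : Ioi (0 : ℝ) ×ˢ (univ : Set ℝ)
      = (Ioi 0 ×ˢ Ioi 0 ∪ Ioi 0 ×ˢ Iio 0) ∪ Ioi 0 ×ˢ {0} := by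
    ext z
    simp only [mem_prod, mem_Ioi, mem_univ, and_true, mem_union, mem_Iio, mem_singleton_iff]
    have := lt_trichotomy z.2 0
    tauto
  rw [hsplit, aemeasurable_union_iff, aemeasurable_union_iff]
  refine ⟨⟨?_, ?_⟩, ?_⟩
  · exact ContinuousOn.aemeasurable (fun z hz =>
      (continuousAt_sol hz.1 (ne_of_gt hz.2)).continuousWithinAt)
      (measurableSet_Ioi.prod measurableSet_Ioi)
  · exact ContinuousOn.aemeasurable (fun z hz =>
      (continuousAt_sol hz.1 (ne_of_lt hz.2)).continuousWithinAt)
      (measurableSet_Ioi.prod measurableSet_Iio)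
  · refine ContinuousOn.aemeasurable ?_ (measurableSet_Ioi.prod (measurableSet_singleton 0))
    refine (continuousOn_const (c := (0 : ℝ))).congr fun z hz => ?_
    have : z.2 = 0 := hz.2
    simp [sol, this]

theorem aemeasurable_comp_sol {S : Set (ℝ × ℝ)} (hS : ∀ z ∈ S, 0 < z.1) (hβ : Measurable β) :
    AEMeasurable (fun z : ℝ × ℝ => β (sol z.1 z.2)) (volume.restrict S) :=
  hβ.comp_aemeasurable
    (aemeasurable_sol.mono_measure (Measure.restrict_mono
      (show S ⊆ Ioi 0 ×ˢ univ from fun z hz => ⟨hS z hz, mem_univ _⟩) le_rfl))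

theorem measurable_kruzkovFlux (k : ℝ) : Measurable (kruzkovFlux k) :=
  (continuous_kruzkovFlux k).measurable

theorem aestronglyMeasurable_balance (hβ : Measurable β) (hη : Measurable η) (hQ : Measurable Q)
    (hφ : ContDiff ℝ 1 φ) {S : Set (ℝ × ℝ)} (hS : ∀ z ∈ S, 0 < z.1) :
    AEStronglyMeasurable (balance β η Q φ) (volume.restrict S) := by
  have h1 := (aemeasurable_comp_sol hS hη).mul (continuous_dt hφ).measurable.aemeasurable
  have h2 := (aemeasurable_comp_sol hS hQ).mul (continuous_dx hφ).measurable.aemeasurable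
  have h3 := ((aemeasurable_comp_sol hS hβ).mul
    (continuous_force.measurable.comp measurable_snd).aemeasurable).mul
    hφ.continuous.measurable.aemeasurable
  exact ((h1.add h2).sub h3).aestronglyMeasurable

theorem abs_balance_le {z : ℝ × ℝ} (hM : 0 ≤ M) (h1 : |η (sol z.1 z.2)| ≤ M)
    (h2 : |Q (sol z.1 z.2)| ≤ M * M) (h3 : |β (sol z.1 z.2)| ≤ 1)
    (hC : |φ z| ≤ C ∧ |dt φ z| ≤ C ∧ |dx φ z| ≤ C) :
    |balance β η Q φ z| ≤ (M + M * M + 8) * C := by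
  have hC0 : 0 ≤ C := (abs_nonneg _).trans hC.1
  have e1 : |η (sol z.1 z.2) * dt φ z| ≤ M * C := by
    rw [abs_mul]; exact mul_le_mul h1 hC.2.1 (abs_nonneg _) hM
  have e2 : |Q (sol z.1 z.2) * dx φ z| ≤ M * M * C := by
    rw [abs_mul]; exact mul_le_mul h2 hC.2.2 (abs_nonneg _) (by positivity)
  have e3 : |β (sol z.1 z.2) * force z.2 * φ z| ≤ 8 * C := by
    rw [abs_mul, abs_mul]
    refine mul_le_mul ?_ hC.1 (abs_nonneg _) (by norm_num)
    exact (mul_le_mul h3 (abs_force_le z.2) (abs_nonneg _) zero_le_one).trans (by norm_num)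
  unfold balance
  calc _ ≤ |η (sol z.1 z.2) * dt φ z + Q (sol z.1 z.2) * dx φ z|
        + |β (sol z.1 z.2) * force z.2 * φ z| := abs_sub _ _
    _ ≤ |η (sol z.1 z.2) * dt φ z| + |Q (sol z.1 z.2) * dx φ z|
        + |β (sol z.1 z.2) * force z.2 * φ z| := by gcongr; exact abs_add_le _ _
    _ ≤ _ := by linarith

/-- The density of the Kruzhkov balance. -/
noncomputable def kruzkovBalance (k : ℝ) (φ : ℝ × ℝ → ℝ) : ℝ × ℝ → ℝ :=
  balance (fun w => Real.sign (w - k)) (fun w => |w - k|) (kruzkovFlux k) φ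

theorem abs_sol_sub_le {t : ℝ} (ht : 0 < t) (x : ℝ) (k : ℝ) : |sol t x - k| ≤ 3 + |k| :=
  (abs_sub _ _).trans (by linarith [abs_sol_le ht x])

theorem abs_flux_sol_le {t : ℝ} (ht : 0 < t) (x : ℝ) (k : ℝ) :
    |kruzkovFlux k (sol t x)| ≤ (3 + |k|) * (3 + |k|) := by
  refine (abs_kruzkovFlux_le (M := 3 + |k|) (by linarith)
    (by linarith [abs_sol_le ht x, abs_nonneg k])).trans ?_
  exact mul_le_mul_of_nonneg_left (abs_sol_sub_le ht x k) (by positivity)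

theorem abs_kruzkovBalance_le {z : ℝ × ℝ} (hz : 0 < z.1)
    (hC : |φ z| ≤ C ∧ |dt φ z| ≤ C ∧ |dx φ z| ≤ C) :
    |kruzkovBalance k φ z| ≤ ((3 + |k|) + (3 + |k|) * (3 + |k|) + 8) * C :=
  abs_balance_le (by positivity) (by rw [abs_abs]; exact abs_sol_sub_le hz _ k)
    (abs_flux_sol_le hz _ k) (abs_sign_le _) hC

theorem measure_rectangle_ne_top (a b c d : ℝ) :
    (volume : Measure (ℝ × ℝ)) (Ioc a b ×ˢ Ioc c d) ≠ ⊤ := by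
  rw [Measure.volume_eq_prod, Measure.prod_prod]
  exact ENNReal.mul_ne_top measure_Ioc_lt_top.ne measure_Ioc_lt_top.ne

/-- The Kruzhkov balance on a rectangle. -/
theorem integral_kruzkovBalance (hφ : ContDiff ℝ 1 φ)
    (hC : ∀ z, |φ z| ≤ C ∧ |dt φ z| ≤ C ∧ |dx φ z| ≤ C)
    (hT : ∀ x, φ (T, x) = 0) (hX : ∀ t, φ (t, X) = 0)
    (ha : 0 < a) (haT : a ≤ T) (hb : 0 < b) (hbX : b ≤ X) (k : ℝ) :
    ∫ z in Ioc a T ×ˢ Ioc b X, kruzkovBalance k φ z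
      = -(∫ x in Ioc b X, |sol a x - k| * φ (a, x))
        - ∫ t in Ioc a T, kruzkovFlux k (sol t b) * φ (t, b) := by
  set M := 3 + |k| with hMdef
  have hM : 0 ≤ M := by positivity
  have hkM : |k| ≤ M := by linarith
  have hMs : ∀ t x, 0 < t → |sol t x| ≤ M := fun t x ht => by
    linarith [abs_sol_le ht x, abs_nonneg k]
  have hsa : ∀ n, Measurable (softAbs k n) := fun n =>
    (continuous_iff_continuousAt.2 fun w => (hasDerivAt_softAbs k n w).continuousAt).measurable
  have hsf : ∀ n, Measurable (softFlux k n) := fun n =>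
    (continuous_iff_continuousAt.2 fun w => (hasDerivAt_softFlux k n w).continuousAt).measurable
  have hb1 : ∀ n t x, 0 < t → |softAbs k n (sol t x)| ≤ M := fun n t x ht =>
    (abs_softAbs_le k n _).trans (abs_sol_sub_le ht x k)
  have hb2 : ∀ n t x, 0 < t → |softFlux k n (sol t x)| ≤ M * M := fun n t x ht =>
    (abs_softFlux_le n hkM (hMs t x ht)).trans
      (mul_le_mul_of_nonneg_left (abs_sol_sub_le ht x k) hM)
  have hslice1 : AEMeasurable (fun x => sol a x) (volume.restrict (Ioc b X)) :=
    ContinuousOn.aemeasurable (fun x hx => ContinuousAt.continuousWithinAt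
      (ContinuousAt.comp (x := x) (f := fun x : ℝ => (a, x))
        (continuousAt_sol_pos ha (hb.trans hx.1))
        (Continuous.prodMk_right a).continuousAt)) measurableSet_Ioc
  have hslice2 : AEMeasurable (fun t => sol t b) (volume.restrict (Ioc a T)) :=
    ContinuousOn.aemeasurable (fun t ht => ContinuousAt.continuousWithinAt
      (ContinuousAt.comp (x := t) (f := fun t : ℝ => (t, b))
        (continuousAt_sol_pos (ha.trans ht.1) hb)
        (Continuous.prodMk_left b).continuousAt)) measurableSet_Ioc
  have hL := tendsto_setIntegral_of_bounded (μ := volume) (S := Ioc a T ×ˢ Ioc b X)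
    (s := fun _ => Ioc a T ×ˢ Ioc b X)
    (f := fun n => balance (softSign k n) (softAbs k n) (softFlux k n) φ)
    (g := kruzkovBalance k φ) (C := (M + M * M + 8) * C)
    (measurableSet_Ioc.prod measurableSet_Ioc) (measure_rectangle_ne_top _ _ _ _)
    (fun _ => measurableSet_Ioc.prod measurableSet_Ioc) (fun _ => Subset.rfl)
    (fun n => aestronglyMeasurable_balance (continuous_softSign k n).measurable (hsa n) (hsf n) hφ
      fun z hz => ha.trans hz.1.1)
    (fun n z hz => abs_balance_le hM (hb1 n _ _ (ha.trans hz.1.1)) (hb2 n _ _ (ha.trans hz.1.1))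
      (abs_softSign_le k n _) (hC z))
    (fun z _ => ⟨Eventually.of_forall fun _ => by assumption,
      (((tendsto_softAbs k _).mul_const _).add ((tendsto_softFlux k _).mul_const _)).sub
        (((tendsto_softSign k _).mul_const _).mul_const _)⟩)
  have hR1 := tendsto_setIntegral_of_bounded (μ := volume) (S := Ioc b X) (s := fun _ => Ioc b X)
    (f := fun n x => softAbs k n (sol a x) * φ (a, x)) (g := fun x => |sol a x - k| * φ (a, x))
    (C := M * C) measurableSet_Ioc measure_Ioc_lt_top.ne (fun _ => measurableSet_Ioc)
    (fun _ => Subset.rfl)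
    (fun n => (((hsa n).comp_aemeasurable hslice1).mul
      (hφ.continuous.comp (Continuous.prodMk_right a)).measurable.aemeasurable).aestronglyMeasurable)
    (fun n x _ => by
      rw [abs_mul]; exact mul_le_mul (hb1 n _ _ ha) (hC _).1 (abs_nonneg _) hM)
    (fun x hx => ⟨Eventually.of_forall fun _ => hx, (tendsto_softAbs k _).mul_const _⟩)
  have hR2 := tendsto_setIntegral_of_bounded (μ := volume) (S := Ioc a T) (s := fun _ => Ioc a T)
    (f := fun n t => softFlux k n (sol t b) * φ (t, b))
    (g := fun t => kruzkovFlux k (sol t b) * φ (t, b))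
    (C := M * M * C) measurableSet_Ioc measure_Ioc_lt_top.ne (fun _ => measurableSet_Ioc)
    (fun _ => Subset.rfl)
    (fun n => (((hsf n).comp_aemeasurable hslice2).mul
      (hφ.continuous.comp (Continuous.prodMk_left b)).measurable.aemeasurable).aestronglyMeasurable)
    (fun n t ht => by
      rw [abs_mul]
      exact mul_le_mul (hb2 n _ _ (ha.trans ht.1)) (hC _).1 (abs_nonneg _) (by positivity))
    (fun t ht => ⟨Eventually.of_forall fun _ => ht, (tendsto_softFlux k _).mul_const _⟩)
  refine tendsto_nhds_unique hL ((hR1.neg.sub hR2).congr fun n => ?_)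
  exact (integral_balance (continuous_softSign k n) (hasDerivAt_softAbs k n)
    (hasDerivAt_softFlux k n) hφ hT hX ha haT hb hbX).symm

theorem tendsto_sol_trace {t : ℝ} (ht : 0 < t) {f : ℕ → ℝ} (hf : Tendsto f atTop (𝓝[>] 0)) :
    Tendsto (fun n => sol t (f n)) atTop (𝓝 (trace t)) := by
  refine (tendsto_sol_right ht).comp (f := fun n => (t, f n)) ?_
  refine tendsto_nhdsWithin_iff.2 ⟨tendsto_const_nhds.prodMk_nhds
    (hf.mono_right nhdsWithin_le_nhds), hf.eventually self_mem_nhdsWithin⟩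

theorem tendsto_one_div_nhdsGT :
    Tendsto (fun n : ℕ => 1 / ((n : ℝ) + 1)) atTop (𝓝[>] 0) :=
  tendsto_nhdsWithin_iff.2 ⟨tendsto_one_div_add_atTop_nhds_zero_nat,
    Eventually.of_forall fun n => (by positivity : (0 : ℝ) < 1 / ((n : ℝ) + 1))⟩

theorem abs_trace_le {t : ℝ} (ht : 0 < t) : |trace t| ≤ 3 :=
  le_of_tendsto (tendsto_sol_trace ht tendsto_one_div_nhdsGT).abs
    (Eventually.of_forall fun _ => abs_sol_le ht _)

/-- The trace is a pointwise limit of functions continuous in time, so no regularity of `threshold`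
is needed. -/
theorem aemeasurable_trace (T : ℝ) : AEMeasurable trace (volume.restrict (Ioc 0 T)) := by
  refine aemeasurable_of_tendsto_metrizable_ae atTop
    (f := fun (n : ℕ) t => sol t (1 / ((n : ℝ) + 1))) (fun n => ?_) ?_
  · exact ContinuousOn.aemeasurable (fun t ht => ContinuousAt.continuousWithinAt
      (ContinuousAt.comp (x := t) (f := fun t : ℝ => (t, 1 / ((n : ℝ) + 1)))
        (continuousAt_sol_pos ht.1 (by positivity : (0 : ℝ) < 1 / ((n : ℝ) + 1)))
        (Continuous.prodMk_left _).continuousAt)) measurableSet_Ioc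
  · filter_upwards [ae_restrict_mem measurableSet_Ioc] with t ht
    exact tendsto_sol_trace ht.1 tendsto_one_div_nhdsGT

/-- The Kruzhkov balance on the quadrant `t > 0`, `x > 0`. -/
theorem integral_kruzkovBalance_quadrant (hφ : ContDiff ℝ 1 φ)
    (hC : ∀ z, |φ z| ≤ C ∧ |dt φ z| ≤ C ∧ |dx φ z| ≤ C)
    (hT : ∀ x, φ (T, x) = 0) (hX : ∀ t, φ (t, X) = 0) (hT0 : 0 < T) (hX0 : 0 < X) (k : ℝ) :
    ∫ z in Ioc 0 T ×ˢ Ioc 0 X, kruzkovBalance k φ z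
      = -(∫ x in Ioc 0 X, |2 - k| * φ (0, x))
        - ∫ t in Ioc 0 T, kruzkovFlux k (trace t) * φ (t, 0) := by
  set ε : ℕ → ℝ := fun n => 1 / ((n : ℝ) + 1) with hε
  have hε0 : ∀ n, 0 < ε n := fun n => by positivity
  have hεlim : Tendsto ε atTop (𝓝[>] 0) := tendsto_one_div_nhdsGT
  have hεlim0 : Tendsto ε atTop (𝓝 0) := hεlim.mono_right nhdsWithin_le_nhds
  have hlt : ∀ c : ℝ, 0 < c → ∀ᶠ n in atTop, ε n < c := fun c hc => hεlim0.eventually_lt_const hc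
  have hL := tendsto_setIntegral_of_bounded (μ := volume) (S := Ioc 0 T ×ˢ Ioc 0 X)
    (s := fun n => Ioc (ε n) T ×ˢ Ioc (ε n) X)
    (f := fun _ => kruzkovBalance k φ) (g := kruzkovBalance k φ)
    (C := ((3 + |k|) + (3 + |k|) * (3 + |k|) + 8) * C)
    (measurableSet_Ioc.prod measurableSet_Ioc) (measure_rectangle_ne_top _ _ _ _)
    (fun _ => measurableSet_Ioc.prod measurableSet_Ioc)
    (fun n => prod_mono (Ioc_subset_Ioc_left (hε0 n).le) (Ioc_subset_Ioc_left (hε0 n).le))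
    (fun n => aestronglyMeasurable_balance (measurable_sign_sub k)
      ((measurable_id.sub_const k).abs) (measurable_kruzkovFlux k) hφ
      fun z hz => (hε0 n).trans hz.1.1)
    (fun n z hz => abs_kruzkovBalance_le ((hε0 n).trans hz.1.1) (hC z))
    (fun z hz => ⟨((hlt _ hz.1.1).and (hlt _ hz.2.1)).mono
      fun n hn => ⟨⟨hn.1, hz.1.2⟩, ⟨hn.2, hz.2.2⟩⟩, tendsto_const_nhds⟩)
  have hR1 := tendsto_setIntegral_of_bounded (μ := volume) (S := Ioc 0 X)
    (s := fun n => Ioc (ε n) X)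
    (f := fun n x => |sol (ε n) x - k| * φ (ε n, x)) (g := fun x => |2 - k| * φ (0, x))
    (C := (3 + |k|) * C) measurableSet_Ioc measure_Ioc_lt_top.ne (fun _ => measurableSet_Ioc)
    (fun n => Ioc_subset_Ioc_left (hε0 n).le)
    (fun n => ContinuousOn.aestronglyMeasurable (fun x hx => ContinuousAt.continuousWithinAt
      (((ContinuousAt.comp (x := x) (f := fun x : ℝ => (ε n, x))
        (continuousAt_sol_pos (hε0 n) ((hε0 n).trans hx.1))
        (Continuous.prodMk_right _).continuousAt).sub_const k).abs.mul
        (hφ.continuous.comp (Continuous.prodMk_right _)).continuousAt)) measurableSet_Ioc)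
    (fun n x _ => by
      rw [abs_mul, abs_abs]
      exact mul_le_mul (abs_sol_sub_le (hε0 n) x k) (hC _).1 (abs_nonneg _) (by positivity))
    (fun x hx => ⟨(hlt _ hx.1).mono fun n hn => ⟨hn, hx.2⟩,
      ((tendsto_sol_zero_pos hx.1 hεlim).sub_const k).abs.mul
        ((hφ.continuous.comp (Continuous.prodMk_left x)).continuousAt.tendsto.comp hεlim0)⟩)
  have hR2 := tendsto_setIntegral_of_bounded (μ := volume) (S := Ioc 0 T)
    (s := fun n => Ioc (ε n) T)
    (f := fun n t => kruzkovFlux k (sol t (ε n)) * φ (t, ε n))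
    (g := fun t => kruzkovFlux k (trace t) * φ (t, 0))
    (C := (3 + |k|) * (3 + |k|) * C) measurableSet_Ioc measure_Ioc_lt_top.ne
    (fun _ => measurableSet_Ioc) (fun n => Ioc_subset_Ioc_left (hε0 n).le)
    (fun n => ContinuousOn.aestronglyMeasurable (fun t ht => ContinuousAt.continuousWithinAt
      (((continuous_kruzkovFlux k).continuousAt.comp
        (ContinuousAt.comp (x := t) (f := fun t : ℝ => (t, ε n))
        (continuousAt_sol_pos ((hε0 n).trans ht.1) (hε0 n))
        (Continuous.prodMk_left _).continuousAt)).mul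
        (hφ.continuous.comp (Continuous.prodMk_left _)).continuousAt)) measurableSet_Ioc)
    (fun n t ht => by
      rw [abs_mul]
      exact mul_le_mul (abs_flux_sol_le ((hε0 n).trans ht.1) _ k) (hC _).1 (abs_nonneg _)
        (by positivity))
    (fun t ht => ⟨(hlt _ ht.1).mono fun n hn => ⟨hn, ht.2⟩,
      ((continuous_kruzkovFlux k).continuousAt.tendsto.comp (tendsto_sol_trace ht.1 hεlim)).mul
        ((hφ.continuous.comp (Continuous.prodMk_right t)).continuousAt.tendsto.comp hεlim0)⟩)
  refine tendsto_nhds_unique hL ((hR1.neg.sub hR2).congr' ?_)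
  filter_upwards [hlt T hT0, hlt X hX0] with n h1 h2
  exact (integral_kruzkovBalance hφ hC hT hX (hε0 n) h1.le (hε0 n) h2.le k).symm

/-- The sum is k² - w² when |k| ≤ |w| and 0 otherwise. It is the net entropy flux at a jump from -w
on the left to w on the right, and this is where the sign of the trace makes the jump entropic. -/
theorem kruzkovFlux_add_nonpos (k : ℝ) {w : ℝ} (hw : w ≤ 0) :
    kruzkovFlux k w + kruzkovFlux (-k) w ≤ 0 := by
  unfold kruzkovFlux
  rw [sub_neg_eq_add]
  rcases abs_cases (w - k) with ⟨h1, h2⟩ | ⟨h1, h2⟩ <;>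
    rcases abs_cases (w + k) with ⟨h3, h4⟩ | ⟨h3, h4⟩ <;> rw [h1, h3] <;> nlinarith

/-! ### Reflection -/

/-- The reflection of a test function. -/
def reflect (φ : ℝ × ℝ → ℝ) (z : ℝ × ℝ) : ℝ := φ (z.1, -z.2)

theorem contDiff_reflect (hφ : ContDiff ℝ 1 φ) : ContDiff ℝ 1 (reflect φ) :=
  hφ.comp (contDiff_fst.prodMk contDiff_snd.neg)

theorem dt_reflect (hφ : ContDiff ℝ 1 φ) (z : ℝ × ℝ) : dt (reflect φ) z = dt φ (z.1, -z.2) :=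
  (hasDerivAt_dt (contDiff_reflect hφ) z.1 z.2).unique (hasDerivAt_dt hφ z.1 (-z.2))

theorem dx_reflect (hφ : ContDiff ℝ 1 φ) (z : ℝ × ℝ) : dx (reflect φ) z = -dx φ (z.1, -z.2) := by
  refine (hasDerivAt_dx (contDiff_reflect hφ) z.1 z.2).unique ?_
  have := HasDerivAt.comp z.2 (h := fun y : ℝ => -y) (hasDerivAt_dx hφ z.1 (-z.2))
    (hasDerivAt_neg z.2)
  refine HasDerivAt.congr_deriv this ?_
  ring

/-- Since u and the force are odd in x, reflection turns the balance at level k on the left into the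
one at level -k on the right. -/
theorem kruzkovBalance_reflect (hφ : ContDiff ℝ 1 φ) (k t x : ℝ) :
    kruzkovBalance k φ (t, -x) = kruzkovBalance (-k) (reflect φ) (t, x) := by
  simp only [kruzkovBalance, balance, dt_reflect hφ, dx_reflect hφ, sol_neg, force_neg]
  have h1 : -sol t x - k = -(sol t x - -k) := by ring
  have h2 : kruzkovFlux k (-sol t x) = -kruzkovFlux (-k) (sol t x) := by
    unfold kruzkovFlux
    rw [h1, abs_neg]; ring
  rw [h2, h1, Real.sign_neg, abs_neg]
  simp only [reflect]
  ring

end Balance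

/-! ### The entropy inequality -/

section Entropy

variable {φ : ℝ × ℝ → ℝ} {C R k : ℝ}

theorem exists_radius_bound (hφ : ContDiff ℝ 1 φ) (hs : HasCompactSupport φ) :
    ∃ R C : ℝ, 0 < R ∧ (∀ z : ℝ × ℝ, R ≤ ‖z‖ → φ z = 0 ∧ dt φ z = 0 ∧ dx φ z = 0) ∧
      ∀ z, |φ z| ≤ C ∧ |dt φ z| ≤ C ∧ |dx φ z| ≤ C := by
  have hs1 : HasCompactSupport (dt φ) := (hs.fderiv ℝ).comp_left (g := fun L : ℝ × ℝ →L[ℝ] ℝ => L (1, 0)) rfl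
  have hs2 : HasCompactSupport (dx φ) := (hs.fderiv ℝ).comp_left (g := fun L : ℝ × ℝ →L[ℝ] ℝ => L (0, 1)) rfl
  obtain ⟨R0, hR0, h0⟩ := hs.exists_pos_le_norm
  obtain ⟨R1, -, h1⟩ := hs1.exists_pos_le_norm
  obtain ⟨R2, -, h2⟩ := hs2.exists_pos_le_norm
  obtain ⟨C0, k0⟩ := hs.exists_bound_of_continuous hφ.continuous
  obtain ⟨C1, k1⟩ := hs1.exists_bound_of_continuous (continuous_dt hφ)
  obtain ⟨C2, k2⟩ := hs2.exists_bound_of_continuous (continuous_dx hφ)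
  refine ⟨max R0 (max R1 R2), max C0 (max C1 C2), lt_max_of_lt_left hR0, fun z hz => ?_,
    fun z => ?_⟩
  · simp only [max_le_iff] at hz
    exact ⟨h0 z hz.1, h1 z hz.2.1, h2 z hz.2.2⟩
  · simp only [le_max_iff]
    exact ⟨Or.inl (k0 z), Or.inr (Or.inl (k1 z)), Or.inr (Or.inr (k2 z))⟩

theorem integrableOn_rectangle_of_bounded {F : ℝ × ℝ → ℝ} {a b c d : ℝ}
    (hm : AEStronglyMeasurable F (volume.restrict (Ioc a b ×ˢ Ioc c d)))
    (hb : ∀ z ∈ Ioc a b ×ˢ Ioc c d, |F z| ≤ C) :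
    IntegrableOn F (Ioc a b ×ˢ Ioc c d) :=
  ⟨hm, HasFiniteIntegral.restrict_of_bounded C (measure_rectangle_ne_top _ _ _ _).lt_top
    (ae_restrict_of_forall_mem (measurableSet_Ioc.prod measurableSet_Ioc) hb)⟩

theorem integral_halfPlane_eq {F : ℝ × ℝ → ℝ}
    (hF : IntegrableOn F (Ioc 0 R ×ˢ Ioc (-R) R)) (h0 : ∀ z : ℝ × ℝ, R ≤ ‖z‖ → F z = 0) :
    ∫ t in Ioi (0 : ℝ), ∫ x : ℝ, F (t, x) = ∫ z in Ioc 0 R ×ˢ Ioc (-R) R, F z := by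
  have hin : ∀ t, ∫ x : ℝ, F (t, x) = ∫ x in Ioc (-R) R, F (t, x) := fun t => by
    refine (setIntegral_eq_integral_of_forall_compl_eq_zero fun x hx => h0 _ ?_).symm
    exact le_trans (le_of_not_gt fun h : |x| < R => hx ⟨(abs_lt.1 h).1, (abs_lt.1 h).2.le⟩)
      (norm_snd_le (t, x))
  have hout : ∀ t ∈ Ioi (0 : ℝ) \ Ioc 0 R, ∫ x in Ioc (-R) R, F (t, x) = 0 := fun t ht => by
    have hR : R ≤ |t| := by
      by_contra h
      exact ht.2 ⟨ht.1, ((le_abs_self t).trans_lt (not_le.1 h)).le⟩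
    have : ∀ x, F (t, x) = 0 := fun x => h0 _ (hR.trans (norm_fst_le (t, x)))
    simp [this]
  simp_rw [hin]
  rw [setIntegral_eq_of_subset_of_forall_sdiff_eq_zero measurableSet_Ioi
    (fun t ht => ht.1) hout, Measure.volume_eq_prod]
  exact (setIntegral_prod F hF).symm

/-- The potential cancels in the difference, which is why the entropy flux does not depend on x. -/
theorem sign_mul_ham_sub (x w k : ℝ) :
    Real.sign (w - k) * (ham x w - ham x k) = kruzkovFlux k w := by
  unfold ham kruzkovFlux
  rw [← sign_mul_self_eq_abs (w - k)]
  ring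

theorem integrableOn_kruzkovBalance (hφ : ContDiff ℝ 1 φ)
    (hC : ∀ z, |φ z| ≤ C ∧ |dt φ z| ≤ C ∧ |dx φ z| ≤ C) (k T a b : ℝ) :
    IntegrableOn (kruzkovBalance k φ) (Ioc 0 T ×ˢ Ioc a b) :=
  integrableOn_rectangle_of_bounded
    (aestronglyMeasurable_balance (measurable_sign_sub k) ((measurable_id.sub_const k).abs)
      (measurable_kruzkovFlux k) hφ fun _ hz => hz.1.1)
    fun _ hz => abs_kruzkovBalance_le hz.1.1 (hC _)

/-- The three volume terms of the entropy inequality add up to the integral of the balance. -/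
theorem entropy_volume_terms (hφ : ContDiff ℝ 1 φ)
    (h0 : ∀ z : ℝ × ℝ, R ≤ ‖z‖ → φ z = 0 ∧ dt φ z = 0 ∧ dx φ z = 0)
    (hC : ∀ z, |φ z| ≤ C ∧ |dt φ z| ≤ C ∧ |dx φ z| ≤ C) (k : ℝ) :
    (∫ t in Ioi (0 : ℝ), ∫ x : ℝ, |sol t x - k| * deriv (fun s => φ (s, x)) t)
      + (∫ t in Ioi (0 : ℝ), ∫ x : ℝ,
          Real.sign (sol t x - k) * (ham x (sol t x) - ham x k) * deriv (fun y => φ (t, y)) x)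
      - (∫ t in Ioi (0 : ℝ), ∫ x : ℝ,
          Real.sign (sol t x - k) * deriv (fun y => ham y k) x * φ (t, x))
      = ∫ z in Ioc 0 R ×ˢ Ioc (-R) R, kruzkovBalance k φ z := by
  simp_rw [sign_mul_ham_sub, deriv_ham_fst, (hasDerivAt_dt hφ _ _).deriv,
    (hasDerivAt_dx hφ _ _).deriv]
  have hpos : ∀ z ∈ Ioc 0 R ×ˢ Ioc (-R) R, 0 < z.1 := fun z hz => hz.1.1
  have hC0 : 0 ≤ C := (abs_nonneg _).trans (hC 0).1
  have i1 : IntegrableOn (fun z : ℝ × ℝ => |sol z.1 z.2 - k| * dt φ z)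
      (Ioc 0 R ×ˢ Ioc (-R) R) := by
    refine integrableOn_rectangle_of_bounded (C := (3 + |k|) * C)
      ((aemeasurable_comp_sol hpos (β := fun w => |w - k|) (measurable_id.sub_const k).abs).mul
        (continuous_dt hφ).measurable.aemeasurable).aestronglyMeasurable fun z hz => ?_
    rw [abs_mul, abs_abs]
    exact mul_le_mul (abs_sol_sub_le (hpos z hz) _ k) (hC z).2.1 (abs_nonneg _) (by positivity)
  have i2 : IntegrableOn (fun z : ℝ × ℝ => kruzkovFlux k (sol z.1 z.2) * dx φ z)
      (Ioc 0 R ×ˢ Ioc (-R) R) := by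
    refine integrableOn_rectangle_of_bounded (C := (3 + |k|) * (3 + |k|) * C)
      ((aemeasurable_comp_sol hpos (measurable_kruzkovFlux k)).mul
        (continuous_dx hφ).measurable.aemeasurable).aestronglyMeasurable fun z hz => ?_
    rw [abs_mul]
    exact mul_le_mul (abs_flux_sol_le (hpos z hz) _ k) (hC z).2.2 (abs_nonneg _) (by positivity)
  have i3 : IntegrableOn (fun z : ℝ × ℝ => Real.sign (sol z.1 z.2 - k) * force z.2 * φ z)
      (Ioc 0 R ×ˢ Ioc (-R) R) := by
    refine integrableOn_rectangle_of_bounded (C := 8 * C)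
      (((aemeasurable_comp_sol hpos (measurable_sign_sub k)).mul
        (continuous_force.measurable.comp measurable_snd).aemeasurable).mul
        hφ.continuous.measurable.aemeasurable).aestronglyMeasurable fun z _ => ?_
    rw [abs_mul, abs_mul]
    refine mul_le_mul ?_ (hC z).1 (abs_nonneg _) (by norm_num)
    exact (mul_le_mul (abs_sign_le _) (abs_force_le z.2) (abs_nonneg _) zero_le_one).trans
      (by norm_num)
  have e1 := integral_halfPlane_eq i1 fun z hz => by simp [(h0 z hz).2.1]
  have e2 := integral_halfPlane_eq i2 fun z hz => by simp [(h0 z hz).2.2]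
  have e3 := integral_halfPlane_eq i3 fun z hz => by simp [(h0 z hz).1]
  rw [e1, e2, e3, ← integral_add i1 i2]
  exact (integral_sub (i1.add i2) i3).symm

theorem integral_reflect_strip (hφ : ContDiff ℝ 1 φ)
    (hC : ∀ z, |φ z| ≤ C ∧ |dt φ z| ≤ C ∧ |dx φ z| ≤ C) (hR : 0 ≤ R) (k : ℝ) :
    ∫ z in Ioc 0 R ×ˢ Ioc (-R) 0, kruzkovBalance k φ z
      = ∫ z in Ioc 0 R ×ˢ Ioc 0 R, kruzkovBalance (-k) (reflect φ) z := by
  have hC' : ∀ z, |reflect φ z| ≤ C ∧ |dt (reflect φ) z| ≤ C ∧ |dx (reflect φ) z| ≤ C :=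
    fun z => by
      rw [dt_reflect hφ, dx_reflect hφ, abs_neg]
      exact hC (z.1, -z.2)
  have i1 := integrableOn_kruzkovBalance hφ hC k R (-R) 0
  have i2 := integrableOn_kruzkovBalance (contDiff_reflect hφ) hC' (-k) R 0 R
  rw [Measure.volume_eq_prod] at i1 i2 ⊢
  rw [setIntegral_prod _ i1, setIntegral_prod _ i2]
  refine integral_congr_ae (Eventually.of_forall fun t => ?_)
  simp only [← kruzkovBalance_reflect hφ]
  rw [← intervalIntegral.integral_of_le (neg_nonpos.2 hR), ← intervalIntegral.integral_of_le hR,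
    intervalIntegral.integral_comp_neg (fun x => kruzkovBalance k φ (t, x)), neg_zero]

theorem integral_datum (hφ : Continuous φ) (h0 : ∀ z : ℝ × ℝ, R ≤ ‖z‖ → φ z = 0)
    (hR : 0 ≤ R) (k : ℝ) :
    ∫ x, |datum x - k| * φ (0, x)
      = (∫ x in Ioc 0 R, |2 - k| * φ (0, x)) + ∫ x in Ioc 0 R, |2 - -k| * reflect φ (0, x) := by
  have hc : Continuous fun x : ℝ => φ (0, x) := hφ.comp (Continuous.prodMk_right 0)
  have hp : ∫ x in Ioc 0 R, |datum x - k| * φ (0, x) = ∫ x in Ioc 0 R, |2 - k| * φ (0, x) :=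
    setIntegral_congr_fun measurableSet_Ioc fun x hx => by simp [datum, hx.1.not_gt]
  -- Only almost everywhere: the interval contains 0, where `datum` takes the value 2.
  have hae : ∀ᵐ x ∂(volume.restrict (Ioc (-R) 0)),
      |-2 - k| * φ (0, x) = |datum x - k| * φ (0, x) := by
    filter_upwards [ae_restrict_mem measurableSet_Ioc,
      ae_restrict_of_ae (Measure.ae_ne volume (0 : ℝ))] with x hx hx0
    simp [datum, lt_of_le_of_ne hx.2 hx0]
  have ip : IntegrableOn (fun x => |datum x - k| * φ (0, x)) (Ioc 0 R) :=
    ((hc.const_mul |2 - k|).integrableOn_Ioc).congr_fun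
      (fun x hx => by simp [datum, hx.1.not_gt]) measurableSet_Ioc
  have im : IntegrableOn (fun x => |datum x - k| * φ (0, x)) (Ioc (-R) 0) :=
    ((hc.const_mul |-2 - k|).integrableOn_Ioc).congr_fun_ae hae
  have hm : ∫ x in Ioc (-R) 0, |datum x - k| * φ (0, x)
      = ∫ x in Ioc 0 R, |2 - -k| * reflect φ (0, x) := by
    rw [← integral_congr_ae hae, ← intervalIntegral.integral_of_le (neg_nonpos.2 hR),
      ← intervalIntegral.integral_of_le hR]
    have := intervalIntegral.integral_comp_neg (a := 0) (b := R)
      (fun x => |-2 - k| * φ (0, x))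
    rw [neg_zero] at this
    rw [← this, show (2 : ℝ) - -k = -(-2 - k) by ring, abs_neg]
    rfl
  rw [← setIntegral_eq_integral_of_forall_compl_eq_zero (s := Ioc (-R) R) fun x hx => ?_,
    ← Ioc_union_Ioc_eq_Ioc (neg_nonpos.2 hR) hR,
    setIntegral_union (Ioc_disjoint_Ioc_of_le le_rfl) measurableSet_Ioc im ip, hp, hm, add_comm]
  rw [h0 (0, x), mul_zero]
  exact le_trans (le_of_not_gt fun h : |x| < R => hx ⟨(abs_lt.1 h).1, (abs_lt.1 h).2.le⟩)
    (norm_snd_le ((0 : ℝ), x))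

theorem integrableOn_flux_trace (hφ : Continuous φ) (hC : ∀ z, |φ z| ≤ C) (k R : ℝ) :
    IntegrableOn (fun t => kruzkovFlux k (trace t) * φ (t, 0)) (Ioc 0 R) := by
  refine ⟨(((measurable_kruzkovFlux k).comp_aemeasurable (aemeasurable_trace R)).mul
    (hφ.comp (Continuous.prodMk_left 0)).measurable.aemeasurable).aestronglyMeasurable,
    HasFiniteIntegral.restrict_of_bounded ((3 + |k|) * (3 + |k|) * C) measure_Ioc_lt_top
    (ae_restrict_of_forall_mem measurableSet_Ioc fun t ht => ?_)⟩
  rw [Real.norm_eq_abs, abs_mul]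
  have ht3 := abs_trace_le ht.1
  refine mul_le_mul ?_ (hC _) (abs_nonneg _) (by positivity)
  refine (abs_kruzkovFlux_le (M := 3 + |k|) (by linarith) (by linarith [abs_nonneg k])).trans ?_
  exact mul_le_mul_of_nonneg_left ((abs_sub _ _).trans (by linarith)) (by positivity)

theorem memLp_sol : MemLp (fun z : ℝ × ℝ => sol z.1 z.2) ⊤
    (volume.restrict (Ioi (0 : ℝ) ×ˢ (univ : Set ℝ))) :=
  memLp_top_of_bound aemeasurable_sol.aestronglyMeasurable 3
    (ae_restrict_of_forall_mem (measurableSet_Ioi.prod MeasurableSet.univ) fun z hz =>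
      abs_sol_le hz.1 z.2)

theorem memLp_datum : MemLp datum ⊤ volume :=
  memLp_top_of_bound (Measurable.ite measurableSet_Iio measurable_const
    measurable_const).aestronglyMeasurable 2
    (Eventually.of_forall fun x => by unfold datum; split_ifs <;> norm_num)

theorem isEntropySolution_sol : IsEntropySolution ham datum sol := by
  refine ⟨memLp_datum, memLp_sol, fun φ hφ' hs hnn k => ?_⟩
  have hφ : ContDiff ℝ 1 φ := hφ'.of_le (by exact_mod_cast le_top)
  obtain ⟨R, C, hR, h0, hC⟩ := exists_radius_bound hφ hs
  have hCr : ∀ z, |reflect φ z| ≤ C ∧ |dt (reflect φ) z| ≤ C ∧ |dx (reflect φ) z| ≤ C :=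
    fun z => by
      rw [dt_reflect hφ, dx_reflect hφ, abs_neg]
      exact hC (z.1, -z.2)
  have hT : ∀ x, φ (R, x) = 0 := fun x =>
    (h0 _ ((le_abs_self R).trans (norm_fst_le (R, x)))).1
  have hX : ∀ t, φ (t, R) = 0 := fun t =>
    (h0 _ ((le_abs_self R).trans (norm_snd_le (t, R)))).1
  have hX' : ∀ t, reflect φ (t, R) = 0 := fun t =>
    (h0 _ ((neg_le_abs (-R)).trans' (neg_neg R).ge |>.trans (norm_snd_le (t, -R)))).1
  rw [entropy_volume_terms hφ h0 hC, integral_datum hφ.continuous (fun z hz => (h0 z hz).1) hR.le,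
    ← Ioc_union_Ioc_eq_Ioc (neg_nonpos.2 hR.le) hR.le, prod_union,
    setIntegral_union (Disjoint.set_prod_right (Ioc_disjoint_Ioc_of_le le_rfl) _ _)
      (measurableSet_Ioc.prod measurableSet_Ioc) (integrableOn_kruzkovBalance hφ hC _ _ _ _)
      (integrableOn_kruzkovBalance hφ hC _ _ _ _),
    integral_reflect_strip hφ hC hR.le,
    integral_kruzkovBalance_quadrant (contDiff_reflect hφ) hCr (fun x => hT (-x)) hX' hR hR,
    integral_kruzkovBalance_quadrant hφ hC hT hX hR hR]
  have i1 := integrableOn_flux_trace hφ.continuous (fun z => (hC z).1) k R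
  have i2 := integrableOn_flux_trace (contDiff_reflect hφ).continuous (fun z => (hCr z).1) (-k) R
  -- The initial terms of the two quadrants cancel against the integral of the datum; what remains
  -- is minus this shock contribution.
  have hneg : (∫ t in Ioc 0 R, kruzkovFlux k (trace t) * φ (t, 0))
      + ∫ t in Ioc 0 R, kruzkovFlux (-k) (trace t) * reflect φ (t, 0) ≤ 0 := by
    rw [← integral_add i1 i2]
    refine setIntegral_nonpos measurableSet_Ioc fun t ht => ?_
    simp only [reflect, neg_zero]
    rw [← add_mul]
    exact mul_nonpos_of_nonpos_of_nonneg (kruzkovFlux_add_nonpos k (trace_nonpos ht.1))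
      (hnn t 0 ht.1.le)
  linarith

end Entropy

end ScalarCL

theorem proposition5p14 :
    -- the flow and the map `Δ` are well defined
    (∀ z : ℝ × ℝ, ∃! γ : ℝ → ℝ × ℝ,
      ScalarCL.IsHamiltonianTrajectory ScalarCL.ham γ ∧ γ 0 = z) ∧
    (∀ t x : ℝ, 0 < t → 0 < x → ∃! d : ℝ × ℝ, ScalarCL.IsStartingPoint t x d) ∧
    -- `u` is a bounded entropy solution
    MemLp (fun z : ℝ × ℝ => ScalarCL.sol z.1 z.2) ⊤
      (volume.restrict (Ioi (0 : ℝ) ×ˢ (univ : Set ℝ))) ∧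
    ScalarCL.IsEntropySolution ScalarCL.ham ScalarCL.datum ScalarCL.sol ∧
    -- it is classical outside `x = 0` and `|x| = q♯(t)`, and attains the datum pointwise
    (∀ t x : ℝ, 0 < t → x ≠ 0 → |x| ≠ ScalarCL.qSharp t →
      ScalarCL.IsClassicalSolutionAt ScalarCL.ham ScalarCL.sol t x) ∧
    (∀ x : ℝ, x ≠ 0 →
      Tendsto (fun t => ScalarCL.sol t x) (𝓝[>] 0) (𝓝 (ScalarCL.datum x))) ∧
    -- it is continuous along `|x| = q♯(t)`
    (∀ t x : ℝ, 0 < t → |x| = ScalarCL.qSharp t →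
      ContinuousAt (fun z : ℝ × ℝ => ScalarCL.sol z.1 z.2) (t, x)) ∧
    -- it has a stationary entropic shock along `x = 0`
    (∀ t : ℝ, Real.pi / (2 * Real.sqrt 2) < t →
      ScalarCL.HasStationaryEntropicShock ScalarCL.ham ScalarCL.sol t 0) :=
  ⟨ScalarCL.existsUnique_trajectory,
    fun _ _ ht hx => ScalarCL.existsUnique_isStartingPoint ht hx,
    ScalarCL.memLp_sol,
    ScalarCL.isEntropySolution_sol,
    fun _ _ ht hx hq => ScalarCL.isClassicalSolutionAt_sol ht hx hq,
    fun _ hx => ScalarCL.tendsto_sol_datum hx,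
    -- Since q♯(t) > 0, the curve avoids x = 0, and u is continuous everywhere off that line.
    fun _ _ ht hq => ScalarCL.continuousAt_sol ht
      (abs_pos.1 (hq ▸ ScalarCL.qSharp_pos ht)),
    fun _ ht => ScalarCL.hasStationaryEntropicShock_sol ht⟩
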